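/- Let $d_1,d_2,d'\ge 1$ be integers, $A=\mathbb R^{d'}$, $T>0$, $\epsilon>0$, and let $b:\mathbb R^{d_1}\times A\to\mathbb R^{d_1}$, $\ell:A\to\mathbb R$, $L:\mathbb R^{d_1}\times\mathbb R^{d_2}\to\mathbb R$ satisfy: (i) $b$ is $C^4$, $b(x,0)=0$ for all $x$, and there is $C\ge 0$ with $|\nabla_x^k\nabla_a^l b(x,a)|\le C(1+|a|^{k+1})(1+|x|^l)$ for all $(x,a)$ and all integers $k,l\ge0$ with $k+l\le 4$; (ii) $\ell$ is $C^2$ and convex, and $\nabla^2\ell(a)\ge c(1+|a|^2)I_{d'}$ for some $c>0$ and all $a\in A$; put $\nu^\infty(da)=e^{-\ell(a)}da\big/\int_A e^{-\ell(a')}da'$; (iii) $L$ is bounded from below and three times differentiable, and for some $C\ge0$ one has $|L(x,y)|\le C(1+|x|^2+|y|^2)$ and $|\nabla^jL(x,y)|\le C(1+|x|+|y|)$ for $j=1,2,3$ and all $(x,y)$. Let $\mathcal P_2=\mathcal P_2(\mathbb R^{d_1}\times\mathbb R^{d_2})$ be the set of Borel probability measures on $\mathbb R^{d_1}\times\mathbb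 R^{d_2}$ with finite second moment, with the Monge–Kantorovich–Rubinstein distance $d_2$ of order two for the Euclidean norm. Let $\mathcal E(\nu|\nu^\infty)=\int_A\log\frac{d\nu}{d\nu^\infty}\,d\nu$ if $\nu\ll\nu^\infty$ and $+\infty$ otherwise. For $t_0\in[0,T]$, let $\mathcal A(t_0)$ be the set of measurable maps $\boldsymbol\nu=(\nu_t)_{t\in[t_0,T]}$ into the Borel probability measures on $A$ with $\int_{t_0}^T\mathcal E(\nu_t|\nu^\infty)\,dt<\infty$. For $\gamma_0\in\mathcal P_2$ and $\boldsymbol\nu\in\mathcal A(t_0)$, let $\boldsymbol\gamma\in C([t_0,T],\mathcal P_2)$ be the distributional solution of $$\partial_t\gamma_t+\operatorname{div}_x\big(b(x,\nu_t)\gamma_t\big)=0,\qquad \gamma_{t_0}=\gamma_0,\qquad b(x,\nu)=\int_A b(x,a)\,d\nu(a),$$ that is, for every $t_1\in[t_0,T]$ and every $\varphi\in C^1_b([t_0,T]\times\mathbb R^{d_1}\times\mathbb R^{d_2})$, $$\int\varphi_{t_1}\,d\gamma_{t_1}=\int\varphi_{t_0}\,d\gamma_0+\int_{t_0}^{t_1}\!\int\{\partial_t\varphi_t(x,y)+b(x,\nu_t)\cdot\nabla_x\varphi_t(x,y)\}\,d\gamma_t(x,y)\,dt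 .$$ Set $$J((t_0,\gamma_0),\boldsymbol\nu)=\int L\,d\gamma_T+\epsilon\int_{t_0}^T\mathcal E(\nu_t|\nu^\infty)\,dt,\qquad U(t_0,\gamma_0)=\inf_{\boldsymbol\nu\in\mathcal A(t_0)}J((t_0,\gamma_0),\boldsymbol\nu).$$ Then $U$ is well defined with values in $\mathbb R$ (the set of attained costs is nonempty and bounded below), and $U$ is locally Lipschitz continuous on $[0,T]\times\mathcal P_2$. More precisely, there is a nondecreasing function $\Lambda:\mathbb R_+\to\mathbb R_+$ such that, for all $(t_1,\gamma_1),(t_2,\gamma_2)\in[0,T]\times\mathcal P_2$, $$|U(t_2,\gamma_2)-U(t_1,\gamma_1)|\le \sup_{i=1,2}\Lambda\Big(\int(|x|^2+|y|^2)\,d\gamma_i(x,y)\Big)\,\big(|t_2-t_1|+d_2(\gamma_1,\gamma_2)\big).$$ -/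

import Mathlib

open Set Filter Topology MeasureTheory InformationTheory
open scoped NNReal ENNReal

noncomputable section

namespace MeanFieldResNet

/-- `ℝ^d` with its Euclidean norm. -/
abbrev E (d : ℕ) : Type := EuclideanSpace ℝ (Fin d)

variable {d₁ d₂ d' : ℕ}

/-- The second moment `∫ (|x|² + |y|²) dγ(x, y)`, as an extended nonnegative number. -/
def secondMoment (γ : Measure (E d₁ × E d₂)) : ℝ≥0∞ :=
  ∫⁻ p, (‖p.1‖ₑ ^ 2 + ‖p.2‖ₑ ^ 2) ∂γ

/-- `𝒫₂(ℝ^{d₁} × ℝ^{d₂})`: Borel probability measures with finite second moment. -/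
def P2 (d₁ d₂ : ℕ) : Type :=
  {γ : Measure (E d₁ × E d₂) // IsProbabilityMeasure γ ∧ secondMoment γ ≠ ∞}

/-- The measure underlying an element of `𝒫₂`. -/
def P2.toMeasure (γ : P2 d₁ d₂) : Measure (E d₁ × E d₂) := γ.1

/-- The second moment of an element of `𝒫₂`, as a nonnegative real number. -/
def P2.moment (γ : P2 d₁ d₂) : ℝ≥0 := (secondMoment γ.toMeasure).toNNReal

/-- `Γ(μ, ν)`: the couplings of `μ` and `ν`. -/
def couplings (μ ν : P2 d₁ d₂) : Set (Measure ((E d₁ × E d₂) × (E d₁ × E d₂))) :=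
  {π | π.fst = μ.toMeasure ∧ π.snd = ν.toMeasure}

/-- The Monge-Kantorovich-Rubinstein distance of order two on `𝒫₂`, for the Euclidean norm
`|(x, y)|² = |x|² + |y|²` on `ℝ^{d₁} × ℝ^{d₂}`. -/
def dist2 (μ ν : P2 d₁ d₂) : ℝ :=
  ((⨅ π ∈ couplings μ ν,
    ∫⁻ q, (‖q.1.1 - q.2.1‖ₑ ^ 2 + ‖q.1.2 - q.2.2‖ₑ ^ 2) ∂π) ^ (1 / 2 : ℝ)).toReal

/-- The standing regularity assumptions on the velocity field `b`, the potential `ℓ` of the prior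
and the terminal cost `L`. -/
structure Regularity (b : E d₁ → E d' → E d₁) (ℓ : E d' → ℝ) (L : E d₁ × E d₂ → ℝ) : Prop where
  /-- All derivatives `∇ₓᵏ ∇ₐˡ b`, `k + l ≤ 4`, exist and are jointly continuous. -/
  b_smooth : ContDiff ℝ 4 (fun p : E d₁ × E d' => b p.1 p.2)
  b_growth : ∃ C : ℝ, ∀ k l : ℕ, k + l ≤ 4 → ∀ (x : E d₁) (a : E d'),
    ‖iteratedFDeriv ℝ k (fun x' => iteratedFDeriv ℝ l (fun a' => b x' a') a) x‖
      ≤ C * (1 + ‖a‖ ^ (k + 1)) * (1 + ‖x‖ ^ l)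
  b_zero : ∀ x, b x 0 = 0
  ℓ_smooth : ContDiff ℝ 2 ℓ
  ℓ_convex : ConvexOn ℝ univ ℓ
  /-- `∇² ℓ(a) ≥ c (1 + |a|²) I`, as quadratic forms. -/
  ℓ_hessian : ∃ c : ℝ, 0 < c ∧ ∀ a h : E d',
    c * (1 + ‖a‖ ^ 2) * ‖h‖ ^ 2 ≤ iteratedFDeriv ℝ 2 ℓ a ![h, h]
  L_bddBelow : ∃ m : ℝ, ∀ p, m ≤ L p
  /-- `L` is twice differentiable, with continuous second derivative ... -/
  L_smooth : ContDiff ℝ 2 L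
  /-- ... and the second derivative is differentiable: `L` is three times differentiable. -/
  L_smooth' : Differentiable ℝ (iteratedFDeriv ℝ 2 L)
  L_growth : ∃ C : ℝ, ∀ p : E d₁ × E d₂,
    |L p| ≤ C * (1 + ‖p.1‖ ^ 2 + ‖p.2‖ ^ 2) ∧
    ∀ j : ℕ, 1 ≤ j → j ≤ 3 → ‖iteratedFDeriv ℝ j L p‖ ≤ C * (1 + ‖p.1‖ + ‖p.2‖)

/-- The prior `ν^∞(da) = e^{-ℓ(a)} da / ∫ e^{-ℓ}`. -/
def prior (ℓ : E d' → ℝ) : Measure (E d') :=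
  (volume : Measure (E d')).tilted (fun a => -ℓ a)

/-- The total entropy `∫_{t₀}^T ℰ(ν_t | ν^∞) dt` of a curve of measures, in `[0, ∞]`. For
probability measures `klDiv` is the relative entropy. -/
def totalEntropy (ℓ : E d' → ℝ) (T t₀ : ℝ) (ν : ℝ → Measure (E d')) : ℝ≥0∞ :=
  ∫⁻ t in Icc t₀ T, klDiv (ν t) (prior ℓ)

/-- `ν ∈ 𝒜(t₀)`: a measurable curve `t ∈ [t₀, T] ↦ ν_t` of probability measures on `A = ℝ^{d'}`
with finite total entropy. Values of `ν` outside `[t₀, T]` play no role. -/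
structure IsAdmissible (ℓ : E d' → ℝ) (T t₀ : ℝ) (ν : ℝ → Measure (E d')) : Prop where
  prob : ∀ t ∈ Icc t₀ T, IsProbabilityMeasure (ν t)
  meas : Measurable (fun t : Icc t₀ T => ν t)
  entropy : totalEntropy ℓ T t₀ ν < ∞

/-- The averaged velocity field `b(x, ν) = ∫ b(x, a) dν(a)`. -/
def field (b : E d₁ → E d' → E d₁) (ν : Measure (E d')) (x : E d₁) : E d₁ := ∫ a, b x a ∂ν

/-- Test functions: `φ` and its first derivatives in `(t, x, y)` are continuous, and bounded on
`[t₀, T] × ℝ^{d₁} × ℝ^{d₂}`. (Every `C¹` function up to the boundary of this strip extends to a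
`C¹` function on the whole space.) -/
structure IsTest (T t₀ : ℝ) (φ : ℝ × E d₁ × E d₂ → ℝ) : Prop where
  smooth : ContDiff ℝ 1 φ
  bounded : ∃ C : ℝ, ∀ t ∈ Icc t₀ T, ∀ (x : E d₁) (y : E d₂),
    |φ (t, x, y)| ≤ C ∧ ‖fderiv ℝ φ (t, x, y)‖ ≤ C

/-- `γ ∈ C([t₀, T], 𝒫₂)` is a distributional solution of
`∂_t γ_t + div_x (b(x, ν_t) γ_t) = 0`, `γ_{t₀} = γ₀`. Here
`fderiv ℝ φ (t, x, y) (1, v, 0) = ∂_t φ_t(x, y) + v · ∇ₓ φ_t(x, y)`.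
Values of `γ` outside `[t₀, T]` play no role. -/
structure IsSolution (b : E d₁ → E d' → E d₁) (T t₀ : ℝ) (γ₀ : P2 d₁ d₂)
    (ν : ℝ → Measure (E d')) (γ : ℝ → P2 d₁ d₂) : Prop where
  cont : ∀ t ∈ Icc t₀ T, Tendsto (fun s => dist2 (γ s) (γ t)) (𝓝[Icc t₀ T] t) (𝓝 0)
  init : γ t₀ = γ₀
  weak : ∀ φ : ℝ × E d₁ × E d₂ → ℝ, IsTest T t₀ φ → ∀ t₁ ∈ Icc t₀ T,
    ∫ p, φ (t₁, p.1, p.2) ∂(γ t₁).toMeasure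
      = ∫ p, φ (t₀, p.1, p.2) ∂γ₀.toMeasure
        + ∫ t in t₀..t₁, ∫ p, fderiv ℝ φ (t, p.1, p.2) (1, field b (ν t) p.1, 0)
            ∂(γ t).toMeasure

/-- The total cost `∫ L dγ_T + ε ∫_{t₀}^T ℰ(ν_t | ν^∞) dt` of a control `ν` and its curve `γ`. -/
def totalCost (ε : ℝ) (ℓ : E d' → ℝ) (L : E d₁ × E d₂ → ℝ) (T t₀ : ℝ)
    (ν : ℝ → Measure (E d')) (γ : ℝ → P2 d₁ d₂) : ℝ :=
  ∫ p, L p ∂(γ T).toMeasure + ε * (totalEntropy ℓ T t₀ ν).toReal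

/-- The costs `J((t₀, γ₀), ν)` attained by the controls `ν ∈ 𝒜(t₀)`, the terminal law `γ_T` being
that of the curve driven by `ν` from `(t₀, γ₀)`. -/
def costs (ε : ℝ) (b : E d₁ → E d' → E d₁) (ℓ : E d' → ℝ) (L : E d₁ × E d₂ → ℝ) (T t₀ : ℝ)
    (γ₀ : P2 d₁ d₂) : Set ℝ :=
  {c | ∃ (ν : ℝ → Measure (E d')) (γ : ℝ → P2 d₁ d₂),
    IsAdmissible ℓ T t₀ ν ∧ IsSolution b T t₀ γ₀ ν γ ∧ c = totalCost ε ℓ L T t₀ ν γ}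

/-- The value function `U(t₀, γ₀) = inf_{ν ∈ 𝒜(t₀)} J((t₀, γ₀), ν)`. -/
def U (ε : ℝ) (b : E d₁ → E d' → E d₁) (ℓ : E d' → ℝ) (L : E d₁ × E d₂ → ℝ) (T t₀ : ℝ)
    (γ₀ : P2 d₁ d₂) : ℝ :=
  sInf (costs ε b ℓ L T t₀ γ₀)

end MeanFieldResNet

end

set_option linter.unusedSectionVars false

noncomputable section

namespace MeanFieldResNet

/-! ### Absolutely continuous curves -/

/-! The field b and its first two state derivatives grow at most cubically in the control, uniformly
in the state, while the potential ℓ of the prior grows at least like |a|⁴. The entropy inequality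
therefore gives, for every K, K ∫ (1 + |a|³) dν ≤ ℰ(ν|ν^∞) + ∫ exp(K (1 + |a|³)) dν^∞ with a finite
last term (`Regularity.lintegral_weight_le`). A control of finite total entropy thus drives a field
whose sup norm and Lipschitz constant are integrable in time, and its entropy bounds the
displacement of its flow.

Such a field has a flow Φ, and the push-forward of γ₀ by Φ_t × id solves the continuity equation. It
is the only distributional solution (`IsSolution.unique`): the adjoint equation is discretised by an
explicit Euler scheme, each step of which keeps test functions in a class with two controlled
derivatives and costs a quadratic error. The value function becomes an infimum over controls with
their flows (`Regularity.mem_costs_iff`).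

The constant control ν^∞ has no entropy, so it bounds U from above in terms of the second moment.
Since L is bounded below, near-optimal controls have bounded entropy, hence bounded displacement
(`Regularity.exists_isRun`). Three comparisons of near-optimal controls conclude. In the initial
law, the same control is kept, and the linear growth of ∇L is paired with a near-optimal coupling by
Cauchy-Schwarz (`Regularity.U_le_add_dist2`). To start earlier, one waits under ν^∞, which is free
and moves points at a fixed speed (`Regularity.U_le_of_later`). To start later, the control is
restricted (`Regularity.U_le_of_earlier`); the displacement lost on the short interval need not be
of the order of its length, but the entropy inequality with large K bounds its effect by the entropy
saved there plus a constant times the length. -/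

theorem absolutelyContinuousOnInterval_of_dist_le {α : Type*} [PseudoMetricSpace α] {f : ℝ → α}
    {G : ℝ → ℝ} {a b K : ℝ} (hG : AbsolutelyContinuousOnInterval G a b)
    (h : ∀ x ∈ uIcc a b, ∀ y ∈ uIcc a b, dist (f x) (f y) ≤ K * dist (G x) (G y)) :
    AbsolutelyContinuousOnInterval f a b := by
  have hG' := hG.const_mul K
  rw [absolutelyContinuousOnInterval_iff] at hG' ⊢
  intro ε hε
  obtain ⟨δ, hδ, H⟩ := hG' ε hε
  refine ⟨δ, hδ, fun E hE hE' => lt_of_le_of_lt (Finset.sum_le_sum fun i hi => ?_) (H E hE hE')⟩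
  have h1 := hE.1 i hi
  refine (h _ h1.1 _ h1.2).trans ?_
  rw [Real.dist_eq, Real.dist_eq, ← mul_sub, abs_mul]
  gcongr
  exact le_abs_self K

section ChainRule

variable {F : Type*} [NormedAddCommGroup F] [NormedSpace ℝ F] [FiniteDimensional ℝ F]

/-- The chain rule along the absolutely continuous curve `s ↦ x + ∫ r in a..s, g r`. -/
theorem integral_fderiv_comp_primitive {φ : F → ℝ} (hφ : ContDiff ℝ 1 φ) {g : ℝ → F} {a b : ℝ}
    (hab : a ≤ b) (hg : IntervalIntegrable g volume a b) (x : F) :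
    ∫ s in a..b, fderiv ℝ φ (x + ∫ r in a..s, g r) (g s)
      = φ (x + ∫ r in a..b, g r) - φ x := by
  have hcomplete : CompleteSpace F := FiniteDimensional.complete ℝ F
  have hproper : ProperSpace F := FiniteDimensional.proper ℝ F
  set X : ℝ → F := fun s => x + ∫ r in a..s, g r with hX
  set G : ℝ → ℝ := fun s => ∫ r in a..s, ‖g r‖ with hGdef
  have hsub : ∀ s ∈ uIcc a b, ∀ t ∈ uIcc a b, IntervalIntegrable g volume s t := fun s hs t ht =>
    hg.mono_set (uIcc_subset_uIcc hs ht)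
  have ha : a ∈ uIcc a b := left_mem_uIcc
  have hXd : ∀ s ∈ uIcc a b, ∀ t ∈ uIcc a b, ‖X s - X t‖ ≤ |G s - G t| := by
    intro s hs t ht
    have e1 : X s - X t = ∫ r in t..s, g r := by
      simp only [hX, add_sub_add_left_eq_sub]
      exact intervalIntegral.integral_interval_sub_left (hsub a ha s hs) (hsub a ha t ht)
    have e2 : G s - G t = ∫ r in t..s, ‖g r‖ :=
      intervalIntegral.integral_interval_sub_left (hsub a ha s hs).norm (hsub a ha t ht).norm
    rw [e1, e2]
    exact intervalIntegral.norm_integral_le_abs_integral_norm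
  have hGa : G a = 0 := by simp [hGdef]
  have hGnn : ∀ s ∈ uIcc a b, |G s| ≤ |G b| := by
    intro s hs
    rw [uIcc_of_le hab] at hs
    refine intervalIntegral.abs_integral_mono_interval ?_ (ae_of_all _ fun r => norm_nonneg _) hg.norm
    rw [uIoc_of_le hs.1, uIoc_of_le hab]
    exact Ioc_subset_Ioc_right hs.2
  have hXa : X a = x := by simp [hX]
  have hball : ∀ s ∈ uIcc a b, X s ∈ Metric.closedBall x |G b| := by
    intro s hs
    rw [mem_closedBall_iff_norm]
    have := hXd s hs a ha
    rw [hXa, hGa, sub_zero] at this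
    exact this.trans (hGnn s hs)
  -- The curve stays in a compact ball, on which the C¹ function is Lipschitz. The composition then
  -- inherits absolute continuity from the primitive of ‖g‖.
  obtain ⟨K, hK⟩ := (hφ.contDiffOn (s := Metric.closedBall x |G b|)).exists_lipschitzOnWith
    one_ne_zero (convex_closedBall _ _) (isCompact_closedBall _ _)
  have hGac : AbsolutelyContinuousOnInterval G a b :=
    hg.norm.absolutelyContinuousOnInterval_intervalIntegral ha
  have hac : AbsolutelyContinuousOnInterval (fun s => φ (X s)) a b := by
    refine absolutelyContinuousOnInterval_of_dist_le (K := K) hGac fun s hs t ht => ?_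
    refine (hK.dist_le_mul _ (hball s hs) _ (hball t ht)).trans ?_
    gcongr
    rw [dist_eq_norm, Real.dist_eq]
    exact hXd s hs t ht
  have hder : ∀ᵐ s, s ∈ uIoc a b →
      fderiv ℝ φ (X s) (g s) = deriv (fun s => φ (X s)) s := by
    filter_upwards [hg.ae_hasDerivAt_integral] with s hs hs'
    have h1 : HasDerivAt X (g s) s := (hs (uIoc_subset_uIcc hs') a ha).const_add x
    exact (((hφ.differentiable one_ne_zero) (X s)).hasFDerivAt.comp_hasDerivAt s h1).deriv.symm
  rw [intervalIntegral.integral_congr_ae hder, hac.integral_deriv_eq_sub, hXa]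

end ChainRule

/-- Chain rule for u ↦ exp(2u)/2. The 2 in the exponent makes integration against m a map of norm at
most 1/2 in the weight exp(2 ∫ m), which serves both Grönwall's inequality and the Picard
contraction. -/
theorem integral_mul_exp_primitive {m : ℝ → ℝ} {a t : ℝ} (hat : a ≤ t)
    (hm : IntervalIntegrable m volume a t) :
    ∫ s in a..t, m s * Real.exp (2 * ∫ r in a..s, m r)
      = (Real.exp (2 * ∫ r in a..t, m r) - 1) / 2 := by
  have hφ : ContDiff ℝ 1 (fun u : ℝ => Real.exp (2 * u) / 2) := by fun_prop
  have h := integral_fderiv_comp_primitive hφ hat hm 0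
  have hd : ∀ u v : ℝ, fderiv ℝ (fun u : ℝ => Real.exp (2 * u) / 2) u v
      = v * Real.exp (2 * u) := by
    intro u v
    have h1 : HasDerivAt (fun u : ℝ => Real.exp (2 * u) / 2) (Real.exp (2 * u)) u := by
      have h2 : HasDerivAt (fun u : ℝ => 2 * u) 2 u := by
        simpa using (hasDerivAt_id u).const_mul (2 : ℝ)
      convert! h2.exp.div_const 2 using 1
      ring
    rw [h1.hasFDerivAt.fderiv]
    simp
  simp only [hd, zero_add, mul_zero, Real.exp_zero] at h
  rw [h]
  ring

/-- Grönwall's inequality with an integrable coefficient (and a non-optimal constant). -/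
theorem le_exp_of_le_add_integral {m u : ℝ → ℝ} {a b A : ℝ} (hab : a ≤ b) (hA : 0 ≤ A)
    (hm : IntervalIntegrable m volume a b) (hm0 : ∀ s, 0 ≤ m s) (hu : ContinuousOn u (Icc a b))
    (h : ∀ t ∈ Icc a b, u t ≤ A + ∫ s in a..t, m s * u s) :
    ∀ t ∈ Icc a b, u t ≤ 2 * A * Real.exp (2 * ∫ s in a..t, m s) := by
  set M : ℝ → ℝ := fun t => ∫ s in a..t, m s with hM
  have hMc : ContinuousOn M (Icc a b) := by
    have := intervalIntegral.continuousOn_primitive_interval' hm (left_mem_uIcc)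
    rwa [uIcc_of_le hab] at this
  have hwc : ContinuousOn (fun t => Real.exp (-(2 * M t)) * u t) (Icc a b) :=
    (hMc.const_smul (2 : ℝ)).neg.rexp.mul hu
  -- At a maximum point of exp(-2M) u, with maximal value W, the hypothesis reads W (exp(2M) + 1) ≤
  -- 2A, whence W ≤ 2A.
  obtain ⟨t₀, ht₀, hmax⟩ := isCompact_Icc.exists_isMaxOn (nonempty_Icc.2 hab) hwc
  set W := Real.exp (-(2 * M t₀)) * u t₀ with hW
  have hle : ∀ t ∈ Icc a b, u t ≤ W * Real.exp (2 * M t) := by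
    intro t ht
    have h1 : Real.exp (-(2 * M t)) * u t ≤ W := hmax ht
    calc u t = (Real.exp (-(2 * M t)) * u t) * Real.exp (2 * M t) := by
          rw [mul_right_comm, ← Real.exp_add]; simp
      _ ≤ _ := by gcongr
  have hMn : ∀ t ∈ Icc a b, 0 ≤ M t := fun t ht =>
    intervalIntegral.integral_nonneg ht.1 fun s _ => hm0 s
  have hb : ∀ t ∈ Icc a b, u t ≤ A + W * ((Real.exp (2 * M t) - 1) / 2) := by
    intro t ht
    have hmt : IntervalIntegrable m volume a t :=
      hm.mono_set (by rw [uIcc_of_le ht.1, uIcc_of_le hab]; exact Icc_subset_Icc_right ht.2)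
    have hsubset : uIcc a t ⊆ Icc a b := by
      rw [uIcc_of_le ht.1]; exact Icc_subset_Icc_right ht.2
    refine (h t ht).trans ?_
    rw [← integral_mul_exp_primitive ht.1 hmt, ← intervalIntegral.integral_const_mul]
    gcongr
    refine intervalIntegral.integral_mono_on ht.1 (hmt.mul_continuousOn (hu.mono hsubset)) ?_ ?_
    · refine (hmt.mul_continuousOn ?_).const_mul W
      exact ((hMc.const_smul (2 : ℝ)).rexp).mono hsubset
    · intro s hs
      have := hle s ⟨hs.1, hs.2.trans ht.2⟩
      nlinarith [hm0 s, mul_le_mul_of_nonneg_left this (hm0 s)]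
  have hWA : W ≤ 2 * A := by
    have h1 := hb t₀ ht₀
    have h2 : u t₀ = W * Real.exp (2 * M t₀) := by
      rw [hW, mul_right_comm, ← Real.exp_add]; simp
    have h3 : 1 ≤ Real.exp (2 * M t₀) := Real.one_le_exp (by linarith [hMn t₀ ht₀])
    rw [h2] at h1
    have h4 : W * (Real.exp (2 * M t₀) + 1) ≤ 2 * A := by linarith
    by_contra hcon
    push Not at hcon
    nlinarith
  intro t ht
  exact (hle t ht).trans (by gcongr)

/-! ### Carathéodory vector fields and their flows -/

section Flow

variable {X : Type*} [NormedAddCommGroup X] [NormedSpace ℝ X] [FiniteDimensional ℝ X]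
  [MeasurableSpace X] [BorelSpace X]

/-- A time-dependent vector field, measurable in time and Lipschitz in space, bounded together with
its Lipschitz constant by a locally integrable function `m` of time. -/
structure IsCaratheodory (V : ℝ → X → X) (m : ℝ → ℝ) : Prop where
  measurable : Measurable (fun p : ℝ × X => V p.1 p.2)
  nonneg : ∀ r, 0 ≤ m r
  intervalIntegrable : ∀ s t, IntervalIntegrable m volume s t
  norm_le : ∀ r x, ‖V r x‖ ≤ m r
  lipschitz : ∀ r x y, ‖V r x - V r y‖ ≤ m r * ‖x - y‖

variable {V : ℝ → X → X} {m : ℝ → ℝ}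

theorem IsCaratheodory.measurable_comp (hV : IsCaratheodory V m) {ξ : ℝ → X} (hξ : Continuous ξ) :
    Measurable (fun s => V s (ξ s)) :=
  hV.measurable.comp (measurable_id.prodMk hξ.measurable)

theorem IsCaratheodory.intervalIntegrable_comp (hV : IsCaratheodory V m) {ξ : ℝ → X}
    (hξ : Continuous ξ) (a b : ℝ) : IntervalIntegrable (fun s => V s (ξ s)) volume a b :=
  (hV.intervalIntegrable a b).mono_fun' (hV.measurable_comp hξ).aestronglyMeasurable
    (ae_of_all _ fun s => hV.norm_le s _)

theorem IsCaratheodory.norm_integral_le (hV : IsCaratheodory V m) (ξ : ℝ → X) {a b : ℝ}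
    (hab : a ≤ b) : ‖∫ s in a..b, V s (ξ s)‖ ≤ ∫ s in a..b, m s :=
  intervalIntegral.norm_integral_le_of_norm_le hab (ae_of_all _ fun s _ => hV.norm_le s _)
    (hV.intervalIntegrable a b)

theorem IsCaratheodory.norm_integral_sub_le (hV : IsCaratheodory V m) {ξ η : ℝ → X}
    (hξ : Continuous ξ) (hη : Continuous η) {a b : ℝ} (hab : a ≤ b) :
    ‖(∫ s in a..b, V s (ξ s)) - ∫ s in a..b, V s (η s)‖ ≤ ∫ s in a..b, m s * ‖ξ s - η s‖ := by
  rw [← intervalIntegral.integral_sub (hV.intervalIntegrable_comp hξ a b)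
    (hV.intervalIntegrable_comp hη a b)]
  exact intervalIntegral.norm_integral_le_of_norm_le hab
    (ae_of_all _ fun s _ => hV.lipschitz s _ _)
    ((hV.intervalIntegrable a b).mul_continuousOn (by fun_prop))

theorem IsCaratheodory.primitive_mono (hV : IsCaratheodory V m) {a s t : ℝ} (hst : s ≤ t) :
    ∫ r in a..s, m r ≤ ∫ r in a..t, m r := by
  rw [← intervalIntegral.integral_add_adjacent_intervals (hV.intervalIntegrable a s)
    (hV.intervalIntegrable s t)]
  linarith [intervalIntegral.integral_nonneg (μ := volume) hst fun r _ => hV.nonneg r]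

/-- An integral curve of `V` on `[a, b]`. -/
structure IsIntegralCurve (V : ℝ → X → X) (a b : ℝ) (ξ : ℝ → X) : Prop where
  continuous : Continuous ξ
  eq : ∀ t ∈ Icc a b, ξ t = ξ a + ∫ s in a..t, V s (ξ s)

theorem IsIntegralCurve.mono_left (hV : IsCaratheodory V m) {a b c : ℝ} {ξ : ℝ → X}
    (h : IsIntegralCurve V a b ξ) (hc : c ∈ Icc a b) : IsIntegralCurve V c b ξ where
  continuous := h.continuous
  eq t ht := by
    rw [h.eq t ⟨hc.1.trans ht.1, ht.2⟩, h.eq c hc, add_assoc,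
      intervalIntegral.integral_add_adjacent_intervals (hV.intervalIntegrable_comp h.continuous _ _)
      (hV.intervalIntegrable_comp h.continuous _ _)]

theorem IsIntegralCurve.norm_sub_le (hV : IsCaratheodory V m) {a b : ℝ} {ξ : ℝ → X}
    (h : IsIntegralCurve V a b ξ) {s t : ℝ} (hs : s ∈ Icc a b) (ht : t ∈ Icc a b) (hst : s ≤ t) :
    ‖ξ t - ξ s‖ ≤ ∫ r in s..t, m r := by
  rw [(h.mono_left hV hs).eq t ⟨hst, ht.2⟩, add_sub_cancel_left]
  exact hV.norm_integral_le _ hst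

theorem IsIntegralCurve.congr {V' : ℝ → X → X} {a b : ℝ} {ξ : ℝ → X}
    (h : IsIntegralCurve V a b ξ) (hVV' : ∀ᵐ s, s ∈ Icc a b → V s = V' s) :
    IsIntegralCurve V' a b ξ where
  continuous := h.continuous
  eq t ht := by
    rw [h.eq t ht]
    congr 1
    refine intervalIntegral.integral_congr_ae ?_
    filter_upwards [hVV'] with s hs hs'
    rw [uIoc_of_le ht.1] at hs'
    rw [hs ⟨hs'.1.le, hs'.2.trans ht.2⟩]

/-- Two integral curves depart from each other at most exponentially. -/
theorem IsIntegralCurve.norm_sub_le_exp (hV : IsCaratheodory V m) {a b : ℝ} {ξ η : ℝ → X}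
    (hab : a ≤ b) (hξ : IsIntegralCurve V a b ξ) (hη : IsIntegralCurve V a b η) :
    ∀ t ∈ Icc a b, ‖ξ t - η t‖ ≤ 2 * ‖ξ a - η a‖ * Real.exp (2 * ∫ s in a..t, m s) := by
  refine le_exp_of_le_add_integral hab (norm_nonneg _) (hV.intervalIntegrable a b) hV.nonneg
    (hξ.continuous.sub hη.continuous).norm.continuousOn fun t ht => ?_
  have h1 := hV.norm_integral_sub_le hξ.continuous hη.continuous ht.1
  calc ‖ξ t - η t‖ = ‖(ξ a - η a) + ((∫ s in a..t, V s (ξ s)) - ∫ s in a..t, V s (η s))‖ := by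
        rw [hξ.eq t ht, hη.eq t ht]; congr 1; abel
    _ ≤ _ := (norm_add_le _ _).trans (by gcongr)

/-- Picard iteration for the unknown Z = exp(-2M) ξ, where M is the primitive of m: in this weight
the map is a contraction of ratio 1/2 on the whole interval at once. The curve is frozen outside the
interval, so that estimates on [a, b] extend to all times. -/
theorem IsCaratheodory.exists_isIntegralCurve (hV : IsCaratheodory V m) {a b : ℝ} (hab : a ≤ b)
    (x : X) : ∃ ξ : ℝ → X, IsIntegralCurve V a b ξ ∧ ξ a = x ∧
      ∀ t, ξ t = ξ (projIcc a b hab t) := by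
  have hcomplete : CompleteSpace X := FiniteDimensional.complete ℝ X
  set M : ℝ → ℝ := fun t => ∫ s in a..t, m s with hM
  have hMc : Continuous M := intervalIntegral.continuous_primitive hV.intervalIntegrable a
  set ext : C(Icc a b, X) → ℝ → X := fun Z s => Real.exp (2 * M s) • Z (projIcc a b hab s)
    with hext
  have hextc : ∀ Z, Continuous (ext Z) := fun Z => by
    have : Continuous (fun s => Z (projIcc a b hab s)) := Z.continuous.comp continuous_projIcc
    fun_prop
  have hprim : ∀ Z, Continuous (fun t => x + ∫ s in a..t, V s (ext Z s)) := fun Z =>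
    continuous_const.add (intervalIntegral.continuous_primitive
      (fun s t => hV.intervalIntegrable_comp (hextc Z) s t) a)
  set G : C(Icc a b, X) → C(Icc a b, X) := fun Z =>
    ⟨fun t => Real.exp (-(2 * M t)) • (x + ∫ s in a..t, V s (ext Z s)),
      ((hMc.const_smul (2 : ℝ)).neg.rexp.smul (hprim Z)).comp continuous_subtype_val⟩ with hG
  have hcontr : ContractingWith (1 / 2) G := by
    refine ⟨by norm_num, LipschitzWith.of_dist_le_mul fun Z Z' => ?_⟩
    rw [ContinuousMap.dist_le (by positivity)]
    rintro ⟨t, ht⟩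
    have e1 : dist (G Z ⟨t, ht⟩) (G Z' ⟨t, ht⟩) = Real.exp (-(2 * M t)) *
        ‖(∫ s in a..t, V s (ext Z s)) - ∫ s in a..t, V s (ext Z' s)‖ := by
      simp only [hG, ContinuousMap.coe_mk, dist_eq_norm, ← smul_sub, add_sub_add_left_eq_sub]
      rw [norm_smul, Real.norm_of_nonneg (Real.exp_pos _).le]
    have e2 : ∫ s in a..t, m s * ‖ext Z s - ext Z' s‖
        ≤ dist Z Z' * ((Real.exp (2 * M t) - 1) / 2) := by
      rw [← integral_mul_exp_primitive ht.1 (hV.intervalIntegrable a t),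
        ← intervalIntegral.integral_const_mul]
      refine intervalIntegral.integral_mono_on ht.1
        ((hV.intervalIntegrable a t).mul_continuousOn
          ((hextc Z).sub (hextc Z')).norm.continuousOn)
        (((hV.intervalIntegrable a t).mul_continuousOn
          (hMc.const_smul (2 : ℝ)).rexp.continuousOn).const_mul _) fun s hs => ?_
      have h3 : ‖ext Z s - ext Z' s‖ ≤ Real.exp (2 * M s) * dist Z Z' := by
        simp only [hext, ← smul_sub]
        rw [norm_smul, Real.norm_of_nonneg (Real.exp_pos _).le, ← dist_eq_norm]
        gcongr
        exact ContinuousMap.dist_apply_le_dist _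
      calc m s * ‖ext Z s - ext Z' s‖ ≤ m s * (Real.exp (2 * M s) * dist Z Z') := by
            gcongr
            exact hV.nonneg s
        _ = _ := by ring
    rw [e1]
    calc _ ≤ Real.exp (-(2 * M t)) * (dist Z Z' * ((Real.exp (2 * M t) - 1) / 2)) := by
          gcongr
          exact (hV.norm_integral_sub_le (hextc Z) (hextc Z') ht.1).trans e2
      _ = (Real.exp (-(2 * M t)) * Real.exp (2 * M t) - Real.exp (-(2 * M t))) / 2
            * dist Z Z' := by ring
      _ ≤ 1 / 2 * dist Z Z' := by
          gcongr
          rw [← Real.exp_add]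
          simp [(Real.exp_pos _).le]
      _ = _ := by norm_num
  obtain ⟨Z, hZ⟩ : ∃ Z, G Z = Z := ⟨_, hcontr.fixedPoint_isFixedPt⟩
  have hZt : ∀ t ∈ Icc a b, ext Z t = x + ∫ s in a..t, V s (ext Z s) := by
    intro t ht
    have h1 : Z ⟨t, ht⟩ = Real.exp (-(2 * M t)) • (x + ∫ s in a..t, V s (ext Z s)) := by
      conv_lhs => rw [← hZ]
      rfl
    rw [hext]
    simp only
    rw [projIcc_of_mem hab ht, h1, smul_smul, ← Real.exp_add]
    simp [hext]
  refine ⟨fun t => ext Z (projIcc a b hab t), ?_, ?_, fun t => ?_⟩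
  · refine ⟨(hextc Z).comp (continuous_subtype_val.comp continuous_projIcc), fun t ht => ?_⟩
    have ha := left_mem_Icc.2 hab
    have e : ∀ s ∈ Icc a b, ext Z (projIcc a b hab s) = ext Z s := fun s hs => by
      rw [projIcc_of_mem hab hs]
    rw [e t ht, e a ha, hZt t ht, hZt a ha]
    simp only [intervalIntegral.integral_same, add_zero]
    congr 1
    refine intervalIntegral.integral_congr fun s hs => ?_
    rw [uIcc_of_le ht.1] at hs
    rw [e s ⟨hs.1, hs.2.trans ht.2⟩]
  · simp only [projIcc_left]
    rw [hZt a (left_mem_Icc.2 hab)]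
    simp
  · simp only [projIcc_val]

/-- `Φ` is a flow of `V` on `[a, b]`, starting from the identity at time `a`. -/
structure IsFlow (V : ℝ → X → X) (a b : ℝ) (Φ : ℝ → X → X) : Prop where
  curve : ∀ x, IsIntegralCurve V a b (fun t => Φ t x)
  init : ∀ x, Φ a x = x
  continuous : Continuous (fun p : ℝ × X => Φ p.1 p.2)

theorem IsCaratheodory.exists_isFlow (hV : IsCaratheodory V m) {a b : ℝ} (hab : a ≤ b) :
    ∃ Φ : ℝ → X → X, IsFlow V a b Φ := by
  choose ξ h1 h2 h3 using fun x => hV.exists_isIntegralCurve hab x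
  refine ⟨fun t x => ξ x t, h1, h2, ?_⟩
  set K := Real.toNNReal (2 * Real.exp (2 * ∫ s in a..b, m s))
  have : Continuous (fun p : X × ℝ => ξ p.1 p.2) := by
    refine continuous_prod_of_continuous_lipschitzWith _ K (fun x => (h1 x).continuous)
      fun t => LipschitzWith.of_dist_le_mul fun x y => ?_
    simp only
    rw [h3 x t, h3 y t, dist_eq_norm, dist_eq_norm, Real.coe_toNNReal _ (by positivity)]
    have ht := (projIcc a b hab t).2
    refine ((h1 x).norm_sub_le_exp hV hab (h1 y) _ ht).trans ?_
    rw [h2, h2]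
    have := hV.primitive_mono (a := a) ht.2
    calc _ ≤ 2 * ‖x - y‖ * Real.exp (2 * ∫ s in a..b, m s) := by gcongr
      _ = _ := by ring
  exact this.comp continuous_swap

end Flow

/-! ### The averaged field -/

section Field

variable {d₁ d' : ℕ}

/-- The cubic weight on the control space. -/
def weight (a : E d') : ℝ := 1 + ‖a‖ ^ 3

theorem one_le_weight (a : E d') : 1 ≤ weight a := le_add_of_nonneg_right (by positivity)

theorem weight_nonneg (a : E d') : 0 ≤ weight a := zero_le_one.trans (one_le_weight a)

theorem continuous_weight : Continuous (weight : E d' → ℝ) := by unfold weight; fun_prop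

/-- The part of the regularity of `b` that involves its derivatives in the state variable only. -/
structure GrowthBound (b : E d₁ → E d' → E d₁) (B : ℝ) : Prop where
  nonneg : 0 ≤ B
  contDiff : ContDiff ℝ 2 (fun p : E d₁ × E d' => b p.1 p.2)
  norm_le : ∀ x a, ‖b x a‖ ≤ B * weight a
  norm_fderiv_le : ∀ x a, ‖fderiv ℝ (fun x' => b x' a) x‖ ≤ B * weight a
  norm_fderiv_fderiv_le : ∀ x a, ‖fderiv ℝ (fderiv ℝ (fun x' => b x' a)) x‖ ≤ B * weight a

/-- Without derivatives in the control the growth factor in x is the constant 1 + |x|⁰ = 2, and for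
k ≤ 2 the factor 1 + |a|^(k+1) is at most twice the cubic weight; hence the constant 4. -/
theorem Regularity.exists_growthBound {d₂ : ℕ} {b : E d₁ → E d' → E d₁} {ℓ : E d' → ℝ}
    {L : E d₁ × E d₂ → ℝ} (h : Regularity b ℓ L) : ∃ B, GrowthBound b B := by
  obtain ⟨C, hC⟩ := h.b_growth
  have key : ∀ k : ℕ, k ≤ 2 → ∀ x a,
      ‖iteratedFDeriv ℝ k (fun x' => b x' a) x‖ ≤ 4 * |C| * weight a := by
    intro k hk x a
    have h1 := hC k 0 (by omega) x a
    have h2 : (fun x' => iteratedFDeriv ℝ 0 (fun a' => b x' a') a)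
        = (continuousMultilinearCurryFin0 ℝ (E d') (E d₁)).symm ∘ fun x' => b x' a := by
      ext x' v
      simp
    rw [h2, LinearIsometryEquiv.norm_iteratedFDeriv_comp_left] at h1
    refine h1.trans ?_
    have h3 : 1 + ‖a‖ ^ (k + 1) ≤ 2 * weight a := by
      unfold weight
      have h0 := norm_nonneg a
      rcases le_total ‖a‖ 1 with h4 | h4
      · have := pow_le_one₀ h0 h4 (n := k + 1)
        have : 0 ≤ ‖a‖ ^ 3 := by positivity
        linarith
      · have := pow_le_pow_right₀ h4 (show k + 1 ≤ 3 by omega)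
        have : 0 ≤ ‖a‖ ^ 3 := by positivity
        linarith
    calc C * (1 + ‖a‖ ^ (k + 1)) * (1 + ‖x‖ ^ 0)
        ≤ |C| * (2 * weight a) * (1 + ‖x‖ ^ 0) := by
          gcongr
          exact le_abs_self C
      _ = 4 * |C| * weight a := by rw [pow_zero]; ring
  refine ⟨4 * |C|, by positivity, h.b_smooth.of_le (by norm_num), fun x a => ?_, fun x a => ?_,
    fun x a => ?_⟩
  · simpa using key 0 (by omega) x a
  · have := key 1 (by omega) x a
    rwa [norm_iteratedFDeriv_one] at this
  · have := key 2 (by omega) x a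
    rwa [← norm_iteratedFDeriv_fderiv, norm_iteratedFDeriv_one] at this

variable {b : E d₁ → E d' → E d₁} {B : ℝ}

theorem GrowthBound.contDiff_left (hb : GrowthBound b B) (a : E d') :
    ContDiff ℝ 2 (fun x => b x a) :=
  hb.contDiff.comp (contDiff_id.prodMk contDiff_const)

theorem GrowthBound.contDiff_fderiv (hb : GrowthBound b B) :
    ContDiff ℝ 1 (fun p : E d₁ × E d' => fderiv ℝ (fun x' => b x' p.2) p.1) := by
  refine ContDiff.fderiv (m := 2) (f := fun (p : E d₁ × E d') x' => b x' p.2) ?_ contDiff_fst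
    (by norm_num)
  exact hb.contDiff.comp (contDiff_snd.prodMk (contDiff_snd.comp contDiff_fst))

theorem GrowthBound.continuous_fderiv_fderiv (hb : GrowthBound b B) :
    Continuous (fun p : E d₁ × E d' => fderiv ℝ (fderiv ℝ (fun x' => b x' p.2)) p.1) := by
  refine (ContDiff.fderiv (m := 1) (n := 0)
    (f := fun (p : E d₁ × E d') x => fderiv ℝ (fun x' => b x' p.2) x) ?_ contDiff_fst
    (by norm_num)).continuous
  exact hb.contDiff_fderiv.comp (contDiff_snd.prodMk (contDiff_snd.comp contDiff_fst))

variable {N : Measure (E d')}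

theorem GrowthBound.integrable (hb : GrowthBound b B) (hN : Integrable weight N) (x : E d₁) :
    Integrable (b x) N :=
  (hN.const_mul B).mono'
    (hb.contDiff.continuous.comp (Continuous.prodMk_right x)).aestronglyMeasurable
    (ae_of_all _ fun a => hb.norm_le x a)

/-- Differentiation under the integral, dominated by a multiple of the weight uniformly in the
state. Total mass one is not required, so that time-integrated controls are covered too. -/
theorem GrowthBound.hasFDerivAt_field (hb : GrowthBound b B) (hN : Integrable weight N)
    (x : E d₁) :
    HasFDerivAt (field b N) (∫ a, fderiv ℝ (fun x' => b x' a) x ∂N) x := by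
  refine hasFDerivAt_integral_of_dominated_of_fderiv_le (s := univ)
    (F' := fun x a => fderiv ℝ (fun x' => b x' a) x) (bound := fun a => B * weight a) univ_mem
    (Eventually.of_forall fun x => (hb.integrable hN x).aestronglyMeasurable) (hb.integrable hN x)
    ?_ (ae_of_all _ fun a x _ => hb.norm_fderiv_le x a) (hN.const_mul B)
    (ae_of_all _ fun a x _ => ?_)
  · exact (hb.contDiff_fderiv.continuous.comp (Continuous.prodMk_right x)).aestronglyMeasurable
  · exact ((hb.contDiff_left a).differentiable (by norm_num) x).hasFDerivAt

theorem GrowthBound.fderiv_field (hb : GrowthBound b B) (hN : Integrable weight N) :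
    fderiv ℝ (field b N) = fun x => ∫ a, fderiv ℝ (fun x' => b x' a) x ∂N :=
  funext fun x => (hb.hasFDerivAt_field hN x).fderiv

theorem GrowthBound.hasFDerivAt_fderiv_field (hb : GrowthBound b B) (hN : Integrable weight N)
    (x : E d₁) :
    HasFDerivAt (fderiv ℝ (field b N)) (∫ a, fderiv ℝ (fderiv ℝ (fun x' => b x' a)) x ∂N) x := by
  rw [hb.fderiv_field hN]
  have hmeas : ∀ x, AEStronglyMeasurable (fun a => fderiv ℝ (fun x' => b x' a) x) N := fun x =>
    (hb.contDiff_fderiv.continuous.comp (Continuous.prodMk_right x)).aestronglyMeasurable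
  refine hasFDerivAt_integral_of_dominated_of_fderiv_le (s := univ)
    (F := fun x a => fderiv ℝ (fun x' => b x' a) x)
    (F' := fun x a => fderiv ℝ (fderiv ℝ (fun x' => b x' a)) x) (bound := fun a => B * weight a)
    univ_mem (Eventually.of_forall hmeas)
    ((hN.const_mul B).mono' (hmeas x) (ae_of_all _ fun a => hb.norm_fderiv_le x a))
    ?_ (ae_of_all _ fun a x _ => hb.norm_fderiv_fderiv_le x a) (hN.const_mul B)
    (ae_of_all _ fun a x _ => ?_)
  · exact (hb.continuous_fderiv_fderiv.comp (Continuous.prodMk_right x)).aestronglyMeasurable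
  · have h1 : ContDiff ℝ 1 (fderiv ℝ fun x' => b x' a) :=
      (hb.contDiff_left a).fderiv_right (by norm_num)
    exact (h1.differentiable (by norm_num) x).hasFDerivAt

theorem GrowthBound.contDiff_field (hb : GrowthBound b B) (hN : Integrable weight N) :
    ContDiff ℝ 2 (field b N) := by
  have h1 : ContDiff ℝ 1 (fderiv ℝ (field b N)) := by
    rw [contDiff_one_iff_hasFDerivAt]
    refine ⟨_, ?_, hb.hasFDerivAt_fderiv_field hN⟩
    refine continuous_of_dominated (bound := fun a => B * weight a) (fun x => ?_)
      (fun x => ae_of_all _ fun a => hb.norm_fderiv_fderiv_le x a) (hN.const_mul B)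
      (ae_of_all _ fun a => ?_)
    · exact (hb.continuous_fderiv_fderiv.comp (Continuous.prodMk_right x)).aestronglyMeasurable
    · exact hb.continuous_fderiv_fderiv.comp (Continuous.prodMk_left a)
  rw [show (2 : WithTop ℕ∞) = 1 + 1 by norm_num, contDiff_succ_iff_fderiv]
  exact ⟨fun x => (hb.hasFDerivAt_field hN x).differentiableAt, by simp, h1⟩

theorem GrowthBound.norm_field_le (hb : GrowthBound b B) (hN : Integrable weight N) (x : E d₁) :
    ‖field b N x‖ ≤ B * ∫ a, weight a ∂N := by
  rw [← integral_const_mul]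
  exact norm_integral_le_of_norm_le (hN.const_mul B) (ae_of_all _ fun a => hb.norm_le x a)

theorem GrowthBound.norm_fderiv_field_le (hb : GrowthBound b B) (hN : Integrable weight N)
    (x : E d₁) : ‖fderiv ℝ (field b N) x‖ ≤ B * ∫ a, weight a ∂N := by
  rw [← integral_const_mul, hb.fderiv_field hN]
  exact norm_integral_le_of_norm_le (hN.const_mul B) (ae_of_all _ fun a => hb.norm_fderiv_le x a)

theorem GrowthBound.norm_fderiv_fderiv_field_le (hb : GrowthBound b B) (hN : Integrable weight N)
    (x : E d₁) : ‖fderiv ℝ (fderiv ℝ (field b N)) x‖ ≤ B * ∫ a, weight a ∂N := by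
  rw [← integral_const_mul, (hb.hasFDerivAt_fderiv_field hN x).fderiv]
  exact norm_integral_le_of_norm_le (hN.const_mul B)
    (ae_of_all _ fun a => hb.norm_fderiv_fderiv_le x a)

theorem GrowthBound.norm_field_sub_le (hb : GrowthBound b B) (hN : Integrable weight N)
    (x y : E d₁) : ‖field b N x - field b N y‖ ≤ (B * ∫ a, weight a ∂N) * ‖x - y‖ :=
  convex_univ.norm_image_sub_le_of_norm_fderiv_le
    (fun z _ => (hb.hasFDerivAt_field hN z).differentiableAt)
    (fun z _ => hb.norm_fderiv_field_le hN z) (mem_univ y) (mem_univ x)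

end Field

/-! ### The entropy inequality -/

/-- Fenchel's inequality: the convex conjugate of x log x + 1 - x is exp(y) - 1. For x > 0 it is the
tangent line inequality for exp at y - log x. -/
theorem mul_le_klFun_add_exp {x : ℝ} (hx : 0 ≤ x) (y : ℝ) : x * y ≤ klFun x + Real.exp y := by
  rw [klFun_apply]
  rcases hx.eq_or_lt with rfl | hx
  · simp; positivity
  · have h1 := Real.add_one_le_exp (y - Real.log x)
    rw [Real.exp_sub, Real.exp_log hx, le_div_iff₀ hx] at h1
    nlinarith

/-- Half of the Donsker-Varadhan variational formula. -/
theorem lintegral_le_klDiv_add {α : Type*} [MeasurableSpace α] (ν μ : Measure α)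
    [IsFiniteMeasure ν] [IsFiniteMeasure μ] {f : α → ℝ} (hf : Measurable f) :
    ∫⁻ a, ENNReal.ofReal (f a) ∂ν
      ≤ klDiv ν μ + ∫⁻ a, ENNReal.ofReal (Real.exp (f a)) ∂μ := by
  by_cases hac : ν ≪ μ
  swap
  · simp [klDiv_of_not_ac hac]
  -- Written with the density dν/dμ, both sides are integrals against μ and can be compared
  -- pointwise.
  rw [klDiv_eq_lintegral_klFun_of_ac hac, ← lintegral_add_right _ (by fun_prop),
    ← lintegral_rnDeriv_mul hac (by fun_prop)]
  refine lintegral_mono_ae ?_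
  filter_upwards [ν.rnDeriv_lt_top μ] with a ha
  rw [← ENNReal.ofReal_add (klFun_nonneg ENNReal.toReal_nonneg) (Real.exp_pos _).le]
  nth_rewrite 1 [← ENNReal.ofReal_toReal ha.ne]
  rw [← ENNReal.ofReal_mul ENNReal.toReal_nonneg]
  exact ENNReal.ofReal_le_ofReal (mul_le_klFun_add_exp ENNReal.toReal_nonneg _)

/-! ### Exponential moments of the prior -/

section Prior

variable {d₁ d₂ d' : ℕ} {b : E d₁ → E d' → E d₁} {ℓ : E d' → ℝ} {L : E d₁ × E d₂ → ℝ}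

/-- Along the ray s ↦ s a the second derivative of ℓ is at least c s² |a|⁴, that of (c/12) |a|⁴ s⁴.
The difference is convex in s, so its slope between 0 and 1 dominates its derivative at 0. -/
theorem Regularity.exists_le_potential (h : Regularity b ℓ L) :
    ∃ c > 0, ∃ D, 0 ≤ D ∧ ∀ a, ℓ 0 - D * ‖a‖ + c * ‖a‖ ^ 4 ≤ ℓ a := by
  obtain ⟨c, hc, hh⟩ := h.ℓ_hessian
  refine ⟨c / 12, by positivity, ‖fderiv ℝ ℓ 0‖, norm_nonneg _, fun a => ?_⟩
  have hl : ∀ s : ℝ, HasDerivAt (fun s : ℝ => s • a) a s := fun s => by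
    simpa using (hasDerivAt_id s).smul_const a
  have hd1 : ∀ s : ℝ, HasDerivAt (fun s : ℝ => ℓ (s • a)) (fderiv ℝ ℓ (s • a) a) s := fun s =>
    ((h.ℓ_smooth.differentiable (by norm_num)) (s • a)).hasFDerivAt.comp_hasDerivAt s (hl s)
  have hf1 : ContDiff ℝ 1 (fderiv ℝ ℓ) := h.ℓ_smooth.fderiv_right (by norm_num)
  have hd2 : ∀ s : ℝ, HasDerivAt (fun s : ℝ => fderiv ℝ ℓ (s • a) a)
      (iteratedFDeriv ℝ 2 ℓ (s • a) ![a, a]) s := fun s => by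
    have h1 := (hf1.differentiable (by norm_num) (s • a)).hasFDerivAt.comp_hasDerivAt s (hl s)
    have h2 := h1.clm_apply (hasDerivAt_const s a)
    simpa [iteratedFDeriv_two_apply] using h2
  set g : ℝ → ℝ := fun s => ℓ (s • a) - c / 12 * ‖a‖ ^ 4 * s ^ 4 with hg
  have hg1 : ∀ s, HasDerivAt g (fderiv ℝ ℓ (s • a) a - c / 12 * ‖a‖ ^ 4 * (4 * s ^ 3)) s := fun s =>
    (hd1 s).sub (by simpa using (hasDerivAt_pow 4 s).const_mul (c / 12 * ‖a‖ ^ 4))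
  have hg1' : deriv g = fun s => fderiv ℝ ℓ (s • a) a - c / 12 * ‖a‖ ^ 4 * (4 * s ^ 3) :=
    funext fun s => (hg1 s).deriv
  have hg2 : ∀ s, HasDerivAt (deriv g) (iteratedFDeriv ℝ 2 ℓ (s • a) ![a, a]
      - c / 12 * ‖a‖ ^ 4 * (4 * (3 * s ^ 2))) s := fun s => by
    rw [hg1']
    exact (hd2 s).sub (by
      simpa using ((hasDerivAt_pow 3 s).const_mul 4).const_mul (c / 12 * ‖a‖ ^ 4))
  have hconv : ConvexOn ℝ univ g := by
    refine convexOn_univ_of_deriv2_nonneg (fun s => (hg1 s).differentiableAt)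
      (fun s => (hg2 s).differentiableAt) fun s => ?_
    rw [Function.iterate_succ, Function.iterate_one, Function.comp_apply, (hg2 s).deriv]
    have := hh (s • a) a
    rw [norm_smul, Real.norm_eq_abs, mul_pow, sq_abs] at this
    have h0 : 0 ≤ c * ‖a‖ ^ 2 := by positivity
    nlinarith
  have h1 := hconv.deriv_le_slope (mem_univ 0) (mem_univ 1) one_pos (hg1 0).differentiableAt
  rw [hg1'] at h1
  simp only [slope_def_field, hg] at h1
  have h2 := (fderiv ℝ ℓ 0).le_opNorm a
  have h3 := neg_abs_le (fderiv ℝ ℓ 0 a)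
  rw [Real.norm_eq_abs] at h2
  norm_num at h1
  linarith

/-- The quartic term absorbs the cubic weight, the linear term and a further u²; that last term
leaves a Gaussian as integrable majorant. -/
theorem exists_pow_four_bound {c : ℝ} (hc : 0 < c) {S : ℝ} (hS : 0 ≤ S) :
    ∃ R, ∀ u : ℝ, 0 ≤ u → S * (1 + u ^ 3) + S * u + u ^ 2 - c * u ^ 4 ≤ R := by
  have hcont : Continuous fun u : ℝ => S * (1 + u ^ 3) + S * u + u ^ 2 - c * u ^ 4 := by fun_prop
  -- Beyond this radius u ≥ 1 and c u ≥ 3S + 1, so c u⁴ dominates the four lower order terms, whose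
  -- sum is at most (3S + 1) u³.
  set r := (3 * S + 1) / c + 1
  have hr : 1 ≤ r := le_add_of_nonneg_left (by positivity)
  obtain ⟨R, hR⟩ := (isCompact_Icc (a := (0 : ℝ)) (b := r)).bddAbove_image hcont.continuousOn
  refine ⟨max R 0, fun u hu => ?_⟩
  rcases le_total u r with h | h
  · exact le_max_of_le_left (hR ⟨u, ⟨hu, h⟩, rfl⟩)
  · refine le_max_of_le_right ?_
    have h1 : 1 ≤ u := hr.trans h
    have h2 : 3 * S + 1 ≤ c * u := by
      have : (3 * S + 1) / c ≤ u := le_trans (by simp [r]) h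
      rw [div_le_iff₀ hc] at this
      linarith
    have h3 : u ≤ u ^ 3 := le_self_pow₀ h1 (by norm_num)
    have h4 : u ^ 2 ≤ u ^ 3 := pow_le_pow_right₀ h1 (by norm_num)
    have h5 : 1 ≤ u ^ 3 := one_le_pow₀ h1
    have h6 : (3 * S + 1) * u ^ 3 ≤ c * u * u ^ 3 := by gcongr
    nlinarith

theorem Regularity.integrable_exp (h : Regularity b ℓ L) (K : ℝ) :
    Integrable (fun a => Real.exp (-ℓ a + K * weight a)) := by
  obtain ⟨c, hc, D, hD, hl⟩ := h.exists_le_potential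
  obtain ⟨R, hR⟩ := exists_pow_four_bound hc (S := |K| + D) (by positivity)
  have hG : Integrable (fun a : E d' => Real.exp (-‖a‖ ^ 2)) := by
    have := (GaussianFourier.integrable_cexp_neg_mul_sq_norm_add (V := E d') (b := 1)
      (by simp) 0 0).norm
    refine this.congr (ae_of_all _ fun a => ?_)
    simp only [Complex.norm_exp]
    congr 1
    norm_cast
    simp
  refine (hG.const_mul (Real.exp (R - ℓ 0))).mono' ?_ (ae_of_all _ fun a => ?_)
  · have h1 := h.ℓ_smooth.continuous
    have h2 := continuous_weight (d' := d')
    exact (by fun_prop : Continuous fun a => Real.exp (-ℓ a + K * weight a)).aestronglyMeasurable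
  · rw [Real.norm_of_nonneg (Real.exp_pos _).le, ← Real.exp_add, Real.exp_le_exp]
    have h1 := hR ‖a‖ (norm_nonneg a)
    have h2 := hl a
    have h3 : K * weight a ≤ |K| * weight a := by
      have := weight_nonneg a
      gcongr
      exact le_abs_self K
    unfold weight at h3 ⊢
    have h4 : 0 ≤ |K| * ‖a‖ := by positivity
    have h5 : 0 ≤ D * (1 + ‖a‖ ^ 3) := by positivity
    nlinarith

theorem Regularity.integrable_exp_neg (h : Regularity b ℓ L) :
    Integrable (fun a => Real.exp (-ℓ a)) := by
  simpa using h.integrable_exp 0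

theorem Regularity.isProbabilityMeasure_prior (h : Regularity b ℓ L) :
    IsProbabilityMeasure (prior ℓ) :=
  isProbabilityMeasure_tilted h.integrable_exp_neg

theorem Regularity.integrable_exp_prior (h : Regularity b ℓ L) (K : ℝ) :
    Integrable (fun a => Real.exp (K * weight a)) (prior ℓ) := by
  rw [prior, integrable_tilted_iff h.integrable_exp_neg]
  simpa [← Real.exp_add] using h.integrable_exp K

/-- The exponential moments of the prior. -/
def expMoment (ℓ : E d' → ℝ) (K : ℝ) : ℝ := ∫ a, Real.exp (K * weight a) ∂(prior ℓ)

theorem expMoment_nonneg (ℓ : E d' → ℝ) (K : ℝ) : 0 ≤ expMoment ℓ K :=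
  integral_nonneg fun _ => (Real.exp_pos _).le

theorem Regularity.expMoment_mono (h : Regularity b ℓ L) : Monotone (expMoment ℓ) :=
  fun K K' hK => integral_mono (h.integrable_exp_prior K) (h.integrable_exp_prior K') fun a => by
    have := weight_nonneg a
    simp only
    gcongr

/-- The scale K is left free: K = 1 bounds displacements, while a large K makes the weight cheap
compared with the entropy. -/
theorem Regularity.lintegral_weight_le (h : Regularity b ℓ L) (K : ℝ) (ν : Measure (E d'))
    [IsProbabilityMeasure ν] :
    ∫⁻ a, ENNReal.ofReal (K * weight a) ∂ν
      ≤ klDiv ν (prior ℓ) + ENNReal.ofReal (expMoment ℓ K) := by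
  have := h.isProbabilityMeasure_prior
  rw [expMoment, ofReal_integral_eq_lintegral_ofReal (h.integrable_exp_prior K)
    (ae_of_all _ fun _ => (Real.exp_pos _).le)]
  exact lintegral_le_klDiv_add _ _ (continuous_weight.measurable.const_mul K)

theorem Regularity.integrable_weight_prior (h : Regularity b ℓ L) :
    Integrable weight (prior ℓ) := by
  refine (h.integrable_exp_prior 1).mono' continuous_weight.aestronglyMeasurable
    (ae_of_all _ fun a => ?_)
  rw [Real.norm_of_nonneg (weight_nonneg a), one_mul]
  linarith [Real.add_one_le_exp (weight a)]

end Prior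

/-! ### Controls with finite weight at all times -/

section Tame

variable {d₁ d₂ d' : ℕ} {b : E d₁ → E d' → E d₁} {ℓ : E d' → ℝ} {L : E d₁ × E d₂ → ℝ}

/-- A measurable family of probability measures whose cubic moments are finite at all times, and
locally integrable in time. -/
structure IsTame (κ : ProbabilityTheory.Kernel ℝ (E d')) : Prop where
  markov : ProbabilityTheory.IsMarkovKernel κ
  integrable : ∀ r, Integrable weight (κ r)
  intervalIntegrable : ∀ s t, IntervalIntegrable (fun r => ∫ a, weight a ∂κ r) volume s t

theorem totalEntropy_congr {T t₀ : ℝ} {ν ν' : ℝ → Measure (E d')}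
    (h : ∀ᵐ t, t ∈ Icc t₀ T → ν t = ν' t) : totalEntropy ℓ T t₀ ν = totalEntropy ℓ T t₀ ν' := by
  refine setLIntegral_congr_fun_ae measurableSet_Icc ?_
  filter_upwards [h] with t ht ht'
  rw [ht ht']

theorem totalEntropy_add {T t₁ t₂ : ℝ} (h₁ : t₁ ≤ t₂) (h₂ : t₂ ≤ T) (ν : ℝ → Measure (E d')) :
    totalEntropy ℓ T t₁ ν = totalEntropy ℓ t₂ t₁ ν + totalEntropy ℓ T t₂ ν := by
  unfold totalEntropy
  rw [← Icc_union_Ioc_eq_Icc h₁ h₂, lintegral_union measurableSet_Ioc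
    (Set.disjoint_left.2 fun x hx hx' => hx'.1.not_ge hx.2), restrict_Ioc_eq_restrict_Icc]

theorem Regularity.lintegral_lintegral_weight_le (h : Regularity b ℓ L) (K : ℝ) {s t : ℝ}
    {ν : ℝ → Measure (E d')} (hν : ∀ r ∈ Icc s t, IsProbabilityMeasure (ν r)) :
    ∫⁻ r in Icc s t, ∫⁻ a, ENNReal.ofReal (K * weight a) ∂ν r
      ≤ totalEntropy ℓ t s ν + ENNReal.ofReal (expMoment ℓ K) * ENNReal.ofReal (t - s) := by
  calc _ ≤ ∫⁻ r in Icc s t, (klDiv (ν r) (prior ℓ) + ENNReal.ofReal (expMoment ℓ K)) := by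
        refine setLIntegral_mono' measurableSet_Icc fun r hr => ?_
        have := hν r hr
        exact h.lintegral_weight_le K (ν r)
    _ = _ := by
        rw [lintegral_add_right _ measurable_const]
        simp [totalEntropy]

theorem IsTame.lintegral_eq {κ : ProbabilityTheory.Kernel ℝ (E d')} (hκ : IsTame κ) (r : ℝ) :
    ∫⁻ a, ENNReal.ofReal (weight a) ∂κ r = ENNReal.ofReal (∫ a, weight a ∂κ r) :=
  (ofReal_integral_eq_lintegral_ofReal (hκ.integrable r) (ae_of_all _ weight_nonneg)).symm

theorem Regularity.integral_weight_le (h : Regularity b ℓ L)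
    {κ : ProbabilityTheory.Kernel ℝ (E d')} (hκ : IsTame κ) {K : ℝ} (hK : 0 ≤ K) {s t : ℝ}
    (hst : s ≤ t) (hfin : totalEntropy ℓ t s κ ≠ ∞) :
    K * ∫ r in s..t, ∫ a, weight a ∂κ r
      ≤ (totalEntropy ℓ t s κ).toReal + expMoment ℓ K * (t - s) := by
  have := hκ.markov
  have h1 := h.lintegral_lintegral_weight_le K (s := s) (t := t) (ν := κ) fun r _ => inferInstance
  have h2 : ∫⁻ r in Icc s t, ∫⁻ a, ENNReal.ofReal (K * weight a) ∂κ r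
      = ENNReal.ofReal (K * ∫ r in s..t, ∫ a, weight a ∂κ r) := by
    rw [intervalIntegral.integral_of_le hst, ENNReal.ofReal_mul hK,
      ofReal_integral_eq_lintegral_ofReal (hκ.intervalIntegrable s t).1
      (ae_of_all _ fun r => integral_nonneg weight_nonneg), restrict_Ioc_eq_restrict_Icc,
      ← lintegral_const_mul' _ _ ENNReal.ofReal_ne_top]
    refine lintegral_congr fun r => ?_
    rw [← hκ.lintegral_eq, ← lintegral_const_mul' _ _ ENNReal.ofReal_ne_top]
    simp_rw [ENNReal.ofReal_mul hK]
  rw [h2, ← ENNReal.ofReal_mul (expMoment_nonneg _ _), ← ENNReal.ofReal_toReal hfin,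
    ← ENNReal.ofReal_add ENNReal.toReal_nonneg
      (mul_nonneg (expMoment_nonneg _ _) (sub_nonneg.2 hst))] at h1
  exact (ENNReal.ofReal_le_ofReal_iff (add_nonneg ENNReal.toReal_nonneg
    (mul_nonneg (expMoment_nonneg _ _) (sub_nonneg.2 hst)))).1 h1

open Classical in
-- By the entropy inequality with K = 1 the weight is finite at almost every time of [t₀, T]. At the
-- exceptional times, and outside the interval, the control is replaced by the prior; a null set of
-- times affects neither the equation nor the entropy.
theorem Regularity.exists_isTame (h : Regularity b ℓ L) {T t₀ : ℝ} {ν : ℝ → Measure (E d')}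
    (hν : IsAdmissible ℓ T t₀ ν) :
    ∃ κ : ProbabilityTheory.Kernel ℝ (E d'), IsTame κ ∧ ∀ᵐ t, t ∈ Icc t₀ T → κ t = ν t := by
  have hprior := h.isProbabilityMeasure_prior
  set ν₁ : ℝ → Measure (E d') := fun t => if t ∈ Icc t₀ T then ν t else prior ℓ with hν₁
  have hν₁m : Measurable ν₁ :=
    Measurable.dite (s := Icc t₀ T) hν.meas (measurable_const (a := prior ℓ)) measurableSet_Icc
  have hwm : Measurable fun a : E d' => ENNReal.ofReal (weight a) :=
    continuous_weight.measurable.ennreal_ofReal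
  have hw₁ : Measurable fun t => ∫⁻ a, ENNReal.ofReal (weight a) ∂ν₁ t :=
    (Measure.measurable_lintegral hwm).comp hν₁m
  have hS : MeasurableSet {t | ∫⁻ a, ENNReal.ofReal (weight a) ∂ν₁ t < ∞} :=
    hw₁ measurableSet_Iio
  set S := {t | ∫⁻ a, ENNReal.ofReal (weight a) ∂ν₁ t < ∞} with hSdef
  have hpw : ∫⁻ a, ENNReal.ofReal (weight a) ∂(prior ℓ) < ∞ :=
    h.integrable_weight_prior.lintegral_lt_top
  let κ : ProbabilityTheory.Kernel ℝ (E d') :=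
    ⟨fun t => if t ∈ S then ν₁ t else prior ℓ, Measurable.ite hS hν₁m measurable_const⟩
  have hκ : ∀ t, κ t = if t ∈ S then ν₁ t else prior ℓ := fun t => rfl
  have hprob : ∀ t, IsProbabilityMeasure (κ t) := by
    intro t
    rw [hκ]
    split_ifs
    · simp only [hν₁]
      split_ifs with h1
      exacts [hν.prob t h1, hprior]
    · exact hprior
  have hkw : ∀ t, ∫⁻ a, ENNReal.ofReal (weight a) ∂κ t < ∞ := by
    intro t
    rw [hκ]
    split_ifs with h1
    exacts [h1, hpw]
  have hint : ∀ r, Integrable weight (κ r) := fun r => by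
    rw [← lintegral_ofReal_ne_top_iff_integrable continuous_weight.aestronglyMeasurable
      (ae_of_all _ weight_nonneg)]
    exact (hkw r).ne
  have hκm : Measurable fun t => ∫⁻ a, ENNReal.ofReal (weight a) ∂κ t :=
    (Measure.measurable_lintegral hwm).comp κ.measurable
  have htot : ∫⁻ t in Icc t₀ T, ∫⁻ a, ENNReal.ofReal (weight a) ∂ν₁ t < ∞ := by
    have h1 := h.lintegral_lintegral_weight_le 1 hν.prob
    simp only [one_mul] at h1
    calc _ = ∫⁻ t in Icc t₀ T, ∫⁻ a, ENNReal.ofReal (weight a) ∂ν t :=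
          setLIntegral_congr_fun measurableSet_Icc fun t ht => by simp only [hν₁, if_pos ht]
      _ ≤ _ := h1
      _ < ∞ := ENNReal.add_lt_top.2 ⟨hν.entropy, ENNReal.mul_lt_top ENNReal.ofReal_lt_top
          ENNReal.ofReal_lt_top⟩
  have hae : ∀ᵐ t, t ∈ Icc t₀ T → κ t = ν t := by
    have h1 := ae_lt_top hw₁ htot.ne
    rw [ae_restrict_iff' measurableSet_Icc] at h1
    filter_upwards [h1] with t ht ht'
    have : t ∈ S := ht ht'
    rw [hκ, if_pos this]
    simp only [hν₁, if_pos ht']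
  have htot' : ∫⁻ t in Icc t₀ T, ∫⁻ a, ENNReal.ofReal (weight a) ∂κ t < ∞ := by
    refine lt_of_le_of_lt (lintegral_mono_ae ?_) htot
    refine (ae_restrict_iff' measurableSet_Icc).2 ?_
    filter_upwards [hae] with t ht ht'
    rw [ht ht']
    simp only [hν₁, if_pos ht', le_refl]
  refine ⟨κ, ⟨⟨hprob⟩, hint, fun s t => ?_⟩, hae⟩
  rw [intervalIntegrable_iff]
  have e : (fun r => ∫ a, weight a ∂κ r)
      = fun r => (∫⁻ a, ENNReal.ofReal (weight a) ∂κ r).toReal := funext fun r =>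
    integral_eq_lintegral_of_nonneg_ae (ae_of_all _ weight_nonneg)
      continuous_weight.aestronglyMeasurable
  rw [e]
  refine integrable_toReal_of_lintegral_ne_top hκm.aemeasurable (ne_of_lt ?_)
  calc ∫⁻ r in uIoc s t, ∫⁻ a, ENNReal.ofReal (weight a) ∂κ r
      ≤ ∫⁻ r in Icc t₀ T ∪ (uIoc s t \ Icc t₀ T), ∫⁻ a, ENNReal.ofReal (weight a) ∂κ r :=
        lintegral_mono_set (by rw [union_sdiff_self]; exact subset_union_right)
    _ ≤ (∫⁻ r in Icc t₀ T, ∫⁻ a, ENNReal.ofReal (weight a) ∂κ r)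
        + ∫⁻ r in uIoc s t \ Icc t₀ T, ∫⁻ a, ENNReal.ofReal (weight a) ∂κ r :=
        lintegral_union_le _ _ _
    _ = (∫⁻ r in Icc t₀ T, ∫⁻ a, ENNReal.ofReal (weight a) ∂κ r)
        + ∫⁻ r in uIoc s t \ Icc t₀ T, ∫⁻ a, ENNReal.ofReal (weight a) ∂(prior ℓ) := by
        congr 1
        refine setLIntegral_congr_fun (measurableSet_uIoc.diff measurableSet_Icc) fun r hr => ?_
        have : κ r = prior ℓ := by
          have h2 : ν₁ r = prior ℓ := if_neg hr.2
          rw [hκ]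
          split_ifs
          exacts [h2, rfl]
        simp only [this]
    _ < ∞ := by
        refine ENNReal.add_lt_top.2 ⟨htot', ?_⟩
        rw [setLIntegral_const]
        refine ENNReal.mul_lt_top hpw (lt_of_le_of_lt (measure_mono sdiff_subset) ?_)
        simp [uIoc]

end Tame

/-! ### The vector field driven by a tame control -/

section Velocity

variable {d₁ d₂ d' : ℕ} {b : E d₁ → E d' → E d₁} {B : ℝ}
  {κ : ProbabilityTheory.Kernel ℝ (E d')}

/-- The bound for the vector field `field b (κ r)` and its first two derivatives. -/
def speed (B : ℝ) (κ : ProbabilityTheory.Kernel ℝ (E d')) (r : ℝ) : ℝ :=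
  B * ∫ a, weight a ∂κ r

theorem GrowthBound.isCaratheodory (hb : GrowthBound b B) (hκ : IsTame κ) :
    IsCaratheodory (fun r => field b (κ r)) (speed B κ) where
  measurable := by
    have := hκ.markov
    have h1 : StronglyMeasurable (fun q : (ℝ × E d₁) × E d' => b q.1.2 q.2) :=
      (hb.contDiff.continuous.comp (by fun_prop :
        Continuous fun q : (ℝ × E d₁) × E d' => (q.1.2, q.2))).stronglyMeasurable
    exact (h1.integral_kernel_prod_right' (κ := κ.comap Prod.fst measurable_fst)).measurable
  nonneg r := mul_nonneg hb.nonneg (integral_nonneg weight_nonneg)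
  intervalIntegrable s t := (hκ.intervalIntegrable s t).const_mul B
  norm_le r x := hb.norm_field_le (hκ.integrable r) x
  lipschitz r x y := hb.norm_field_sub_le (hκ.integrable r) x y

/-- The total control `∫_s^t κ_r dr`. -/
def cumulative (κ : ProbabilityTheory.Kernel ℝ (E d')) (s t : ℝ) : Measure (E d') :=
  (volume.restrict (Ioc s t)).bind κ

theorem IsTame.integrable_cumulative (hκ : IsTame κ) (s t : ℝ) :
    Integrable weight (cumulative κ s t) := by
  rw [cumulative, Measure.integrable_comp_iff continuous_weight.aestronglyMeasurable]
  refine ⟨ae_of_all _ hκ.integrable, ?_⟩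
  simp_rw [Real.norm_of_nonneg (weight_nonneg _)]
  exact (hκ.intervalIntegrable s t).1

theorem integral_cumulative {F : Type*} [NormedAddCommGroup F] [NormedSpace ℝ F]
    (hκ : IsTame κ) {s t : ℝ} (hst : s ≤ t) {f : E d' → F}
    (hf : Integrable f (cumulative κ s t)) :
    ∫ a, f a ∂(cumulative κ s t) = ∫ r in s..t, ∫ a, f a ∂κ r := by
  have := hκ.markov
  rw [cumulative, Measure.comp_eq_comp_const_apply] at hf
  rw [intervalIntegral.integral_of_le hst, cumulative, Measure.comp_eq_comp_const_apply,
    ProbabilityTheory.Kernel.integral_comp hf, ProbabilityTheory.Kernel.const_apply]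

/-- Makes the Euler displacement over [s, t] the averaged field of a single measure, so that its C²
bounds come from those already known for averaged fields. -/
theorem GrowthBound.field_cumulative (hb : GrowthBound b B) (hκ : IsTame κ) {s t : ℝ}
    (hst : s ≤ t) (x : E d₁) :
    field b (cumulative κ s t) x = ∫ r in s..t, field b (κ r) x :=
  integral_cumulative hκ hst (hb.integrable (hκ.integrable_cumulative s t) x)

theorem IsTame.integral_weight_cumulative (hκ : IsTame κ) {s t : ℝ} (hst : s ≤ t) :
    B * ∫ a, weight a ∂(cumulative κ s t) = ∫ r in s..t, speed B κ r := by
  rw [integral_cumulative hκ hst (hκ.integrable_cumulative s t),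
    ← intervalIntegral.integral_const_mul]
  rfl

end Velocity

/-! ### The distance of order two -/

section Distance

variable {d₁ d₂ : ℕ}

/-- The squared Euclidean norm on the product. -/
def sq (p : E d₁ × E d₂) : ℝ := ‖p.1‖ ^ 2 + ‖p.2‖ ^ 2

theorem sq_nonneg' (p : E d₁ × E d₂) : 0 ≤ sq p := by unfold sq; positivity

theorem continuous_sq : Continuous (sq : E d₁ × E d₂ → ℝ) := by unfold sq; fun_prop

theorem ofReal_sq (p : E d₁ × E d₂) : ENNReal.ofReal (sq p) = ‖p.1‖ₑ ^ 2 + ‖p.2‖ₑ ^ 2 := by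
  rw [sq, ENNReal.ofReal_add (by positivity) (by positivity), ENNReal.ofReal_pow (norm_nonneg _),
    ENNReal.ofReal_pow (norm_nonneg _), ofReal_norm, ofReal_norm]

instance (γ : P2 d₁ d₂) : IsProbabilityMeasure γ.toMeasure := γ.2.1

theorem P2.secondMoment_eq (γ : P2 d₁ d₂) :
    secondMoment γ.toMeasure = ∫⁻ p, ENNReal.ofReal (sq p) ∂γ.toMeasure := by
  simp_rw [ofReal_sq]; rfl

theorem P2.integrable_sq (γ : P2 d₁ d₂) : Integrable sq γ.toMeasure := by
  rw [← lintegral_ofReal_ne_top_iff_integrable continuous_sq.aestronglyMeasurable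
    (ae_of_all _ sq_nonneg'), ← P2.secondMoment_eq]
  exact γ.2.2

theorem P2.integral_sq (γ : P2 d₁ d₂) : ∫ p, sq p ∂γ.toMeasure = γ.moment := by
  rw [integral_eq_lintegral_of_nonneg_ae (ae_of_all _ sq_nonneg')
    continuous_sq.aestronglyMeasurable, ← P2.secondMoment_eq]
  rfl

/-- Build an element of `𝒫₂`. -/
def P2.mk' (μ : Measure (E d₁ × E d₂)) (h : IsProbabilityMeasure μ) (hs : Integrable sq μ) :
    P2 d₁ d₂ :=
  ⟨μ, h, by
    have := (lintegral_ofReal_ne_top_iff_integrable continuous_sq.aestronglyMeasurable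
      (ae_of_all _ sq_nonneg')).2 hs
    simp_rw [ofReal_sq] at this
    exact this⟩

theorem sq_sub_le (p q : E d₁ × E d₂) : sq (p - q) ≤ 2 * sq p + 2 * sq q := by
  have h1 : ∀ {n : ℕ} (u v : E n), ‖u - v‖ ^ 2 ≤ 2 * ‖u‖ ^ 2 + 2 * ‖v‖ ^ 2 := fun u v => by
    have := norm_sub_le u v
    have h0 := norm_nonneg (u - v)
    nlinarith [_root_.sq_nonneg (‖u‖ - ‖v‖)]
  unfold sq
  have := h1 p.1 q.1
  have := h1 p.2 q.2
  simp only [Prod.fst_sub, Prod.snd_sub]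
  linarith

/-- The norm on the product type is the maximum of the two norms, whereas the transport cost is
Euclidean. Only this direction of the comparison is needed. -/
theorem norm_sq_le_sq (p : E d₁ × E d₂) : ‖p‖ ^ 2 ≤ sq p := by
  unfold sq
  rcases max_choice ‖p.1‖ ‖p.2‖ with h | h <;> rw [Prod.norm_def, h] <;> nlinarith [norm_nonneg p.1]

theorem dist2_eq (μ ν : P2 d₁ d₂) :
    dist2 μ ν = ((⨅ π ∈ couplings μ ν,
      ∫⁻ q, ENNReal.ofReal (sq (q.1 - q.2)) ∂π) ^ (1 / 2 : ℝ)).toReal := by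
  simp_rw [ofReal_sq]; rfl

theorem dist2_nonneg (μ ν : P2 d₁ d₂) : 0 ≤ dist2 μ ν := ENNReal.toReal_nonneg

theorem isProbabilityMeasure_of_mem_couplings {μ ν : P2 d₁ d₂}
    {π : Measure ((E d₁ × E d₂) × (E d₁ × E d₂))} (hπ : π ∈ couplings μ ν) :
    IsProbabilityMeasure π := by
  have h : IsProbabilityMeasure π.fst := by rw [hπ.1]; infer_instance
  constructor
  rw [← Measure.fst_univ]
  exact h.measure_univ

theorem integrable_sq_fst {μ ν : P2 d₁ d₂}
    {π : Measure ((E d₁ × E d₂) × (E d₁ × E d₂))} (hπ : π ∈ couplings μ ν) :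
    Integrable (fun q => sq q.1) π := by
  have h := μ.integrable_sq
  rw [← hπ.1, Measure.fst] at h
  exact (integrable_map_measure continuous_sq.aestronglyMeasurable
    measurable_fst.aemeasurable).1 h

theorem integrable_sq_snd {μ ν : P2 d₁ d₂}
    {π : Measure ((E d₁ × E d₂) × (E d₁ × E d₂))} (hπ : π ∈ couplings μ ν) :
    Integrable (fun q => sq q.2) π := by
  have h := ν.integrable_sq
  rw [← hπ.2, Measure.snd] at h
  exact (integrable_map_measure continuous_sq.aestronglyMeasurable
    measurable_snd.aemeasurable).1 h

theorem integrable_sq_sub {μ ν : P2 d₁ d₂}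
    {π : Measure ((E d₁ × E d₂) × (E d₁ × E d₂))} (hπ : π ∈ couplings μ ν) :
    Integrable (fun q => sq (q.1 - q.2)) π := by
  refine (((integrable_sq_fst hπ).const_mul 2).add ((integrable_sq_snd hπ).const_mul 2)).mono'
    (continuous_sq.comp (by fun_prop)).aestronglyMeasurable (ae_of_all _ fun q => ?_)
  rw [Real.norm_of_nonneg (sq_nonneg' _)]
  exact sq_sub_le _ _

theorem dist2_le_of_coupling {μ ν : P2 d₁ d₂} {c : ℝ} (hc : 0 ≤ c)
    {π : Measure ((E d₁ × E d₂) × (E d₁ × E d₂))} (hπ : π ∈ couplings μ ν)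
    (h : ∫ q, sq (q.1 - q.2) ∂π ≤ c ^ 2) : dist2 μ ν ≤ c := by
  rw [dist2_eq]
  refine ENNReal.toReal_le_of_le_ofReal hc ?_
  have h1 : ⨅ π ∈ couplings μ ν, ∫⁻ q, ENNReal.ofReal (sq (q.1 - q.2)) ∂π
      ≤ ENNReal.ofReal (c ^ 2) := by
    refine (iInf₂_le π hπ).trans ?_
    rw [← ofReal_integral_eq_lintegral_ofReal (integrable_sq_sub hπ)
      (ae_of_all _ fun q => sq_nonneg' _)]
    exact ENNReal.ofReal_le_ofReal h
  calc _ ≤ ENNReal.ofReal (c ^ 2) ^ (1 / 2 : ℝ) := by gcongr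
    _ = ENNReal.ofReal c := by
      rw [ENNReal.ofReal_rpow_of_nonneg (by positivity) (by norm_num), ← Real.sqrt_eq_rpow,
        Real.sqrt_sq hc]

/-- Near-optimal couplings suffice throughout, so no existence of optimal plans is invoked. The
product coupling shows that the infimum is finite. -/
theorem exists_coupling (μ ν : P2 d₁ d₂) {δ : ℝ} (hδ : 0 < δ) :
    ∃ π ∈ couplings μ ν, ∫ q, sq (q.1 - q.2) ∂π ≤ (dist2 μ ν + δ) ^ 2 := by
  have hlt : ⨅ π ∈ couplings μ ν, ∫⁻ q, ENNReal.ofReal (sq (q.1 - q.2)) ∂π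
      < ENNReal.ofReal ((dist2 μ ν + δ) ^ 2) := by
    set I := ⨅ π ∈ couplings μ ν, ∫⁻ q, ENNReal.ofReal (sq (q.1 - q.2)) ∂π with hI
    have hfin : I ≠ ∞ := by
      have hmem : μ.toMeasure.prod ν.toMeasure ∈ couplings μ ν :=
        ⟨Measure.fst_prod, Measure.snd_prod⟩
      refine ne_of_lt (lt_of_le_of_lt (iInf₂_le _ hmem) ?_)
      exact (integrable_sq_sub hmem).lintegral_lt_top
    have h1 : dist2 μ ν = Real.sqrt I.toReal := by
      rw [dist2_eq, ← hI, ← ENNReal.toReal_rpow, Real.sqrt_eq_rpow]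
    have h2 : I.toReal < (dist2 μ ν + δ) ^ 2 := by
      have h3 := Real.sq_sqrt (ENNReal.toReal_nonneg (a := I))
      rw [← h1] at h3
      nlinarith [dist2_nonneg μ ν]
    exact (ENNReal.lt_ofReal_iff_toReal_lt hfin).2 h2
  obtain ⟨π, h⟩ := iInf_lt_iff.1 hlt
  obtain ⟨hπ, h⟩ := iInf_lt_iff.1 h
  refine ⟨π, hπ, ?_⟩
  rw [← ofReal_integral_eq_lintegral_ofReal (integrable_sq_sub hπ)
      (ae_of_all _ fun q => sq_nonneg' _)] at h
  exact (ENNReal.ofReal_le_ofReal_iff (by positivity)).1 h.le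

theorem integral_mul_le_sqrt_mul_sqrt {α : Type*} [MeasurableSpace α] {μ : Measure α}
    {f g : α → ℝ} (hf0 : ∀ a, 0 ≤ f a) (hg0 : ∀ a, 0 ≤ g a) (hf : AEStronglyMeasurable f μ)
    (hg : AEStronglyMeasurable g μ) (hf2 : Integrable (fun a => f a ^ 2) μ)
    (hg2 : Integrable (fun a => g a ^ 2) μ) :
    ∫ a, f a * g a ∂μ ≤ √(∫ a, f a ^ 2 ∂μ) * √(∫ a, g a ^ 2 ∂μ) := by
  have h := integral_mul_le_Lp_mul_Lq_of_nonneg Real.HolderConjugate.two_two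
    (ae_of_all μ hf0) (ae_of_all μ hg0)
    (by simpa using (memLp_two_iff_integrable_sq hf).2 hf2)
    (by simpa using (memLp_two_iff_integrable_sq hg).2 hg2)
  simpa [Real.sqrt_eq_rpow] using h

theorem integral_norm_sub_le {μ ν : P2 d₁ d₂}
    {π : Measure ((E d₁ × E d₂) × (E d₁ × E d₂))} (hπ : π ∈ couplings μ ν) :
    ∫ q, ‖q.1 - q.2‖ ∂π ≤ √(∫ q, sq (q.1 - q.2) ∂π) := by
  have := isProbabilityMeasure_of_mem_couplings hπ
  have hm : AEStronglyMeasurable (fun q : (E d₁ × E d₂) × (E d₁ × E d₂) => ‖q.1 - q.2‖) π :=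
    (by fun_prop : Continuous fun q : (E d₁ × E d₂) × (E d₁ × E d₂) =>
      ‖q.1 - q.2‖).aestronglyMeasurable
  have hi : Integrable (fun q : (E d₁ × E d₂) × (E d₁ × E d₂) => ‖q.1 - q.2‖ ^ 2) π :=
    (integrable_sq_sub hπ).mono' (hm.pow 2) (ae_of_all _ fun q => by
      rw [Real.norm_of_nonneg (by positivity)]; exact norm_sq_le_sq _)
  have h := integral_mul_le_sqrt_mul_sqrt (μ := π) (f := fun _ => 1) (fun _ => zero_le_one)
    (fun q => norm_nonneg (q.1 - q.2)) aestronglyMeasurable_const hm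
    (by simp) hi
  simp only [one_mul, one_pow, integral_const, probReal_univ, smul_eq_mul, Real.sqrt_one] at h
  refine h.trans (Real.sqrt_le_sqrt ?_)
  exact integral_mono hi (integrable_sq_sub hπ) fun q => norm_sq_le_sq _

theorem integral_fst_of_mem_couplings {μ ν : P2 d₁ d₂}
    {π : Measure ((E d₁ × E d₂) × (E d₁ × E d₂))} (hπ : π ∈ couplings μ ν)
    {f : E d₁ × E d₂ → ℝ} (hf : Continuous f) :
    ∫ q, f q.1 ∂π = ∫ p, f p ∂μ.toMeasure := by
  rw [← hπ.1, Measure.fst, integral_map measurable_fst.aemeasurable hf.aestronglyMeasurable]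

theorem integral_snd_of_mem_couplings {μ ν : P2 d₁ d₂}
    {π : Measure ((E d₁ × E d₂) × (E d₁ × E d₂))} (hπ : π ∈ couplings μ ν)
    {f : E d₁ × E d₂ → ℝ} (hf : Continuous f) :
    ∫ q, f q.2 ∂π = ∫ p, f p ∂ν.toMeasure := by
  rw [← hπ.2, Measure.snd, integral_map measurable_snd.aemeasurable hf.aestronglyMeasurable]

/-- Bounded Lipschitz functions have integrals that are Lipschitz for `dist2`. -/
theorem abs_integral_sub_le_dist2 (μ ν : P2 d₁ d₂) {f : E d₁ × E d₂ → ℝ} {C K : ℝ} (hK : 0 ≤ K)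
    (hfC : ∀ p, |f p| ≤ C) (hf : ∀ p q, |f p - f q| ≤ K * ‖p - q‖) :
    |∫ p, f p ∂μ.toMeasure - ∫ p, f p ∂ν.toMeasure| ≤ K * dist2 μ ν := by
  have hfc : Continuous f := by
    refine (LipschitzWith.of_dist_le_mul (K := ⟨K, hK⟩) fun p q => ?_).continuous
    rw [Real.dist_eq, dist_eq_norm]
    exact hf p q
  refine le_of_forall_pos_le_add fun δ hδ => ?_
  obtain ⟨π, hπ, h⟩ := exists_coupling μ ν (δ := δ / (K + 1)) (by positivity)
  have := isProbabilityMeasure_of_mem_couplings hπ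
  have hi : ∀ g : (E d₁ × E d₂) × (E d₁ × E d₂) → E d₁ × E d₂, Continuous g →
      Integrable (fun q => f (g q)) π := fun g hg =>
    (integrable_const C).mono' (hfc.comp hg).aestronglyMeasurable (ae_of_all _ fun q => hfC _)
  have hn : Integrable (fun q : (E d₁ × E d₂) × (E d₁ × E d₂) => ‖q.1 - q.2‖) π := by
    refine ((integrable_sq_sub hπ).add (integrable_const 1)).mono'
      (by fun_prop : Continuous fun q : (E d₁ × E d₂) × (E d₁ × E d₂) =>
        ‖q.1 - q.2‖).aestronglyMeasurable (ae_of_all _ fun q => ?_)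
    have := norm_sq_le_sq (q.1 - q.2)
    simp only [norm_norm, Pi.add_apply]
    nlinarith [_root_.sq_nonneg (‖q.1 - q.2‖ - 1)]
  rw [← integral_fst_of_mem_couplings hπ hfc, ← integral_snd_of_mem_couplings hπ hfc,
    ← integral_sub (hi _ continuous_fst) (hi _ continuous_snd)]
  calc |∫ q, f q.1 - f q.2 ∂π| ≤ ∫ q, K * ‖q.1 - q.2‖ ∂π :=
        (Real.norm_eq_abs _).symm.trans_le
          (norm_integral_le_of_norm_le (hn.const_mul K) (ae_of_all _ fun q => hf _ _))
    _ ≤ K * (dist2 μ ν + δ / (K + 1)) := by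
        rw [integral_const_mul]
        gcongr
        refine (integral_norm_sub_le hπ).trans ?_
        exact Real.sqrt_le_iff.2 ⟨by have := dist2_nonneg μ ν; positivity, h⟩
    _ ≤ K * dist2 μ ν + δ := by
        rw [mul_add]
        gcongr
        rw [mul_div_assoc', div_le_iff₀ (by positivity)]
        nlinarith

/-- Moments are bounded on balls, which turns a Lipschitz constant depending on the moment into a
local one. -/
theorem moment_le_of_dist2 (μ ν : P2 d₁ d₂) {δ : ℝ} (h : dist2 μ ν < δ) :
    (μ.moment : ℝ) ≤ 2 * ν.moment + 2 * δ ^ 2 := by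
  obtain ⟨π, hπ, h1⟩ := exists_coupling μ ν (sub_pos.2 h)
  rw [add_sub_cancel] at h1
  rw [← μ.integral_sq, ← ν.integral_sq, ← integral_fst_of_mem_couplings hπ continuous_sq,
    ← integral_snd_of_mem_couplings hπ continuous_sq]
  have h2 : ∫ q, sq q.1 ∂π ≤ ∫ q, (2 * sq q.2 + 2 * sq (q.1 - q.2)) ∂π := by
    refine integral_mono (integrable_sq_fst hπ) (((integrable_sq_snd hπ).const_mul 2).add
      ((integrable_sq_sub hπ).const_mul 2)) fun q => ?_
    have h3 := sq_sub_le (q.1 - q.2) (-q.2)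
    have h4 : sq (-q.2) = sq q.2 := by simp [sq]
    rw [sub_neg_eq_add, sub_add_cancel, h4] at h3
    simp only
    linarith
  rw [integral_add ((integrable_sq_snd hπ).const_mul 2) ((integrable_sq_sub hπ).const_mul 2),
    integral_const_mul, integral_const_mul] at h2
  linarith

end Distance

/-! ### Existence of solutions of the continuity equation -/

section Existence

variable {d₁ d₂ d' : ℕ}

theorem sq_le_of_norm_sub_le {f : E d₁ → E d₁} {C : ℝ} (h : ∀ x, ‖f x - x‖ ≤ C)
    (p : E d₁ × E d₂) : sq (f p.1, p.2) ≤ 2 * sq p + 2 * C ^ 2 := by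
  have h1 : ‖f p.1‖ ≤ ‖p.1‖ + C := by
    calc ‖f p.1‖ = ‖p.1 + (f p.1 - p.1)‖ := by rw [add_sub_cancel]
      _ ≤ _ := (norm_add_le _ _).trans (by gcongr; exact h _)
  have h2 := pow_le_pow_left₀ (norm_nonneg _) h1 2
  unfold sq
  simp only
  nlinarith [_root_.sq_nonneg (‖p.1‖ - C), _root_.sq_nonneg ‖p.2‖]

theorem exists_push (γ₀ : P2 d₁ d₂) {f : E d₁ → E d₁} (hf : Continuous f) {C : ℝ}
    (h : ∀ x, ‖f x - x‖ ≤ C) :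
    ∃ γ : P2 d₁ d₂, γ.toMeasure = γ₀.toMeasure.map (fun p => (f p.1, p.2)) := by
  have hm : Continuous (fun p : E d₁ × E d₂ => (f p.1, p.2)) := by fun_prop
  refine ⟨P2.mk' _ (Measure.isProbabilityMeasure_map hm.aemeasurable) ?_, rfl⟩
  rw [integrable_map_measure continuous_sq.aestronglyMeasurable hm.aemeasurable]
  refine ((γ₀.integrable_sq.const_mul 2).add (integrable_const (2 * C ^ 2))).mono'
    (continuous_sq.comp hm).aestronglyMeasurable (ae_of_all _ fun p => ?_)
  exact (Real.norm_of_nonneg (sq_nonneg' _)).trans_le (sq_le_of_norm_sub_le h p)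

/-- Images of the same initial point are coupled together. -/
theorem dist2_le_of_push {γ₀ γ γ' : P2 d₁ d₂} {f g : E d₁ → E d₁} (hf : Continuous f)
    (hg : Continuous g) (h : γ.toMeasure = γ₀.toMeasure.map (fun p => (f p.1, p.2)))
    (h' : γ'.toMeasure = γ₀.toMeasure.map (fun p => (g p.1, p.2))) {C : ℝ} (hC : 0 ≤ C)
    (hfg : ∀ x, ‖f x - g x‖ ≤ C) : dist2 γ γ' ≤ C := by
  have hfm : Continuous (fun p : E d₁ × E d₂ => (f p.1, p.2)) := by fun_prop
  have hgm : Continuous (fun p : E d₁ × E d₂ => (g p.1, p.2)) := by fun_prop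
  have hm := hfm.prodMk hgm
  refine dist2_le_of_coupling hC (π := γ₀.toMeasure.map fun p => ((f p.1, p.2), (g p.1, p.2)))
    ⟨?_, ?_⟩ ?_
  · rw [h, Measure.fst, Measure.map_map measurable_fst hm.measurable]; rfl
  · rw [h', Measure.snd, Measure.map_map measurable_snd hm.measurable]; rfl
  · have hc : Continuous fun q : (E d₁ × E d₂) × (E d₁ × E d₂) => sq (q.1 - q.2) :=
      continuous_sq.comp (by fun_prop)
    rw [integral_map hm.aemeasurable hc.aestronglyMeasurable]
    have h1 : ∀ p : E d₁ × E d₂, sq (((f p.1, p.2) : E d₁ × E d₂) - (g p.1, p.2)) ≤ C ^ 2 := by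
      intro p
      simp only [sq, Prod.mk_sub_mk, sub_self, norm_zero]
      have := pow_le_pow_left₀ (norm_nonneg _) (hfg p.1) 2
      linarith
    calc _ ≤ ∫ _, C ^ 2 ∂γ₀.toMeasure :=
          integral_mono_of_nonneg (ae_of_all _ fun p => sq_nonneg' _) (integrable_const _)
            (ae_of_all _ h1)
      _ = C ^ 2 := by simp

theorem IsFlow.norm_sub_le {X : Type*} [NormedAddCommGroup X] [NormedSpace ℝ X]
    [FiniteDimensional ℝ X] [MeasurableSpace X] [BorelSpace X] {V : ℝ → X → X} {m : ℝ → ℝ}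
    (hV : IsCaratheodory V m) {a b : ℝ} {Φ : ℝ → X → X} (hΦ : IsFlow V a b Φ) {t : ℝ}
    (ht : t ∈ Icc a b) (x : X) : ‖Φ t x - x‖ ≤ ∫ r in a..t, m r := by
  have h := (hΦ.curve x).norm_sub_le hV (left_mem_Icc.2 (ht.1.trans ht.2)) ht ht.1
  simpa only [hΦ.init] using h

variable {V : ℝ → E d₁ → E d₁} {m : ℝ → ℝ} {T t₀ : ℝ}

/-- Chain rule along the space-time curve s ↦ (s, Φ_s x, y), the primitive of the integrable
velocity (1, V, 0). -/
theorem IsFlow.integral_test (hV : IsCaratheodory V m) {Φ : ℝ → E d₁ → E d₁}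
    (hΦ : IsFlow V t₀ T Φ) {φ : ℝ × E d₁ × E d₂ → ℝ} (hφ : ContDiff ℝ 1 φ) {t : ℝ}
    (ht : t ∈ Icc t₀ T) (x : E d₁) (y : E d₂) :
    ∫ s in t₀..t, fderiv ℝ φ (s, Φ s x, y) (1, V s (Φ s x), 0)
      = φ (t, Φ t x, y) - φ (t₀, x, y) := by
  have hξ := (hΦ.curve x).continuous
  have hVi : ∀ s, IntervalIntegrable (fun s => V s (Φ s x)) volume t₀ s := fun s =>
    hV.intervalIntegrable_comp hξ t₀ s
  have hi : ∀ s, IntervalIntegrable (fun s => ((1, V s (Φ s x), 0) : ℝ × E d₁ × E d₂))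
      volume t₀ s := fun s => by
    refine ((intervalIntegrable_const (c := (1 : ℝ))).add (hVi s).norm).mono_fun'
      (measurable_const.prodMk ((hV.measurable_comp hξ).prodMk
        measurable_const)).aestronglyMeasurable (ae_of_all _ fun r => ?_)
    simp only [Prod.norm_mk, norm_one, norm_zero]
    have := norm_nonneg (V r (Φ r x))
    simp [this]
  have hcurve : ∀ s ∈ Icc t₀ T, ((t₀, x, y) : ℝ × E d₁ × E d₂)
      + ∫ r in t₀..s, ((1, V r (Φ r x), 0) : ℝ × E d₁ × E d₂) = (s, Φ s x, y) := by
    intro s hs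
    have h0 : Integrable (fun _ : ℝ => (0 : E d₂)) (volume.restrict (Ioc t₀ s)) :=
      integrable_zero _ _ _
    have h1 : Integrable (fun _ : ℝ => (1 : ℝ)) (volume.restrict (Ioc t₀ s)) :=
      integrable_const _
    rw [intervalIntegral.integral_of_le hs.1, integral_pair h1 ((hVi s).1.prodMk h0),
      integral_pair (hVi s).1 h0]
    have h2 := (hΦ.curve x).eq s hs
    simp only [hΦ.init] at h2
    rw [h2, intervalIntegral.integral_of_le hs.1]
    simp [hs.1]
  have h := integral_fderiv_comp_primitive hφ ht.1 (hi t) (t₀, x, y)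
  rw [hcurve t ht] at h
  rw [← h]
  refine intervalIntegral.integral_congr fun s hs => ?_
  rw [uIcc_of_le ht.1] at hs
  rw [hcurve s ⟨hs.1, hs.2.trans ht.2⟩]

variable {b : E d₁ → E d' → E d₁} {B : ℝ} {κ : ProbabilityTheory.Kernel ℝ (E d')}

/-- The weak formulation is the chain rule on each trajectory, integrated over the initial law by
Fubini. Continuity in `dist2` holds because all trajectories move by at most the integral of the
speed. -/
theorem GrowthBound.exists_isSolution (hb : GrowthBound b B) (hκ : IsTame κ) (hT : t₀ ≤ T)
    (γ₀ : P2 d₁ d₂) {Φ : ℝ → E d₁ → E d₁} (hΦ : IsFlow (fun r => field b (κ r)) t₀ T Φ)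
    {ν : ℝ → Measure (E d')} (hν : ∀ᵐ t, t ∈ Icc t₀ T → κ t = ν t) :
    ∃ γ : ℝ → P2 d₁ d₂, IsSolution b T t₀ γ₀ ν γ ∧
      ∀ t ∈ Icc t₀ T, (γ t).toMeasure = γ₀.toMeasure.map (fun p => (Φ t p.1, p.2)) := by
  have hV := hb.isCaratheodory hκ
  have hΦt : ∀ t, Continuous (Φ t) := fun t => hΦ.continuous.comp (Continuous.prodMk_right t)
  have hΦm : ∀ t, Continuous (fun p : E d₁ × E d₂ => (Φ t p.1, p.2)) := fun t => by
    have := hΦt t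
    fun_prop
  choose γ hγ using fun t => exists_push γ₀ (hΦt (projIcc t₀ T hT t))
    (fun x => hΦ.norm_sub_le hV (projIcc t₀ T hT t).2 x)
  have hγ' : ∀ t ∈ Icc t₀ T, (γ t).toMeasure = γ₀.toMeasure.map (fun p => (Φ t p.1, p.2)) := by
    intro t ht
    rw [hγ t, projIcc_of_mem hT ht]
  refine ⟨γ, ⟨fun t ht => ?_, ?_, fun φ hφ t₁ ht₁ => ?_⟩, hγ'⟩
  · set M : ℝ → ℝ := fun s => |∫ r in s..t, speed B κ r| with hM
    have hMc : Continuous M := by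
      have h1 : M = fun s => |∫ r in t..s, speed B κ r| := by
        funext s
        rw [hM]
        simp only
        rw [intervalIntegral.integral_symm, abs_neg]
      rw [h1]
      exact (intervalIntegral.continuous_primitive hV.intervalIntegrable t).abs
    have hM0 : Tendsto M (𝓝[Icc t₀ T] t) (𝓝 0) := by
      have := hMc.tendsto t
      simp only [hM, intervalIntegral.integral_same, abs_zero] at this
      exact this.mono_left nhdsWithin_le_nhds
    refine squeeze_zero' (Eventually.of_forall fun s => dist2_nonneg _ _) ?_ hM0
    filter_upwards [self_mem_nhdsWithin] with s hs
    refine dist2_le_of_push (hΦt s) (hΦt t) (hγ' s hs) (hγ' t ht) (abs_nonneg _) fun x => ?_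
    rcases le_total s t with hst | hst
    · rw [norm_sub_rev]
      exact ((hΦ.curve x).norm_sub_le hV hs ht hst).trans (le_abs_self _)
    · refine ((hΦ.curve x).norm_sub_le hV ht hs hst).trans ?_
      rw [intervalIntegral.integral_symm]
      exact neg_le_abs _
  · apply Subtype.ext
    have h1 := hγ' t₀ (left_mem_Icc.2 hT)
    simp only [hΦ.init, Prod.mk.eta, Measure.map_id'] at h1
    exact h1
  · have hφc := hφ.smooth.continuous
    have hDφ : Continuous (fderiv ℝ φ) := hφ.smooth.continuous_fderiv (by norm_num)
    obtain ⟨C, hC⟩ := hφ.bounded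
    have hC0 : 0 ≤ C := (abs_nonneg _).trans (hC t₀ (left_mem_Icc.2 hT) 0 0).1
    have hpush : ∀ t ∈ Icc t₀ T, ∫ p, φ (t, p.1, p.2) ∂(γ t).toMeasure
        = ∫ p, φ (t, Φ t p.1, p.2) ∂γ₀.toMeasure := fun t ht => by
      rw [hγ' t ht]
      exact integral_map (hΦm t).aemeasurable
        (hφc.comp (Continuous.prodMk_right t)).aestronglyMeasurable
    have hV1 : ∀ r, Measurable (field b (κ r)) := fun r =>
      hV.measurable.comp measurable_prodMk_left
    have hint : ∀ t ∈ Icc t₀ T, κ t = ν t →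
        ∫ p, fderiv ℝ φ (t, p.1, p.2) (1, field b (ν t) p.1, 0) ∂(γ t).toMeasure
        = ∫ p, fderiv ℝ φ (t, Φ t p.1, p.2) (1, field b (κ t) (Φ t p.1), 0) ∂γ₀.toMeasure := by
      intro t ht htν
      rw [← htν, hγ' t ht, integral_map (hΦm t).aemeasurable]
      refine (isBoundedBilinearMap_apply.continuous.comp_stronglyMeasurable
        (StronglyMeasurable.prodMk (hDφ.comp (Continuous.prodMk_right t)).stronglyMeasurable
          (Measurable.stronglyMeasurable ?_))).aestronglyMeasurable
      exact measurable_const.prodMk (((hV1 t).comp measurable_fst).prodMk measurable_const)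
    set g : ℝ → E d₁ × E d₂ → ℝ := fun t p =>
      fderiv ℝ φ (t, Φ t p.1, p.2) (1, field b (κ t) (Φ t p.1), 0) with hg
    have hcurve : Continuous fun q : ℝ × E d₁ × E d₂ => (q.1, Φ q.1 q.2.1, q.2.2) := by
      have := hΦ.continuous.comp (by fun_prop :
        Continuous fun q : ℝ × E d₁ × E d₂ => (q.1, q.2.1))
      exact continuous_fst.prodMk (this.prodMk (by fun_prop))
    have hgm : StronglyMeasurable (Function.uncurry g) := by
      refine isBoundedBilinearMap_apply.continuous.comp_stronglyMeasurable
        (StronglyMeasurable.prodMk (hDφ.comp hcurve).stronglyMeasurable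
          (Measurable.stronglyMeasurable ?_))
      refine measurable_const.prodMk (Measurable.prodMk ?_ measurable_const)
      exact hV.measurable.comp (measurable_fst.prodMk
        (measurable_fst.comp (measurable_snd.comp hcurve.measurable)))
    have hgle : ∀ t ∈ Icc t₀ T, ∀ p, ‖g t p‖ ≤ C * (1 + speed B κ t) := by
      intro t ht p
      refine ((fderiv ℝ φ _).le_opNorm _).trans ?_
      have h1 := hV.norm_le t (Φ t p.1)
      have h2 := hV.nonneg t
      gcongr
      · exact (hC t ht _ _).2
      · simp only [Prod.norm_mk, norm_one, norm_zero]
        refine max_le (by linarith) (max_le (by linarith) (by linarith))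
    have hgi : Integrable (Function.uncurry g)
        ((volume.restrict (uIoc t₀ t₁)).prod γ₀.toMeasure) := by
      have h1 : Integrable (fun t => C * (1 + speed B κ t)) (volume.restrict (uIoc t₀ t₁)) := by
        rw [uIoc_of_le ht₁.1]
        exact ((integrable_const 1).add (hV.intervalIntegrable t₀ t₁).1).const_mul C
      refine (h1.comp_fst γ₀.toMeasure).mono' hgm.aestronglyMeasurable ?_
      have h2 : ∀ᵐ t ∂(volume.restrict (uIoc t₀ t₁)), t ∈ Icc t₀ T := by
        refine (ae_restrict_iff' measurableSet_uIoc).2 (ae_of_all _ fun t ht => ?_)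
        rw [uIoc_of_le ht₁.1] at ht
        exact ⟨ht.1.le, ht.2.trans ht₁.2⟩
      filter_upwards [Measure.quasiMeasurePreserving_fst.ae h2] with q hq
      exact hgle q.1 hq q.2
    have hsum : ∫ t in t₀..t₁, ∫ p, fderiv ℝ φ (t, p.1, p.2) (1, field b (ν t) p.1, 0)
        ∂(γ t).toMeasure = ∫ p, (φ (t₁, Φ t₁ p.1, p.2) - φ (t₀, p.1, p.2)) ∂γ₀.toMeasure := by
      calc _ = ∫ t in t₀..t₁, ∫ p, g t p ∂γ₀.toMeasure := by
            refine intervalIntegral.integral_congr_ae ?_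
            filter_upwards [hν] with t ht ht'
            rw [uIoc_of_le ht₁.1] at ht'
            have ht2 : t ∈ Icc t₀ T := ⟨ht'.1.le, ht'.2.trans ht₁.2⟩
            exact hint t ht2 (ht ht2)
        _ = ∫ p, (∫ t in t₀..t₁, g t p) ∂γ₀.toMeasure := intervalIntegral_integral_swap hgi
        _ = _ := by
            refine integral_congr_ae (ae_of_all _ fun p => ?_)
            exact hΦ.integral_test hV hφ.smooth ht₁ p.1 p.2
    have hi : ∀ t ∈ Icc t₀ T, ∀ f : E d₁ → E d₁, Continuous f →
        Integrable (fun p : E d₁ × E d₂ => φ (t, f p.1, p.2)) γ₀.toMeasure := fun t ht f hf =>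
      (integrable_const C).mono' (hφc.comp (by fun_prop : Continuous
        fun p : E d₁ × E d₂ => (t, f p.1, p.2))).aestronglyMeasurable
        (ae_of_all _ fun p => (hC t ht _ _).1)
    have h3 := hi t₀ (left_mem_Icc.2 hT) _ continuous_id
    simp only [id] at h3
    rw [hpush t₁ ht₁, hsum, integral_sub (hi t₁ ht₁ _ (hΦt t₁)) h3, add_sub_cancel]

end Existence

/-! ### Test functions with two bounded derivatives -/

section TestFunctions

variable {X : Type*} [NormedAddCommGroup X] [NormedSpace ℝ X]
  {Y : Type*} [NormedAddCommGroup Y] [NormedSpace ℝ Y]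
  {F : Type*} [NormedAddCommGroup F] [NormedSpace ℝ F]

/-- A function of class `C²` bounded by `c`, with a derivative that is bounded by `c` and
`c`-Lipschitz. -/
structure C2Bound (f : X → F) (c : ℝ) : Prop where
  contDiff : ContDiff ℝ 2 f
  norm_le : ∀ x, ‖f x‖ ≤ c
  norm_fderiv_le : ∀ x, ‖fderiv ℝ f x‖ ≤ c
  lipschitz_fderiv : ∀ x y, ‖fderiv ℝ f x - fderiv ℝ f y‖ ≤ c * ‖x - y‖

namespace C2Bound

variable {f : X → F} {c : ℝ}

theorem nonneg (hf : C2Bound f c) : 0 ≤ c := (norm_nonneg _).trans (hf.norm_le 0)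

theorem differentiable (hf : C2Bound f c) : Differentiable ℝ f :=
  hf.contDiff.differentiable (by norm_num)

theorem contDiff_fderiv (hf : C2Bound f c) : ContDiff ℝ 1 (fderiv ℝ f) :=
  hf.contDiff.fderiv_right (by norm_num)

theorem lipschitz (hf : C2Bound f c) (x y : X) : ‖f x - f y‖ ≤ c * ‖x - y‖ :=
  convex_univ.norm_image_sub_le_of_norm_fderiv_le (fun z _ => hf.differentiable z)
    (fun z _ => hf.norm_fderiv_le z) (mem_univ y) (mem_univ x)

theorem taylor (hf : C2Bound f c) (x w : X) :
    ‖f (x + w) - f x - fderiv ℝ f x w‖ ≤ c * ‖w‖ ^ 2 := by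
  have h := (convex_closedBall x ‖w‖).norm_image_sub_le_of_norm_fderiv_le' (𝕜 := ℝ) (f := f)
    (φ := fderiv ℝ f x) (C := c * ‖w‖) (x := x) (y := x + w)
    (fun z _ => hf.differentiable z) (fun z hz => ?_) (Metric.mem_closedBall_self (norm_nonneg _))
    (by simp)
  · rw [add_sub_cancel_left] at h
    linarith
  · refine (hf.lipschitz_fderiv z x).trans ?_
    have := hf.nonneg
    gcongr
    exact mem_closedBall_iff_norm.1 hz

/-- A vector field on `X`, acting on the first factor of `X × Y`. -/
theorem inl_comp_fst {v : X → X} (hv : C2Bound v c) :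
    C2Bound (fun p : X × Y => ((v p.1, 0) : X × Y)) c := by
  have hd : ∀ p : X × Y, HasFDerivAt (fun p : X × Y => ((v p.1, 0) : X × Y))
      (((ContinuousLinearMap.inl ℝ X Y).comp (fderiv ℝ v p.1)).comp
        (ContinuousLinearMap.fst ℝ X Y)) p := fun p => by
    have h1 := (hv.differentiable p.1).hasFDerivAt.comp p (hasFDerivAt_fst (p := p) (𝕜 := ℝ))
    exact (ContinuousLinearMap.inl ℝ X Y).hasFDerivAt.comp p h1
  have hn : ∀ A : X →L[ℝ] X, ‖((ContinuousLinearMap.inl ℝ X Y).comp A).comp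
      (ContinuousLinearMap.fst ℝ X Y)‖ ≤ ‖A‖ := fun A => by
    refine ContinuousLinearMap.opNorm_le_bound _ (norm_nonneg _) fun p => ?_
    simp only [ContinuousLinearMap.comp_apply, ContinuousLinearMap.inl_apply, Prod.norm_mk,
      norm_zero, ContinuousLinearMap.coe_fst']
    refine max_le ((A.le_opNorm _).trans ?_) (by positivity)
    gcongr
    exact norm_fst_le p
  refine ⟨?_, fun p => ?_, fun p => ?_, fun p q => ?_⟩
  · exact (hv.contDiff.comp contDiff_fst).prodMk contDiff_const
  · simpa [Prod.norm_mk] using hv.norm_le p.1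
  · rw [(hd p).fderiv]
    exact (hn _).trans (hv.norm_fderiv_le _)
  · rw [(hd p).fderiv, (hd q).fderiv, ← ContinuousLinearMap.sub_comp,
      ← ContinuousLinearMap.comp_sub]
    refine (hn _).trans ((hv.lipschitz_fderiv _ _).trans ?_)
    have := hv.nonneg
    gcongr
    exact norm_fst_le (p - q)

/-- Stability of the test class under one Euler step. The loss is a factor 1 + O(μ), so the product
over all the steps stays bounded as the steps shrink. -/
theorem comp_add {ψ : X → F} {W : X → X} {μ : ℝ} (hψ : C2Bound ψ c) (hW : C2Bound W μ)
    (hμ : μ ≤ 1) : C2Bound (fun x => ψ (x + W x)) (c * (1 + 4 * μ)) := by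
  have hc := hψ.nonneg
  have hμ0 := hW.nonneg
  have hΦ : ∀ x, HasFDerivAt (fun x => x + W x)
      (ContinuousLinearMap.id ℝ X + fderiv ℝ W x) x := fun x =>
    (hasFDerivAt_id x).add (hW.differentiable x).hasFDerivAt
  have hd : ∀ x, HasFDerivAt (fun x => ψ (x + W x))
      ((fderiv ℝ ψ (x + W x)).comp (ContinuousLinearMap.id ℝ X + fderiv ℝ W x)) x := fun x =>
    (hψ.differentiable _).hasFDerivAt.comp x (hΦ x)
  have hid : ∀ x, ‖ContinuousLinearMap.id ℝ X + fderiv ℝ W x‖ ≤ 1 + μ := fun x =>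
    (norm_add_le _ _).trans (add_le_add ContinuousLinearMap.norm_id_le (hW.norm_fderiv_le x))
  refine ⟨hψ.contDiff.comp (contDiff_id.add hW.contDiff), fun x => ?_, fun x => ?_,
    fun x y => ?_⟩
  · exact (hψ.norm_le _).trans (by nlinarith)
  · rw [(hd x).fderiv]
    calc _ ≤ c * (1 + μ) := (ContinuousLinearMap.opNorm_comp_le _ _).trans (by
          gcongr
          exacts [hψ.norm_fderiv_le _, hid x])
      _ ≤ _ := by nlinarith
  · rw [(hd x).fderiv, (hd y).fderiv]
    set A := fderiv ℝ ψ (x + W x)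
    set A' := fderiv ℝ ψ (y + W y)
    have e : A.comp (ContinuousLinearMap.id ℝ X + fderiv ℝ W x)
        - A'.comp (ContinuousLinearMap.id ℝ X + fderiv ℝ W y)
        = (A - A').comp (ContinuousLinearMap.id ℝ X + fderiv ℝ W x)
          + A'.comp (fderiv ℝ W x - fderiv ℝ W y) := by
      ext h
      simp only [ContinuousLinearMap.comp_add, ContinuousLinearMap.comp_sub,
        ContinuousLinearMap.sub_comp, add_apply, sub_apply,
        ContinuousLinearMap.comp_apply, ContinuousLinearMap.id_apply]
      abel
    have h1 : ‖(x + W x) - (y + W y)‖ ≤ (1 + μ) * ‖x - y‖ := by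
      calc _ = ‖(x - y) + (W x - W y)‖ := by congr 1; abel
        _ ≤ ‖x - y‖ + μ * ‖x - y‖ := (norm_add_le _ _).trans (by gcongr; exact hW.lipschitz _ _)
        _ = _ := by ring
    have h2 : ‖A - A'‖ ≤ c * ((1 + μ) * ‖x - y‖) :=
      (hψ.lipschitz_fderiv _ _).trans (by gcongr)
    rw [e]
    calc _ ≤ ‖A - A'‖ * ‖ContinuousLinearMap.id ℝ X + fderiv ℝ W x‖
          + ‖A'‖ * ‖fderiv ℝ W x - fderiv ℝ W y‖ :=
          (norm_add_le _ _).trans (add_le_add (ContinuousLinearMap.opNorm_comp_le _ _)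
            (ContinuousLinearMap.opNorm_comp_le _ _))
      _ ≤ c * ((1 + μ) * ‖x - y‖) * (1 + μ) + c * (μ * ‖x - y‖) := by
          gcongr
          exacts [hid x, hψ.norm_fderiv_le _, hW.lipschitz_fderiv _ _]
      _ = c * ((1 + μ) ^ 2 + μ) * ‖x - y‖ := by ring
      _ ≤ c * (1 + 4 * μ) * ‖x - y‖ := by
          have h3 : (1 + μ) ^ 2 + μ ≤ 1 + 4 * μ := by nlinarith
          gcongr

/-- The transport derivative of a test function is itself a legitimate C¹ test function, so the weak
formulation can be applied a second time. -/
theorem fderiv_apply {ψ : X → ℝ} {W : X → X} {k : ℝ} (hψ : C2Bound ψ c) (hW : C2Bound W k) :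
    ContDiff ℝ 1 (fun x => fderiv ℝ ψ x (W x)) ∧ (∀ x, |fderiv ℝ ψ x (W x)| ≤ c * k) ∧
      ∀ x, ‖fderiv ℝ (fun x => fderiv ℝ ψ x (W x)) x‖ ≤ 2 * c * k := by
  have hc := hψ.nonneg
  have hk := hW.nonneg
  refine ⟨hψ.contDiff_fderiv.clm_apply (hW.contDiff.of_le (by norm_num)), fun x => ?_,
    fun x => ?_⟩
  · refine ((fderiv ℝ ψ x).le_opNorm _).trans ?_
    gcongr
    exacts [hψ.norm_fderiv_le x, hW.norm_le x]
  · refine norm_fderiv_le_of_lip' ℝ (by positivity) (Eventually.of_forall fun y => ?_)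
    have e : fderiv ℝ ψ y (W y) - fderiv ℝ ψ x (W x)
        = (fderiv ℝ ψ y - fderiv ℝ ψ x) (W y) + fderiv ℝ ψ x (W y - W x) := by
      rw [sub_apply, map_sub]
      ring
    rw [e]
    calc _ ≤ ‖fderiv ℝ ψ y - fderiv ℝ ψ x‖ * ‖W y‖ + ‖fderiv ℝ ψ x‖ * ‖W y - W x‖ :=
          (norm_add_le _ _).trans (add_le_add (ContinuousLinearMap.le_opNorm _ _)
            (ContinuousLinearMap.le_opNorm _ _))
      _ ≤ (c * ‖y - x‖) * k + c * (k * ‖y - x‖) := by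
          gcongr
          exacts [hψ.lipschitz_fderiv _ _, hW.norm_le y, hψ.norm_fderiv_le x, hW.lipschitz _ _]
      _ = _ := by ring

theorem comp_dual {h h' : ℝ → ℝ} (hd : ∀ x, HasDerivAt h (h' x) x) (hh : ContDiff ℝ 2 h)
    (h1 : ∀ x, |h x| ≤ 1) (h1' : ∀ x, |h' x| ≤ 1) (hl : ∀ x y, |h' x - h' y| ≤ |x - y|)
    (l : X →L[ℝ] ℝ) : C2Bound (fun x => h (l x)) (1 + ‖l‖ + ‖l‖ ^ 2) := by
  have h0 := norm_nonneg l
  have hD : ∀ x, fderiv ℝ (fun x => h (l x)) x = h' (l x) • l := fun x =>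
    ((hd (l x)).comp_hasFDerivAt x l.hasFDerivAt).fderiv
  refine ⟨hh.comp l.contDiff, fun x => ?_, fun x => ?_, fun x y => ?_⟩
  · rw [Real.norm_eq_abs]
    nlinarith [h1 (l x)]
  · rw [hD, norm_smul, Real.norm_eq_abs]
    nlinarith [h1' (l x)]
  · rw [hD, hD, ← sub_smul, norm_smul, Real.norm_eq_abs]
    have h2 : |h' (l x) - h' (l y)| ≤ ‖l‖ * ‖x - y‖ := by
      refine (hl _ _).trans ?_
      rw [← map_sub]
      exact l.le_opNorm _
    calc _ ≤ (‖l‖ * ‖x - y‖) * ‖l‖ := by gcongr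
      _ ≤ _ := by nlinarith [norm_nonneg (x - y)]

end C2Bound

theorem abs_sin_sub_sin_le (x y : ℝ) : |Real.sin x - Real.sin y| ≤ |x - y| := by
  have := convex_univ.norm_image_sub_le_of_norm_deriv_le (f := Real.sin) (C := 1) (x := y) (y := x)
    (fun z _ => Real.differentiable_sin z) (fun z _ => by
      rw [Real.deriv_sin]; exact Real.abs_cos_le_one z) (mem_univ _) (mem_univ _)
  simpa using this

theorem abs_cos_sub_cos_le (x y : ℝ) : |Real.cos x - Real.cos y| ≤ |x - y| := by
  have := convex_univ.norm_image_sub_le_of_norm_deriv_le (f := Real.cos) (C := 1) (x := y) (y := x)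
    (fun z _ => Real.differentiable_cos z) (fun z _ => by
      rw [Real.deriv_cos, norm_neg]; exact Real.abs_sin_le_one z) (mem_univ _) (mem_univ _)
  simpa using this

/-- The class contains the cosine and sine of every continuous linear form, hence determines
characteristic functions. -/
theorem measure_eq_of_forall_C2Bound [CompleteSpace X] [SecondCountableTopology X]
    [MeasurableSpace X] [BorelSpace X] {μ ν : Measure X} [IsProbabilityMeasure μ]
    [IsProbabilityMeasure ν]
    (h : ∀ (ψ : X → ℝ) (c : ℝ), C2Bound ψ c → ∫ x, ψ x ∂μ = ∫ x, ψ x ∂ν) : μ = ν := by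
  refine Measure.ext_of_charFunDual (funext fun l => ?_)
  have hcos : C2Bound (fun x => Real.cos (l x)) (1 + ‖l‖ + ‖l‖ ^ 2) := by
    refine C2Bound.comp_dual (h' := fun x => -Real.sin x) Real.hasDerivAt_cos Real.contDiff_cos
      Real.abs_cos_le_one (fun x => by rw [abs_neg]; exact Real.abs_sin_le_one x)
      (fun x y => ?_) l
    rw [← neg_sub', abs_neg]
    exact abs_sin_sub_sin_le x y
  have hsin : C2Bound (fun x => Real.sin (l x)) (1 + ‖l‖ + ‖l‖ ^ 2) :=
    C2Bound.comp_dual (h' := Real.cos) Real.hasDerivAt_sin Real.contDiff_sin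
      Real.abs_sin_le_one Real.abs_cos_le_one abs_cos_sub_cos_le l
  have key : ∀ ρ : Measure X, IsProbabilityMeasure ρ → charFunDual ρ l
      = (∫ x, Real.cos (l x) ∂ρ : ℝ) + (∫ x, Real.sin (l x) ∂ρ : ℝ) * Complex.I := by
    intro ρ hρ
    have hic : Integrable (fun x => Real.cos (l x)) ρ :=
      (integrable_const _).mono' (by fun_prop) (ae_of_all _ fun x => hcos.norm_le x)
    have his : Integrable (fun x => Real.sin (l x)) ρ :=
      (integrable_const _).mono' (by fun_prop) (ae_of_all _ fun x => hsin.norm_le x)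
    rw [charFunDual_apply, ← integral_complex_ofReal, ← integral_complex_ofReal,
      ← integral_mul_const, ← integral_add hic.ofReal (his.ofReal.mul_const _)]
    refine integral_congr_ae (ae_of_all _ fun x => ?_)
    simp only [Complex.ofReal_cos, Complex.ofReal_sin]
    exact Complex.exp_mul_I _
  rw [key μ inferInstance, key ν inferInstance, h _ _ hcos, h _ _ hsin]

end TestFunctions

/-! ### Uniqueness of solutions of the continuity equation -/

section Uniqueness

variable {d₁ d₂ d' : ℕ} {T t₀ : ℝ}

theorem continuous_integral_curve (hT : t₀ ≤ T) {γ : ℝ → P2 d₁ d₂}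
    (hγ : ∀ t ∈ Icc t₀ T, Tendsto (fun s => dist2 (γ s) (γ t)) (𝓝[Icc t₀ T] t) (𝓝 0))
    {f : E d₁ × E d₂ → ℝ} {C K : ℝ} (hK : 0 ≤ K) (hfC : ∀ p, |f p| ≤ C)
    (hf : ∀ p q, |f p - f q| ≤ K * ‖p - q‖) :
    Continuous fun t => ∫ p, f p ∂(γ (projIcc t₀ T hT t)).toMeasure := by
  have h1 : ContinuousOn (fun t => ∫ p, f p ∂(γ t).toMeasure) (Icc t₀ T) := by
    intro t ht
    rw [ContinuousWithinAt, tendsto_iff_dist_tendsto_zero]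
    refine squeeze_zero (fun s => dist_nonneg)
      (fun s => abs_integral_sub_le_dist2 (γ s) (γ t) hK hfC hf) ?_
    simpa using (hγ t ht).const_mul K
  exact h1.comp_continuous (continuous_subtype_val.comp continuous_projIcc)
    fun t => (projIcc t₀ T hT t).2

/-- The mass of a closed set is a pointwise limit of integrals of bounded Lipschitz thickened
indicators, which are continuous in time; closed sets form a generating π-system. This makes the
curve a kernel, so that averages of time-dependent integrands are measurable. -/
theorem measurable_curve (hT : t₀ ≤ T) {γ : ℝ → P2 d₁ d₂}
    (hγ : ∀ t ∈ Icc t₀ T, Tendsto (fun s => dist2 (γ s) (γ t)) (𝓝[Icc t₀ T] t) (𝓝 0)) :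
    Measurable fun t => (γ (projIcc t₀ T hT t)).toMeasure := by
  refine Measurable.measure_of_isPiSystem_of_isProbabilityMeasure (S := {s | IsClosed s})
    (by rw [BorelSpace.measurable_eq (α := E d₁ × E d₂), borel_eq_generateFrom_isClosed])
    isPiSystem_isClosed fun F hF => ?_
  have hδ : ∀ n : ℕ, (0 : ℝ) < 1 / (n + 1) := fun n => by positivity
  have hreal : Measurable fun t => (γ (projIcc t₀ T hT t)).toMeasure.real F := by
    refine measurable_of_tendsto_metrizable (f := fun (n : ℕ) t =>
      ∫ p, (thickenedIndicator (hδ n) F p : ℝ) ∂(γ (projIcc t₀ T hT t)).toMeasure) (fun n => ?_)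
      (tendsto_pi_nhds.2 fun t => ?_)
    · refine (continuous_integral_curve hT hγ (f := fun p => (thickenedIndicator (hδ n) F p : ℝ))
        (C := 1) (K := ((Real.toNNReal (1 / (n + 1 : ℝ)))⁻¹ : ℝ≥0)) (NNReal.coe_nonneg _) (fun p => ?_)
        fun p q => ?_).measurable
      · rw [abs_of_nonneg (NNReal.coe_nonneg _)]
        exact_mod_cast thickenedIndicator_le_one (hδ n) F p
      · have h := (lipschitzWith_thickenedIndicator (hδ n) F).dist_le_mul p q
        rwa [NNReal.dist_eq, dist_eq_norm] at h
    · exact tendsto_integral_thickenedIndicator_of_isClosed _ hF hδ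
        tendsto_one_div_add_atTop_nhds_zero_nat
  have e : (fun t => (γ (projIcc t₀ T hT t)).toMeasure F)
      = fun t => ENNReal.ofReal ((γ (projIcc t₀ T hT t)).toMeasure.real F) :=
    funext fun t => (ofReal_measureReal).symm
  rw [e]
  exact hreal.ennreal_ofReal

variable {b : E d₁ → E d' → E d₁} {B : ℝ} {κ : ProbabilityTheory.Kernel ℝ (E d')}
  {ν : ℝ → Measure (E d')} {γ₀ : P2 d₁ d₂} {γ : ℝ → P2 d₁ d₂}

theorem GrowthBound.c2Bound_field (hb : GrowthBound b B) {N : Measure (E d')}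
    (hN : Integrable weight N) : C2Bound (field b N) (B * ∫ a, weight a ∂N) := by
  have h1 : ContDiff ℝ 1 (fderiv ℝ (field b N)) :=
    (hb.contDiff_field hN).fderiv_right (by norm_num)
  exact ⟨hb.contDiff_field hN, hb.norm_field_le hN, hb.norm_fderiv_field_le hN, fun x y =>
    convex_univ.norm_image_sub_le_of_norm_fderiv_le
      (fun z _ => h1.differentiable (by norm_num) z)
      (fun z _ => hb.norm_fderiv_fderiv_field_le hN z) (mem_univ y) (mem_univ x)⟩

theorem GrowthBound.c2Bound_velocity (hb : GrowthBound b B) (hκ : IsTame κ) (r : ℝ) :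
    C2Bound (fun p : E d₁ × E d₂ => ((field b (κ r) p.1, 0) : E d₁ × E d₂)) (speed B κ r) :=
  (hb.c2Bound_field (hκ.integrable r)).inl_comp_fst

theorem GrowthBound.c2Bound_cumulative (hb : GrowthBound b B) (hκ : IsTame κ) {s t : ℝ}
    (hst : s ≤ t) :
    C2Bound (fun p : E d₁ × E d₂ => ((field b (cumulative κ s t) p.1, 0) : E d₁ × E d₂))
      (∫ r in s..t, speed B κ r) := by
  rw [← hκ.integral_weight_cumulative hst]
  exact (hb.c2Bound_field (hκ.integrable_cumulative s t)).inl_comp_fst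

/-- The weak formulation with a time-independent test function. -/
theorem IsSolution.weak_autonomous (hb : GrowthBound b B) (hκ : IsTame κ) (hT : t₀ ≤ T)
    (hν : ∀ᵐ t, t ∈ Icc t₀ T → κ t = ν t) (hγ : IsSolution b T t₀ γ₀ ν γ)
    {ψ : E d₁ × E d₂ → ℝ} (hψ : ContDiff ℝ 1 ψ) {C : ℝ} (hC : ∀ p, |ψ p| ≤ C) {D : ℝ}
    (hD : ∀ p, ‖fderiv ℝ ψ p‖ ≤ D) {s t : ℝ} (hs : s ∈ Icc t₀ T) (ht : t ∈ Icc t₀ T) :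
    IntervalIntegrable
      (fun r => ∫ p, fderiv ℝ ψ p (field b (κ r) p.1, 0)
        ∂(γ (projIcc t₀ T hT r)).toMeasure) volume s t ∧
    ∫ p, ψ p ∂(γ t).toMeasure - ∫ p, ψ p ∂(γ s).toMeasure
      = ∫ r in s..t, ∫ p, fderiv ℝ ψ p (field b (κ r) p.1, 0)
          ∂(γ (projIcc t₀ T hT r)).toMeasure := by
  have hV := hb.isCaratheodory hκ
  have hDψ : Continuous (fderiv ℝ ψ) := hψ.continuous_fderiv (by norm_num)
  have hD0 : 0 ≤ D := (norm_nonneg _).trans (hD 0)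
  set G : ℝ → ℝ := fun r => ∫ p, fderiv ℝ ψ p (field b (κ r) p.1, 0)
    ∂(γ (projIcc t₀ T hT r)).toMeasure with hG
  let Γ : ProbabilityTheory.Kernel ℝ (E d₁ × E d₂) :=
    ⟨fun r => (γ (projIcc t₀ T hT r)).toMeasure, measurable_curve hT hγ.cont⟩
  have hΓ : ProbabilityTheory.IsMarkovKernel Γ := ⟨fun r => γ _ |>.2.1⟩
  have hGm : StronglyMeasurable G := by
    have h1 : StronglyMeasurable (fun q : ℝ × E d₁ × E d₂ =>
        fderiv ℝ ψ q.2 (field b (κ q.1) q.2.1, 0)) := by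
      refine isBoundedBilinearMap_apply.continuous.comp_stronglyMeasurable
        (StronglyMeasurable.prodMk (hDψ.comp continuous_snd).stronglyMeasurable
          (Measurable.stronglyMeasurable ?_))
      refine Measurable.prodMk ?_ measurable_const
      exact hV.measurable.comp (measurable_fst.prodMk (measurable_fst.comp measurable_snd))
    exact h1.integral_kernel_prod_right' (κ := Γ)
  have hGi : ∀ s t, IntervalIntegrable G volume s t := fun s t => by
    refine ((hV.intervalIntegrable s t).const_mul D).mono_fun' hGm.aestronglyMeasurable
      (ae_of_all _ fun r => ?_)
    refine (norm_integral_le_of_norm_le_const (C := D * speed B κ r)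
      (ae_of_all _ fun p => ?_)).trans (by simp)
    refine ((fderiv ℝ ψ p).le_opNorm _).trans ?_
    gcongr
    exacts [hD p, (hb.c2Bound_velocity hκ r).norm_le p]
  refine ⟨hGi s t, ?_⟩
  have hφD : ∀ q : ℝ × E d₁ × E d₂, HasFDerivAt (fun q : ℝ × E d₁ × E d₂ => ψ q.2)
      ((fderiv ℝ ψ q.2).comp (ContinuousLinearMap.snd ℝ ℝ (E d₁ × E d₂))) q := fun q =>
    (hψ.differentiable one_ne_zero q.2).hasFDerivAt.comp q hasFDerivAt_snd
  have hφ : IsTest T t₀ (fun q : ℝ × E d₁ × E d₂ => ψ q.2) := by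
    refine ⟨hψ.comp contDiff_snd, max C D, fun t _ x y => ⟨(hC _).trans (le_max_left _ _), ?_⟩⟩
    rw [(hφD _).fderiv]
    refine (ContinuousLinearMap.opNorm_comp_le _ _).trans ?_
    calc _ ≤ D * 1 := by
          gcongr
          exacts [hD _, ContinuousLinearMap.norm_snd_le _ _ _]
      _ ≤ _ := by rw [mul_one]; exact le_max_right _ _
  have key : ∀ t ∈ Icc t₀ T, ∫ p, ψ p ∂(γ t).toMeasure
      = ∫ p, ψ p ∂γ₀.toMeasure + ∫ r in t₀..t, G r := by
    intro t ht
    have h := hγ.weak _ hφ t ht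
    simp only at h
    rw [h]
    congr 1
    refine intervalIntegral.integral_congr_ae ?_
    filter_upwards [hν] with r hr hr'
    rw [uIoc_of_le ht.1] at hr'
    have hr2 : r ∈ Icc t₀ T := ⟨hr'.1.le, hr'.2.trans ht.2⟩
    simp only [hG]
    rw [← hr hr2, projIcc_of_mem hT hr2]
    refine integral_congr_ae (ae_of_all _ fun p => ?_)
    simp only
    rw [(hφD _).fderiv]
    rfl
  rw [key t ht, key s hs, add_sub_add_left_eq_sub,
    intervalIntegral.integral_interval_sub_left (hGi _ _) (hGi _ _)]

/-- One step of the explicit Euler scheme, for the adjoint transport equation. -/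
theorem IsSolution.euler_step (hb : GrowthBound b B) (hκ : IsTame κ) (hT : t₀ ≤ T)
    (hν : ∀ᵐ t, t ∈ Icc t₀ T → κ t = ν t) (hγ : IsSolution b T t₀ γ₀ ν γ)
    {ψ : E d₁ × E d₂ → ℝ} {c : ℝ} (hψ : C2Bound ψ c) {s t : ℝ} (hs : s ∈ Icc t₀ T)
    (ht : t ∈ Icc t₀ T) (hst : s ≤ t) :
    |∫ p, ψ p ∂(γ t).toMeasure
      - ∫ p, ψ (p + (field b (cumulative κ s t) p.1, 0)) ∂(γ s).toMeasure|
      ≤ 3 * c * (∫ r in s..t, speed B κ r) ^ 2 := by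
  have hV := hb.isCaratheodory hκ
  have hc := hψ.nonneg
  have hDψ : Continuous (fderiv ℝ ψ) := hψ.contDiff.continuous_fderiv (by norm_num)
  set m := speed B κ with hm
  set μ := ∫ r in s..t, m r with hμ
  have hW := hb.c2Bound_cumulative (d₂ := d₂) hκ hst
  set W : E d₁ × E d₂ → E d₁ × E d₂ := fun p => (field b (cumulative κ s t) p.1, 0) with hWdef
  set f : ℝ → E d₁ × E d₂ → ℝ := fun r p => fderiv ℝ ψ p (field b (κ r) p.1, 0) with hf
  have hfr := fun r => hψ.fderiv_apply (hb.c2Bound_velocity (d₂ := d₂) hκ r)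
  obtain ⟨hGi, hGe⟩ := hγ.weak_autonomous hb hκ hT hν (hψ.contDiff.of_le (by norm_num))
    hψ.norm_le hψ.norm_fderiv_le hs ht
  -- freezing the measure at time `s`
  have hfm : StronglyMeasurable (Function.uncurry f) := by
    refine isBoundedBilinearMap_apply.continuous.comp_stronglyMeasurable
      (StronglyMeasurable.prodMk (hDψ.comp continuous_snd).stronglyMeasurable
        (Measurable.stronglyMeasurable ?_))
    refine Measurable.prodMk ?_ measurable_const
    exact hV.measurable.comp (measurable_fst.prodMk (measurable_fst.comp measurable_snd))
  have hfi : Integrable (Function.uncurry f)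
      ((volume.restrict (uIoc s t)).prod (γ s).toMeasure) := by
    have h1 : Integrable (fun r => c * m r) (volume.restrict (uIoc s t)) :=
      (intervalIntegrable_iff.1 (hV.intervalIntegrable s t)).const_mul c
    exact (h1.comp_fst (γ s).toMeasure).mono' hfm.aestronglyMeasurable
      (ae_of_all _ fun q => (hfr q.1).2.1 q.2)
  have hHi : IntervalIntegrable (fun r => ∫ p, f r p ∂(γ s).toMeasure) volume s t := by
    rw [intervalIntegrable_iff]
    exact hfi.integral_prod_left
  have hH : ∫ r in s..t, ∫ p, f r p ∂(γ s).toMeasure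
      = ∫ p, fderiv ℝ ψ p (W p) ∂(γ s).toMeasure := by
    rw [intervalIntegral_integral_swap hfi]
    refine integral_congr_ae (ae_of_all _ fun p => ?_)
    have h1 := ((fderiv ℝ ψ p).comp
      (ContinuousLinearMap.inl ℝ (E d₁) (E d₂))).intervalIntegral_comp_comm
      (hV.intervalIntegrable_comp (continuous_const (y := p.1)) s t)
    simp only [ContinuousLinearMap.comp_apply, ContinuousLinearMap.inl_apply] at h1
    simp only [hf, hWdef]
    rw [h1, hb.field_cumulative hκ hst]
  -- Replacing γ_r by γ_s costs, by the weak formulation tested with f_r, at most ∫ 2c m(r) m(q) dq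
  -- over [s, r]. Integrating in r gives an error quadratic in μ.
  have h1 : |(∫ r in s..t, ∫ p, f r p ∂(γ (projIcc t₀ T hT r)).toMeasure)
      - ∫ r in s..t, ∫ p, f r p ∂(γ s).toMeasure| ≤ 2 * c * μ ^ 2 := by
    rw [← intervalIntegral.integral_sub hGi hHi, ← Real.norm_eq_abs]
    calc _ ≤ ∫ r in s..t, 2 * c * μ * m r := by
          refine intervalIntegral.norm_integral_le_of_norm_le hst (ae_of_all _ fun r hr => ?_)
            ((hV.intervalIntegrable s t).const_mul _)
          have hr2 : r ∈ Icc t₀ T := ⟨hs.1.trans hr.1.le, hr.2.trans ht.2⟩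
          have h2 := (hγ.weak_autonomous hb hκ hT hν (hfr r).1 (hfr r).2.1 (hfr r).2.2 hs hr2).2
          rw [projIcc_of_mem hT hr2, h2]
          calc _ ≤ ∫ q in s..r, 2 * c * m r * m q := by
                refine intervalIntegral.norm_integral_le_of_norm_le hr.1.le
                  (ae_of_all _ fun q hq => ?_) ((hV.intervalIntegrable s r).const_mul _)
                refine (norm_integral_le_of_norm_le_const (C := 2 * c * m r * m q)
                  (ae_of_all _ fun p => ?_)).trans (by simp)
                refine ((fderiv ℝ (f r) p).le_opNorm _).trans ?_
                have h3 := hV.nonneg r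
                gcongr
                exacts [(hfr r).2.2 p, (hb.c2Bound_velocity hκ q).norm_le p]
            _ = 2 * c * m r * ∫ q in s..r, m q := by rw [intervalIntegral.integral_const_mul]
            _ ≤ 2 * c * m r * μ := by
                have h3 := hV.nonneg r
                gcongr
                exact hV.primitive_mono hr.2
            _ = _ := by ring
      _ = 2 * c * μ * μ := by rw [intervalIntegral.integral_const_mul]
      _ = _ := by ring
  -- Taylor expansion
  have hψc := hψ.contDiff.continuous
  have hWc := hW.contDiff.continuous
  have hi1 : Integrable (fun p => ψ (p + W p)) (γ s).toMeasure :=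
    (integrable_const c).mono' (hψc.comp (continuous_id.add hWc)).aestronglyMeasurable
      (ae_of_all _ fun p => hψ.norm_le _)
  have hi2 : Integrable ψ (γ s).toMeasure :=
    (integrable_const c).mono' hψc.aestronglyMeasurable (ae_of_all _ fun p => hψ.norm_le _)
  have hi3 : Integrable (fun p => fderiv ℝ ψ p (W p)) (γ s).toMeasure :=
    (integrable_const (c * μ)).mono' (hDψ.clm_apply hWc).aestronglyMeasurable
      (ae_of_all _ fun p => (hψ.fderiv_apply hW).2.1 p)
  have h2 : |∫ p, (ψ (p + W p) - ψ p - fderiv ℝ ψ p (W p)) ∂(γ s).toMeasure| ≤ c * μ ^ 2 := by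
    have h3 := norm_integral_le_of_norm_le_const (μ := (γ s).toMeasure) (C := c * μ ^ 2)
      (f := fun p => ψ (p + W p) - ψ p - fderiv ℝ ψ p (W p)) (ae_of_all _ fun p => by
        refine (hψ.taylor p (W p)).trans ?_
        gcongr
        exact hW.norm_le p)
    simpa using h3
  rw [integral_sub (f := fun p => ψ (p + W p) - ψ p) (hi1.sub hi2) hi3, integral_sub hi1 hi2] at h2
  rw [hH, ← hGe] at h1
  have h3 := abs_le.1 h1
  have h4 := abs_le.1 h2
  rw [abs_le]
  constructor <;> linarith [h3.1, h3.2, h4.1, h4.2]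

/-- Time is measured by the integral of the speed and cut into n pieces of size at most η. On the
last piece an Euler step for both solutions moves the comparison back to an earlier time, tested
against ψ(p + W p), whose constant has grown by at most 1 + 4η. The two step errors add 6cη². -/
theorem IsSolution.abs_integral_sub_le (hb : GrowthBound b B) (hκ : IsTame κ) (hT : t₀ ≤ T)
    (hν : ∀ᵐ t, t ∈ Icc t₀ T → κ t = ν t) (hγ : IsSolution b T t₀ γ₀ ν γ) {γ' : ℝ → P2 d₁ d₂}
    (hγ' : IsSolution b T t₀ γ₀ ν γ') {η : ℝ} (hη : 0 ≤ η) (hη1 : η ≤ 1) (n : ℕ) :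
    ∀ t ∈ Icc t₀ T, ∫ r in t₀..t, speed B κ r ≤ n * η → ∀ (ψ : E d₁ × E d₂ → ℝ) (c : ℝ),
      C2Bound ψ c → |∫ p, ψ p ∂(γ t).toMeasure - ∫ p, ψ p ∂(γ' t).toMeasure|
        ≤ c * (6 * n * η ^ 2 * (1 + 4 * η) ^ n) := by
  have hV := hb.isCaratheodory hκ
  have ht₀ : t₀ ∈ Icc t₀ T := left_mem_Icc.2 hT
  induction n with
  | zero =>
    intro t ht hM ψ c hψ
    have h0 : ∫ r in t₀..t, speed B κ r = 0 :=
      le_antisymm (by simpa using hM)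
        (intervalIntegral.integral_nonneg ht.1 fun r _ => hV.nonneg r)
    have h1 := hγ.euler_step hb hκ hT hν hψ ht₀ ht ht.1
    have h2 := hγ'.euler_step hb hκ hT hν hψ ht₀ ht ht.1
    rw [h0, hγ.init] at h1
    rw [h0, hγ'.init] at h2
    have h3 := abs_le.1 h1
    have h4 := abs_le.1 h2
    rw [abs_le]
    constructor <;> simp <;> linarith [h3.1, h3.2, h4.1, h4.2]
  | succ n ih =>
    intro t ht hM ψ c hψ
    have hc := hψ.nonneg
    set M : ℝ → ℝ := fun t => ∫ r in t₀..t, speed B κ r with hMdef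
    have hMc : Continuous M := intervalIntegral.continuous_primitive hV.intervalIntegrable t₀
    have hM0 : M t₀ = 0 := by simp [hMdef]
    have hMt : 0 ≤ M t := intervalIntegral.integral_nonneg ht.1 fun r _ => hV.nonneg r
    -- The earlier time is chosen so that the integral of the speed over the last piece is at most
    -- η; the maximum with 0 covers an integral over [t₀, t] already below η.
    obtain ⟨s, hs, hMs⟩ : max (M t - η) 0 ∈ M '' Icc t₀ t :=
      intermediate_value_Icc ht.1 hMc.continuousOn
        ⟨by rw [hM0]; exact le_max_right _ _, max_le (by linarith) hMt⟩
    have hsT : s ∈ Icc t₀ T := ⟨hs.1, hs.2.trans ht.2⟩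
    have hμ : ∫ r in s..t, speed B κ r = M t - M s :=
      (intervalIntegral.integral_interval_sub_left (hV.intervalIntegrable _ _)
        (hV.intervalIntegrable _ _)).symm
    have hμη : ∫ r in s..t, speed B κ r ≤ η := by
      rw [hμ, hMs]
      linarith [le_max_left (M t - η) 0]
    have hμ0 : 0 ≤ ∫ r in s..t, speed B κ r :=
      intervalIntegral.integral_nonneg hs.2 fun r _ => hV.nonneg r
    have hMs' : M s ≤ n * η := by
      rw [hMs]
      push_cast at hM
      exact max_le (by linarith) (by positivity)
    have h1 := hγ.euler_step hb hκ hT hν hψ hsT ht hs.2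
    have h2 := hγ'.euler_step hb hκ hT hν hψ hsT ht hs.2
    have h3 := ih s hsT hMs' _ _ (hψ.comp_add (hb.c2Bound_cumulative hκ hs.2) (hμη.trans hη1))
    set μ := ∫ r in s..t, speed B κ r
    have h4 : 3 * c * μ ^ 2 ≤ 3 * c * η ^ 2 := by gcongr
    have h5 : c * (1 + 4 * μ) * (6 * n * η ^ 2 * (1 + 4 * η) ^ n)
        ≤ c * (1 + 4 * η) * (6 * n * η ^ 2 * (1 + 4 * η) ^ n) := by gcongr
    have h6 : 6 * c * η ^ 2 ≤ 6 * c * η ^ 2 * (1 + 4 * η) ^ (n + 1) :=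
      le_mul_of_one_le_right (by positivity) (one_le_pow₀ (by linarith))
    have h7 : c * (6 * (n + 1 : ℕ) * η ^ 2 * (1 + 4 * η) ^ (n + 1))
        = c * (1 + 4 * η) * (6 * n * η ^ 2 * (1 + 4 * η) ^ n)
          + 6 * c * η ^ 2 * (1 + 4 * η) ^ (n + 1) := by push_cast; ring
    rw [h7]
    have k1 := abs_le.1 h1
    have k2 := abs_le.1 h2
    have k3 := abs_le.1 h3
    rw [abs_le]
    constructor <;> linarith [k1.1, k1.2, k2.1, k2.2, k3.1, k3.2]

/-- Distributional solutions of the continuity equation are unique. -/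
theorem IsSolution.unique (hb : GrowthBound b B) (hκ : IsTame κ) (hT : t₀ ≤ T)
    (hν : ∀ᵐ t, t ∈ Icc t₀ T → κ t = ν t) (hγ : IsSolution b T t₀ γ₀ ν γ) {γ' : ℝ → P2 d₁ d₂}
    (hγ' : IsSolution b T t₀ γ₀ ν γ') {t : ℝ} (ht : t ∈ Icc t₀ T) :
    (γ t).toMeasure = (γ' t).toMeasure := by
  refine measure_eq_of_forall_C2Bound fun ψ c hψ => ?_
  have hV := hb.isCaratheodory hκ
  have hc := hψ.nonneg
  set M := ∫ r in t₀..t, speed B κ r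
  have hM : 0 ≤ M := intervalIntegral.integral_nonneg ht.1 fun r _ => hV.nonneg r
  -- With η = M/n the n quadratic errors sum to O(1/n), and (1 + 4M/n)^n stays below exp(4M).
  have hbound : ∀ᶠ n : ℕ in atTop,
      |∫ p, ψ p ∂(γ t).toMeasure - ∫ p, ψ p ∂(γ' t).toMeasure|
        ≤ c * (6 * M ^ 2 * Real.exp (4 * M)) / n := by
    obtain ⟨n₀, hn₀⟩ := exists_nat_ge M
    filter_upwards [eventually_ge_atTop (max n₀ 1)] with n hn
    have hn1 : (1 : ℝ) ≤ n := by exact_mod_cast (le_max_right _ _).trans hn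
    have hnM : M ≤ n := hn₀.trans (by exact_mod_cast (le_max_left _ _).trans hn)
    have hn0 : (0 : ℝ) < n := by linarith
    have h := hγ.abs_integral_sub_le hb hκ hT hν hγ' (η := M / n) (by positivity)
      ((div_le_one hn0).2 hnM) n t ht (by rw [mul_div_cancel₀ _ hn0.ne']) ψ c hψ
    refine h.trans ?_
    have he : (1 + 4 * (M / n)) ^ n ≤ Real.exp (4 * M) := by
      have h1 : 1 + 4 * (M / n) ≤ Real.exp (4 * (M / n)) := by
        linarith [Real.add_one_le_exp (4 * (M / n))]
      calc _ ≤ Real.exp (4 * (M / n)) ^ n := by gcongr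
        _ = Real.exp (4 * M) := by
          rw [← Real.exp_nat_mul]
          congr 1
          field_simp
    calc c * (6 * n * (M / n) ^ 2 * (1 + 4 * (M / n)) ^ n)
        ≤ c * (6 * n * (M / n) ^ 2 * Real.exp (4 * M)) := by gcongr
      _ = _ := by field_simp
  have hlim : Tendsto (fun n : ℕ => c * (6 * M ^ 2 * Real.exp (4 * M)) / n) atTop (𝓝 0) :=
    tendsto_const_div_atTop_nhds_zero_nat _
  have h0 := ge_of_tendsto hlim hbound
  exact sub_eq_zero.1 (abs_eq_zero.1 (le_antisymm h0 (abs_nonneg _)))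

end Uniqueness

/-! ### The costs in terms of flows -/

section Costs

variable {d₁ d₂ d' : ℕ} {b : E d₁ → E d' → E d₁} {B : ℝ} {ℓ : E d' → ℝ}
  {L : E d₁ × E d₂ → ℝ} {T t₀ ε : ℝ} {κ : ProbabilityTheory.Kernel ℝ (E d')}
  {Φ : ℝ → E d₁ → E d₁}

/-- A tame control of finite entropy, together with its flow. -/
structure IsRun (b : E d₁ → E d' → E d₁) (ℓ : E d' → ℝ) (T t₀ : ℝ)
    (κ : ProbabilityTheory.Kernel ℝ (E d')) (Φ : ℝ → E d₁ → E d₁) : Prop where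
  tame : IsTame κ
  flow : IsFlow (fun r => field b (κ r)) t₀ T Φ
  entropy : totalEntropy ℓ T t₀ κ ≠ ∞

/-- The cost of a run. -/
def runCost (ε : ℝ) (ℓ : E d' → ℝ) (L : E d₁ × E d₂ → ℝ) (T t₀ : ℝ) (γ₀ : P2 d₁ d₂)
    (κ : ProbabilityTheory.Kernel ℝ (E d')) (Φ : ℝ → E d₁ → E d₁) : ℝ :=
  ∫ p, L (Φ T p.1, p.2) ∂γ₀.toMeasure + ε * (totalEntropy ℓ T t₀ κ).toReal

theorem IsFlow.continuous_at {V : ℝ → E d₁ → E d₁} {a c : ℝ} (hΦ : IsFlow V a c Φ) (t : ℝ) :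
    Continuous (Φ t) :=
  hΦ.continuous.comp (Continuous.prodMk_right t)

/-- Uniqueness identifies the terminal law of any admissible solution with the push-forward by a
flow; existence gives the converse. Afterwards the continuity equation is no longer needed. -/
theorem Regularity.mem_costs_iff (h : Regularity b ℓ L) (hb : GrowthBound b B) (hT : t₀ ≤ T)
    {γ₀ : P2 d₁ d₂} {c : ℝ} :
    c ∈ costs ε b ℓ L T t₀ γ₀ ↔ ∃ κ Φ, IsRun b ℓ T t₀ κ Φ ∧ c = runCost ε ℓ L T t₀ γ₀ κ Φ := by
  have hLc := h.L_smooth.continuous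
  have hpush : ∀ {κ : ProbabilityTheory.Kernel ℝ (E d')} {Φ : ℝ → E d₁ → E d₁} {γT : P2 d₁ d₂},
      IsFlow (fun r => field b (κ r)) t₀ T Φ →
      γT.toMeasure = γ₀.toMeasure.map (fun p => (Φ T p.1, p.2)) →
      ∫ p, L p ∂γT.toMeasure = ∫ p, L (Φ T p.1, p.2) ∂γ₀.toMeasure := by
    intro κ Φ γT hΦ hγ
    have := hΦ.continuous_at T
    rw [hγ, integral_map (by fun_prop : Continuous fun p : E d₁ × E d₂ =>
      (Φ T p.1, p.2)).aemeasurable hLc.aestronglyMeasurable]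
  have hTT : T ∈ Icc t₀ T := right_mem_Icc.2 hT
  constructor
  · rintro ⟨ν, γ, hν, hγ, rfl⟩
    obtain ⟨κ, hκ, hκν⟩ := h.exists_isTame hν
    obtain ⟨Φ, hΦ⟩ := (hb.isCaratheodory hκ).exists_isFlow hT
    obtain ⟨γ', hγ', hγ'Φ⟩ := hb.exists_isSolution hκ hT γ₀ hΦ hκν
    have he := totalEntropy_congr (ℓ := ℓ) hκν
    refine ⟨κ, Φ, ⟨hκ, hΦ, by rw [he]; exact hν.entropy.ne⟩, ?_⟩
    rw [totalCost, runCost, he, hγ.unique hb hκ hT hκν hγ' hTT, hpush hΦ (hγ'Φ T hTT)]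
  · rintro ⟨κ, Φ, hr, rfl⟩
    obtain ⟨γ, hγ, hγΦ⟩ := hb.exists_isSolution hr.tame hT γ₀ hr.flow
      (ν := κ) (ae_of_all _ fun _ _ => rfl)
    refine ⟨κ, γ, ⟨fun t _ => hr.tame.markov.isProbabilityMeasure t, ?_, hr.entropy.lt_top⟩,
      hγ, ?_⟩
    · exact κ.measurable.comp measurable_subtype_coe
    · rw [totalCost, runCost, hpush hr.flow (hγΦ T hTT)]

/-! ### Stability of the terminal cost -/

/-- Quadratic growth and local Lipschitz continuity of the terminal cost. -/
structure CostBound (L : E d₁ × E d₂ → ℝ) (C m₀ : ℝ) : Prop where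
  nonneg : 0 ≤ C
  continuous : Continuous L
  lower : ∀ p, m₀ ≤ L p
  growth : ∀ p, |L p| ≤ C * (1 + sq p)
  lipschitz : ∀ p q, |L p - L q| ≤ C * (1 + ‖p‖ + ‖q‖) * ‖p - q‖

theorem Regularity.exists_costBound (h : Regularity b ℓ L) : ∃ C m₀, CostBound L C m₀ := by
  obtain ⟨C, hC⟩ := h.L_growth
  obtain ⟨m₀, hm₀⟩ := h.L_bddBelow
  have hC0 : 0 ≤ C := by
    have := (abs_nonneg _).trans (hC 0).1
    simpa using this
  refine ⟨2 * C, m₀, by positivity, h.L_smooth.continuous, hm₀, fun p => ?_, fun p q => ?_⟩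
  · refine (hC p).1.trans ?_
    have := sq_nonneg' p
    have h2 : 1 + ‖p.1‖ ^ 2 + ‖p.2‖ ^ 2 = 1 + sq p := by unfold sq; ring
    rw [h2]
    nlinarith
  · set r := max ‖p‖ ‖q‖
    have hr : r ≤ ‖p‖ + ‖q‖ := max_le (by linarith [norm_nonneg q]) (by linarith [norm_nonneg p])
    have hd : ∀ z ∈ Metric.closedBall (0 : E d₁ × E d₂) r,
        ‖fderiv ℝ L z‖ ≤ 2 * C * (1 + ‖p‖ + ‖q‖) := by
      intro z hz
      rw [mem_closedBall_zero_iff] at hz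
      have h1 := (hC z).2 1 le_rfl (by norm_num)
      rw [norm_iteratedFDeriv_one] at h1
      refine h1.trans ?_
      have h2 := norm_fst_le z
      have h3 := norm_snd_le z
      calc C * (1 + ‖z.1‖ + ‖z.2‖) ≤ C * (2 * (1 + ‖p‖ + ‖q‖)) := by
            gcongr
            linarith
        _ = _ := by ring
    exact (convex_closedBall _ _).norm_image_sub_le_of_norm_fderiv_le
      (fun z _ => h.L_smooth.differentiable (by norm_num) z) hd
      (mem_closedBall_zero_iff.2 (le_max_right _ _)) (mem_closedBall_zero_iff.2 (le_max_left _ _))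

/-- The Lipschitz constant of the terminal cost, for flows of displacement at most `M` and initial
conditions of second moment at most `R`. -/
def lipConst (C M R : ℝ) : ℝ := 2 * C * Real.exp (2 * M) * (5 + 16 * M ^ 2 + 8 * R)

theorem lipConst_nonneg {C M R : ℝ} (hC : 0 ≤ C) (hR : 0 ≤ R) : 0 ≤ lipConst C M R := by
  unfold lipConst; positivity

theorem lipConst_mono {C M R M' R' : ℝ} (hC : 0 ≤ C) (hM : 0 ≤ M) (hR : 0 ≤ R) (hMM : M ≤ M')
    (hRR : R ≤ R') : lipConst C M R ≤ lipConst C M' R' := by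
  unfold lipConst; gcongr

variable {C m₀ M R : ℝ} {f g : E d₁ → E d₁}

theorem norm_prod_le_of_norm_sub_le (h : ∀ x, ‖f x - x‖ ≤ M) (p : E d₁ × E d₂) :
    ‖(f p.1, p.2)‖ ≤ ‖p‖ + M := by
  have hM : 0 ≤ M := (norm_nonneg _).trans (h 0)
  rw [Prod.norm_mk]
  refine max_le ?_ ((norm_snd_le p).trans (by linarith))
  calc ‖f p.1‖ = ‖p.1 + (f p.1 - p.1)‖ := by rw [add_sub_cancel]
    _ ≤ ‖p‖ + M := (norm_add_le _ _).trans (add_le_add (norm_fst_le p) (h _))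

theorem CostBound.integrable_comp (hL : CostBound L C m₀) (γ : P2 d₁ d₂) (hf : Continuous f)
    (h : ∀ x, ‖f x - x‖ ≤ M) : Integrable (fun p => L (f p.1, p.2)) γ.toMeasure := by
  have hC := hL.nonneg
  refine (((integrable_const (1 + 2 * M ^ 2)).add (γ.integrable_sq.const_mul 2)).const_mul C).mono'
    (hL.continuous.comp (by fun_prop : Continuous fun p : E d₁ × E d₂ =>
      (f p.1, p.2))).aestronglyMeasurable (ae_of_all _ fun p => ?_)
  refine (hL.growth _).trans ?_
  have := sq_le_of_norm_sub_le h p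
  simp only [Pi.add_apply]
  exact mul_le_mul_of_nonneg_left (by linarith) hC

theorem CostBound.integral_le (hL : CostBound L C m₀) (γ : P2 d₁ d₂) (hf : Continuous f)
    (h : ∀ x, ‖f x - x‖ ≤ M) :
    ∫ p, L (f p.1, p.2) ∂γ.toMeasure ≤ C * (1 + 2 * γ.moment + 2 * M ^ 2) := by
  have hC := hL.nonneg
  calc _ ≤ ∫ p, C * (1 + 2 * M ^ 2 + 2 * sq p) ∂γ.toMeasure := by
        refine integral_mono (hL.integrable_comp γ hf h)
          (((integrable_const (1 + 2 * M ^ 2)).add (γ.integrable_sq.const_mul 2)).const_mul C)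
          fun p => ?_
        refine (le_abs_self _).trans ((hL.growth _).trans ?_)
        have := sq_le_of_norm_sub_le h p
        exact mul_le_mul_of_nonneg_left (by linarith) hC
    _ = _ := by
        rw [integral_const_mul, integral_add (integrable_const _) (γ.integrable_sq.const_mul 2),
          integral_const_mul, γ.integral_sq]
        simp only [integral_const, probReal_univ, smul_eq_mul, one_mul]
        ring

theorem CostBound.le_integral (hL : CostBound L C m₀) (γ : P2 d₁ d₂) (hf : Continuous f)
    (h : ∀ x, ‖f x - x‖ ≤ M) : m₀ ≤ ∫ p, L (f p.1, p.2) ∂γ.toMeasure := by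
  calc m₀ = ∫ _, m₀ ∂γ.toMeasure := by simp
    _ ≤ _ := integral_mono (integrable_const _) (hL.integrable_comp γ hf h) fun p => hL.lower _

/-- Compares two flows started from the same law at different times. In the applications δ is a
displacement bound at the later starting time, and 2 exp(2M) is the Grönwall factor from there to T.
-/
theorem CostBound.abs_integral_sub_le (hL : CostBound L C m₀) (γ : P2 d₁ d₂) (hf : Continuous f)
    (hg : Continuous g) (hfM : ∀ x, ‖f x - x‖ ≤ M) (hgM : ∀ x, ‖g x - x‖ ≤ M) {δ : ℝ}
    (hfg : ∀ x, ‖f x - g x‖ ≤ 2 * Real.exp (2 * M) * δ) :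
    |∫ p, L (f p.1, p.2) ∂γ.toMeasure - ∫ p, L (g p.1, p.2) ∂γ.toMeasure|
      ≤ lipConst C M γ.moment * δ := by
  have hC := hL.nonneg
  have hM : 0 ≤ M := (norm_nonneg _).trans (hfM 0)
  have hδ : 0 ≤ δ := by
    have := (norm_nonneg _).trans (hfg 0)
    exact nonneg_of_mul_nonneg_right this (by positivity)
  have hi : Integrable (fun p => C * (3 + 2 * M + 2 * sq p) * (2 * Real.exp (2 * M) * δ))
      γ.toMeasure :=
    (((integrable_const (3 + 2 * M)).add (γ.integrable_sq.const_mul 2)).const_mul C).mul_const _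
  rw [← integral_sub (hL.integrable_comp γ hf hfM) (hL.integrable_comp γ hg hgM)]
  calc _ ≤ ∫ p, C * (3 + 2 * M + 2 * sq p) * (2 * Real.exp (2 * M) * δ) ∂γ.toMeasure := by
        rw [← Real.norm_eq_abs]
        refine norm_integral_le_of_norm_le hi (ae_of_all _ fun p => ?_)
        refine (hL.lipschitz _ _).trans ?_
        have h1 := norm_prod_le_of_norm_sub_le hfM p
        have h2 := norm_prod_le_of_norm_sub_le hgM p
        have h3 : ‖p‖ ≤ 1 + sq p := by
          nlinarith [norm_sq_le_sq p, _root_.sq_nonneg (‖p‖ - 1)]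
        have h4 : ‖((f p.1, p.2) : E d₁ × E d₂) - (g p.1, p.2)‖
            ≤ 2 * Real.exp (2 * M) * δ := by
          rw [Prod.mk_sub_mk, sub_self, Prod.norm_mk, norm_zero]
          exact max_le (hfg _) (by positivity)
        have h5 : 1 + ‖((f p.1, p.2) : E d₁ × E d₂)‖ + ‖((g p.1, p.2) : E d₁ × E d₂)‖
            ≤ 3 + 2 * M + 2 * sq p := by linarith
        exact mul_le_mul (mul_le_mul_of_nonneg_left h5 hC) h4 (norm_nonneg _)
          (mul_nonneg hC ((by positivity : (0 : ℝ) ≤ _).trans h5))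
    _ = C * (3 + 2 * M + 2 * γ.moment) * (2 * Real.exp (2 * M) * δ) := by
        rw [integral_mul_const, integral_const_mul,
          integral_add (integrable_const _) (γ.integrable_sq.const_mul 2), integral_const_mul,
          γ.integral_sq]
        simp
    _ ≤ _ := by
        have h6 : (0 : ℝ) ≤ γ.moment := NNReal.coe_nonneg _
        -- Weakened on purpose, to share one constant with the estimate in the initial law.
        have h7 : 3 + 2 * M + 2 * (γ.moment : ℝ) ≤ 5 + 16 * M ^ 2 + 8 * γ.moment := by
          nlinarith [_root_.sq_nonneg (M - 1)]
        calc C * (3 + 2 * M + 2 * γ.moment) * (2 * Real.exp (2 * M) * δ)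
            ≤ C * (5 + 16 * M ^ 2 + 8 * γ.moment) * (2 * Real.exp (2 * M) * δ) := by gcongr
          _ = _ := by unfold lipConst; ring

/-- The local Lipschitz constant of L grows linearly, so it is square integrable under any coupling.
Cauchy-Schwarz pairs it with the transport distance. -/
theorem CostBound.integral_le_add_dist2 (hL : CostBound L C m₀) (γ₁ γ₂ : P2 d₁ d₂)
    (hf : Continuous f) (hfM : ∀ x, ‖f x - x‖ ≤ M)
    (hfl : ∀ x y, ‖f x - f y‖ ≤ 2 * Real.exp (2 * M) * ‖x - y‖) (hR₁ : γ₁.moment ≤ R)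
    (hR₂ : γ₂.moment ≤ R) :
    ∫ p, L (f p.1, p.2) ∂γ₂.toMeasure
      ≤ ∫ p, L (f p.1, p.2) ∂γ₁.toMeasure + lipConst C M R * dist2 γ₁ γ₂ := by
  have hC := hL.nonneg
  have hM : 0 ≤ M := (norm_nonneg _).trans (hfM 0)
  have hR : 0 ≤ R := (NNReal.coe_nonneg _).trans hR₁
  have hK := lipConst_nonneg (M := M) hC hR
  refine le_of_forall_pos_le_add fun δ hδ => ?_
  -- The slack is at most δ after multiplication by the Lipschitz constant; the added 1 avoids
  -- division by zero.
  obtain ⟨π, hπ, hcost⟩ := exists_coupling γ₁ γ₂ (δ := δ / (lipConst C M R + 1)) (by positivity)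
  have hprob := isProbabilityMeasure_of_mem_couplings hπ
  have hF : Continuous fun p : E d₁ × E d₂ => L (f p.1, p.2) :=
    hL.continuous.comp (by fun_prop)
  have hi₁ : Integrable (fun q : (E d₁ × E d₂) × (E d₁ × E d₂) => L (f q.1.1, q.1.2)) π := by
    have h := hL.integrable_comp γ₁ hf hfM
    rw [← hπ.1, Measure.fst] at h
    exact (integrable_map_measure hF.aestronglyMeasurable measurable_fst.aemeasurable).1 h
  have hi₂ : Integrable (fun q : (E d₁ × E d₂) × (E d₁ × E d₂) => L (f q.2.1, q.2.2)) π := by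
    have h := hL.integrable_comp γ₂ hf hfM
    rw [← hπ.2, Measure.snd] at h
    exact (integrable_map_measure hF.aestronglyMeasurable measurable_snd.aemeasurable).1 h
  set w : (E d₁ × E d₂) × (E d₁ × E d₂) → ℝ := fun q => 1 + 2 * M + ‖q.1‖ + ‖q.2‖ with hw
  have hwc : Continuous w := by fun_prop
  have hdc : Continuous fun q : (E d₁ × E d₂) × (E d₁ × E d₂) => ‖q.1 - q.2‖ := by fun_prop
  have hw0 : ∀ q, 0 ≤ w q := fun q => by simp only [hw]; positivity
  have hwle : ∀ q, w q ^ 2 ≤ 4 * (1 + 4 * M ^ 2) + 4 * sq q.1 + 4 * sq q.2 := fun q => by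
    have h1 := norm_sq_le_sq q.1
    have h2 := norm_sq_le_sq q.2
    simp only [hw]
    nlinarith [_root_.sq_nonneg (1 - 2 * M), _root_.sq_nonneg (1 - ‖q.1‖),
      _root_.sq_nonneg (1 - ‖q.2‖), _root_.sq_nonneg (2 * M - ‖q.1‖),
      _root_.sq_nonneg (2 * M - ‖q.2‖), _root_.sq_nonneg (‖q.1‖ - ‖q.2‖)]
  have hs₁ := integrable_sq_fst hπ
  have hs₂ := integrable_sq_snd hπ
  have hbi : Integrable (fun q : (E d₁ × E d₂) × (E d₁ × E d₂) =>
      4 * (1 + 4 * M ^ 2) + 4 * sq q.1 + 4 * sq q.2) π :=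
    ((integrable_const _).add (hs₁.const_mul 4)).add (hs₂.const_mul 4)
  have hwi : Integrable (fun q => w q ^ 2) π :=
    hbi.mono' (hwc.pow 2).aestronglyMeasurable (ae_of_all _ fun q => by
      rw [Real.norm_of_nonneg (by positivity)]; exact hwle q)
  have hdi : Integrable (fun q : (E d₁ × E d₂) × (E d₁ × E d₂) => ‖q.1 - q.2‖ ^ 2) π :=
    (integrable_sq_sub hπ).mono' (hdc.pow 2).aestronglyMeasurable (ae_of_all _ fun q => by
      rw [Real.norm_of_nonneg (by positivity)]; exact norm_sq_le_sq _)
  have hwint : ∫ q, w q ^ 2 ∂π ≤ 4 + 16 * M ^ 2 + 8 * R := by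
    calc _ ≤ ∫ q, (4 * (1 + 4 * M ^ 2) + 4 * sq q.1 + 4 * sq q.2) ∂π :=
          integral_mono hwi hbi hwle
      _ = 4 * (1 + 4 * M ^ 2) + 4 * γ₁.moment + 4 * γ₂.moment := by
          rw [integral_add (f := fun q : (E d₁ × E d₂) × (E d₁ × E d₂) =>
              4 * (1 + 4 * M ^ 2) + 4 * sq q.1) ((integrable_const _).add (hs₁.const_mul 4))
              (hs₂.const_mul 4),
            integral_add (integrable_const _) (hs₁.const_mul 4),
            integral_const_mul 4 fun q : (E d₁ × E d₂) × (E d₁ × E d₂) => sq q.1,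
            integral_const_mul 4 fun q : (E d₁ × E d₂) × (E d₁ × E d₂) => sq q.2,
            integral_fst_of_mem_couplings hπ continuous_sq,
            integral_snd_of_mem_couplings hπ continuous_sq, γ₁.integral_sq, γ₂.integral_sq]
          simp
      _ ≤ _ := by linarith
  have hwsqrt : √(∫ q, w q ^ 2 ∂π) ≤ 5 + 16 * M ^ 2 + 8 * R := by
    rw [Real.sqrt_le_iff]
    have h0 : 0 ≤ 16 * M ^ 2 + 8 * R := by positivity
    refine ⟨by linarith, hwint.trans ?_⟩
    nlinarith
  have hd0 := dist2_nonneg γ₁ γ₂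
  have hdsqrt : √(∫ q, ‖q.1 - q.2‖ ^ 2 ∂π) ≤ dist2 γ₁ γ₂ + δ / (lipConst C M R + 1) := by
    rw [Real.sqrt_le_iff]
    refine ⟨by positivity, le_trans ?_ hcost⟩
    exact integral_mono hdi (integrable_sq_sub hπ) fun q => norm_sq_le_sq _
  have hcs := integral_mul_le_sqrt_mul_sqrt hw0 (fun q => norm_nonneg (q.1 - q.2))
    hwc.aestronglyMeasurable hdc.aestronglyMeasurable hwi hdi
  have hprod : Integrable (fun q => w q * ‖q.1 - q.2‖) π := by
    refine (hwi.add hdi).mono' (hwc.mul hdc).aestronglyMeasurable (ae_of_all _ fun q => ?_)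
    rw [Real.norm_of_nonneg (mul_nonneg (hw0 q) (norm_nonneg _))]
    simp only [Pi.add_apply]
    nlinarith [_root_.sq_nonneg (w q - ‖q.1 - q.2‖), _root_.sq_nonneg (w q),
      _root_.sq_nonneg ‖q.1 - q.2‖]
  have hdiff : ∫ q, (L (f q.2.1, q.2.2) - L (f q.1.1, q.1.2)) ∂π
      ≤ lipConst C M R * dist2 γ₁ γ₂ + δ := by
    calc _ ≤ ∫ q, 2 * C * Real.exp (2 * M) * (w q * ‖q.1 - q.2‖) ∂π := by
          refine integral_mono (hi₂.sub hi₁) (hprod.const_mul _) fun q => ?_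
          refine (le_abs_self _).trans ((hL.lipschitz _ _).trans ?_)
          have h1 := norm_prod_le_of_norm_sub_le hfM q.1
          have h2 := norm_prod_le_of_norm_sub_le hfM q.2
          have h3 : ‖((f q.2.1, q.2.2) : E d₁ × E d₂) - (f q.1.1, q.1.2)‖
              ≤ 2 * Real.exp (2 * M) * ‖q.1 - q.2‖ := by
            have h4 : 1 ≤ Real.exp (2 * M) := Real.one_le_exp (by linarith)
            rw [Prod.mk_sub_mk, Prod.norm_mk]
            refine max_le ((hfl _ _).trans ?_) ?_
            · rw [norm_sub_rev]
              gcongr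
              exact norm_fst_le (q.1 - q.2)
            · rw [norm_sub_rev]
              have h5 : ‖q.1.2 - q.2.2‖ ≤ ‖q.1 - q.2‖ := norm_snd_le (q.1 - q.2)
              nlinarith [norm_nonneg (q.1 - q.2)]
          calc _ ≤ C * w q * (2 * Real.exp (2 * M) * ‖q.1 - q.2‖) := by
                have := hw0 q
                gcongr
                simp only [hw]
                linarith
            _ = _ := by ring
      _ = 2 * C * Real.exp (2 * M) * ∫ q, w q * ‖q.1 - q.2‖ ∂π := integral_const_mul _ _
      _ ≤ 2 * C * Real.exp (2 * M) * ((5 + 16 * M ^ 2 + 8 * R)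
            * (dist2 γ₁ γ₂ + δ / (lipConst C M R + 1))) := by
          gcongr
          exact hcs.trans (by gcongr)
      _ = lipConst C M R * dist2 γ₁ γ₂ + lipConst C M R * δ / (lipConst C M R + 1) := by
          rw [show 2 * C * Real.exp (2 * M) * ((5 + 16 * M ^ 2 + 8 * R)
            * (dist2 γ₁ γ₂ + δ / (lipConst C M R + 1)))
            = lipConst C M R * (dist2 γ₁ γ₂ + δ / (lipConst C M R + 1)) by
              rw [lipConst]; ring]
          ring
      _ ≤ _ := by
          gcongr
          rw [div_le_iff₀ (by positivity)]
          nlinarith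
  rw [integral_sub hi₂ hi₁, integral_fst_of_mem_couplings hπ hF,
    integral_snd_of_mem_couplings hπ hF] at hdiff
  linarith

theorem dist2_comm (μ ν : P2 d₁ d₂) : dist2 μ ν = dist2 ν μ := by
  have key : ∀ μ ν : P2 d₁ d₂, dist2 μ ν ≤ dist2 ν μ := fun μ ν => by
    refine le_of_forall_pos_le_add fun δ hδ => ?_
    obtain ⟨π, hπ, h⟩ := exists_coupling ν μ hδ
    have hc : Continuous fun q : (E d₁ × E d₂) × (E d₁ × E d₂) => sq (q.1 - q.2) :=
      continuous_sq.comp (by fun_prop)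
    refine dist2_le_of_coupling (by linarith [dist2_nonneg ν μ]) (π := π.map Prod.swap)
      ⟨by rw [Measure.fst_map_swap]; exact hπ.2, by rw [Measure.snd_map_swap]; exact hπ.1⟩ ?_
    rw [integral_map measurable_swap.aemeasurable hc.aestronglyMeasurable]
    refine le_trans (le_of_eq ?_) h
    refine integral_congr_ae (ae_of_all _ fun q => ?_)
    simp only [sq, Prod.fst_swap, Prod.snd_swap, Prod.fst_sub, Prod.snd_sub]
    rw [norm_sub_rev, norm_sub_rev q.2.2]
  exact le_antisymm (key μ ν) (key ν μ)

end Costs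

/-! ### The value function -/

section Value

variable {d₁ d₂ d' : ℕ} {b : E d₁ → E d' → E d₁} {B : ℝ} {ℓ : E d' → ℝ}
  {L : E d₁ × E d₂ → ℝ} {T t₀ ε : ℝ} {κ : ProbabilityTheory.Kernel ℝ (E d')}
  {Φ : ℝ → E d₁ → E d₁} {C m₀ : ℝ}

/-- The speed of the flow under the constant control `ν^∞`. -/
def priorSpeed (B : ℝ) (ℓ : E d' → ℝ) : ℝ := B * ∫ a, weight a ∂(prior ℓ)

theorem priorSpeed_nonneg (hb : GrowthBound b B) (ℓ : E d' → ℝ) : 0 ≤ priorSpeed B ℓ :=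
  mul_nonneg hb.nonneg (integral_nonneg weight_nonneg)

theorem Regularity.isTame_const (h : Regularity b ℓ L) :
    IsTame (ProbabilityTheory.Kernel.const ℝ (prior ℓ)) := by
  have := h.isProbabilityMeasure_prior
  exact ⟨inferInstance, fun _ => by simpa using h.integrable_weight_prior, fun _ _ => by simp⟩

theorem totalEntropy_eq_zero {ν : ℝ → Measure (E d')} [IsFiniteMeasure (prior ℓ)]
    (hν : ∀ r ∈ Icc t₀ T, ν r = prior ℓ) : totalEntropy ℓ T t₀ ν = 0 := by
  rw [totalEntropy, setLIntegral_congr_fun (g := fun _ => 0) measurableSet_Icc, lintegral_zero]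
  intro r hr
  simp [hν r hr]

/-- The control which follows `ν^∞` up to time `s`, and `κ` afterwards. -/
def delayed (ℓ : E d' → ℝ) (s : ℝ) (κ : ProbabilityTheory.Kernel ℝ (E d')) :
    ProbabilityTheory.Kernel ℝ (E d') :=
  open scoped Classical in
  ProbabilityTheory.Kernel.piecewise (measurableSet_Iic (a := s))
    (ProbabilityTheory.Kernel.const ℝ (prior ℓ)) κ

theorem delayed_of_le {s r : ℝ} (h : r ≤ s) : delayed ℓ s κ r = prior ℓ := by
  simp [delayed, ProbabilityTheory.Kernel.piecewise_apply, h]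

theorem delayed_of_lt {s r : ℝ} (h : s < r) : delayed ℓ s κ r = κ r := by
  simp [delayed, ProbabilityTheory.Kernel.piecewise_apply, h]

/-- The switching time belongs to the prior, so the two controls may differ at that one instant. -/
theorem ae_delayed (ℓ : E d' → ℝ) (s t : ℝ) (κ : ProbabilityTheory.Kernel ℝ (E d')) :
    ∀ᵐ r, r ∈ Icc s t → delayed ℓ s κ r = κ r := by
  filter_upwards [compl_mem_ae_iff.2 (measure_singleton s)] with r hr hr'
  exact delayed_of_lt (lt_of_le_of_ne hr'.1 (Ne.symm hr))

theorem Regularity.isTame_delayed (h : Regularity b ℓ L) (hκ : IsTame κ) (s : ℝ) :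
    IsTame (delayed ℓ s κ) := by
  have := h.isProbabilityMeasure_prior
  have := hκ.markov
  have hm : ProbabilityTheory.IsMarkovKernel (delayed ℓ s κ) := by
    unfold delayed; infer_instance
  refine ⟨hm, fun r => ?_, fun u v => ?_⟩
  · rcases le_or_gt r s with hr | hr
    · rw [delayed_of_le hr]; exact h.integrable_weight_prior
    · rw [delayed_of_lt hr]; exact hκ.integrable r
  · refine ((intervalIntegrable_const (c := ∫ a, weight a ∂(prior ℓ))).add
      (hκ.intervalIntegrable u v)).mono_fun'
      (continuous_weight.stronglyMeasurable.integral_kernel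
        (κ := delayed ℓ s κ)).aestronglyMeasurable (ae_of_all _ fun r => ?_)
    have h1 : 0 ≤ ∫ a, weight a ∂(prior ℓ) := integral_nonneg weight_nonneg
    have h2 : 0 ≤ ∫ a, weight a ∂κ r := integral_nonneg weight_nonneg
    simp only
    rw [Real.norm_of_nonneg (integral_nonneg weight_nonneg)]
    rcases le_or_gt r s with hr | hr
    · rw [delayed_of_le hr]; linarith
    · rw [delayed_of_lt hr]; linarith

theorem integral_speed_delayed_left (B : ℝ) {s t : ℝ} (hts : t ≤ s) :
    ∫ r in t..s, speed B (delayed ℓ s κ) r = priorSpeed B ℓ * (s - t) := by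
  rw [intervalIntegral.integral_congr (g := fun _ => priorSpeed B ℓ)]
  · simp [mul_comm]
  · intro r hr
    rw [uIcc_of_le hts] at hr
    simp only [speed, delayed_of_le hr.2, priorSpeed]

theorem integral_speed_delayed_right (ℓ : E d' → ℝ) (B : ℝ)
    (κ : ProbabilityTheory.Kernel ℝ (E d')) {s t : ℝ} (hst : s ≤ t) :
    ∫ r in s..t, speed B (delayed ℓ s κ) r = ∫ r in s..t, speed B κ r := by
  refine intervalIntegral.integral_congr_ae ?_
  filter_upwards [ae_delayed ℓ s t κ] with r hr hr'
  rw [uIoc_of_le hst] at hr'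
  simp only [speed, hr (Ioc_subset_Icc_self hr')]

/-- The constant control shows that the value function is at most this. -/
def costCeil (B C T : ℝ) (ℓ : E d' → ℝ) (R : ℝ) : ℝ :=
  C * (1 + 2 * R + 2 * (priorSpeed B ℓ * T) ^ 2)

/-- A bound on the displacement along near-optimal flows. -/
def displacementBound (ε B C m₀ T : ℝ) (ℓ : E d' → ℝ) (R : ℝ) : ℝ :=
  B * ((costCeil B C T ℓ R + 1 + |m₀|) / ε + expMoment ℓ 1 * T) + priorSpeed B ℓ * T

/-! ### A priori bounds and near-optimal runs -/

theorem IsRun.displacement_le (hb : GrowthBound b B) (hr : IsRun b ℓ T t₀ κ Φ) (hT : t₀ ≤ T)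
    (x : E d₁) : ‖Φ T x - x‖ ≤ ∫ r in t₀..T, speed B κ r :=
  hr.flow.norm_sub_le (hb.isCaratheodory hr.tame) (right_mem_Icc.2 hT) x

theorem IsRun.le_runCost (hL : CostBound L C m₀) (hb : GrowthBound b B)
    (hr : IsRun b ℓ T t₀ κ Φ) (hT : t₀ ≤ T) (γ : P2 d₁ d₂) :
    m₀ + ε * (totalEntropy ℓ T t₀ κ).toReal ≤ runCost ε ℓ L T t₀ γ κ Φ :=
  add_le_add_left (hL.le_integral γ (hr.flow.continuous_at T) (hr.displacement_le hb hT)) _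

theorem Regularity.bddBelow_costs (h : Regularity b ℓ L) (hL : CostBound L C m₀)
    (hb : GrowthBound b B) (hε : 0 ≤ ε) (hT : t₀ ≤ T) (γ : P2 d₁ d₂) :
    BddBelow (costs ε b ℓ L T t₀ γ) := by
  refine ⟨m₀, fun c hc => ?_⟩
  obtain ⟨κ, Φ, hr, rfl⟩ := (h.mem_costs_iff hb hT).1 hc
  have : 0 ≤ ε * (totalEntropy ℓ T t₀ κ).toReal := by positivity
  linarith [hr.le_runCost (ε := ε) hL hb hT γ]

theorem Regularity.U_le (h : Regularity b ℓ L) (hL : CostBound L C m₀)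
    (hb : GrowthBound b B) (hε : 0 ≤ ε) (hT : t₀ ≤ T) (γ : P2 d₁ d₂)
    (hr : IsRun b ℓ T t₀ κ Φ) : U ε b ℓ L T t₀ γ ≤ runCost ε ℓ L T t₀ γ κ Φ :=
  csInf_le (h.bddBelow_costs hL hb hε hT γ) ((h.mem_costs_iff hb hT).2 ⟨κ, Φ, hr, rfl⟩)

theorem Regularity.exists_le_costCeil (h : Regularity b ℓ L) (hL : CostBound L C m₀)
    (hb : GrowthBound b B) (ht : t₀ ∈ Icc 0 T) (γ : P2 d₁ d₂) :
    ∃ c ∈ costs ε b ℓ L T t₀ γ, c ≤ costCeil B C T ℓ γ.moment := by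
  have := h.isProbabilityMeasure_prior
  have hκ := h.isTame_const
  have hC := hL.nonneg
  obtain ⟨Φ, hΦ⟩ := (hb.isCaratheodory hκ).exists_isFlow ht.2
  have he : totalEntropy ℓ T t₀ (ProbabilityTheory.Kernel.const ℝ (prior ℓ)) = 0 :=
    totalEntropy_eq_zero fun r _ => by simp
  have hr : IsRun b ℓ T t₀ _ Φ := ⟨hκ, hΦ, by simp [he]⟩
  refine ⟨_, (h.mem_costs_iff hb ht.2).2 ⟨_, Φ, hr, rfl⟩, ?_⟩
  have hd : ∀ x, ‖Φ T x - x‖ ≤ priorSpeed B ℓ * T := fun x => by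
    refine (hr.displacement_le hb ht.2 x).trans ?_
    have h1 : ∫ r in t₀..T, speed B (ProbabilityTheory.Kernel.const ℝ (prior ℓ)) r
        = priorSpeed B ℓ * (T - t₀) := by
      simp only [speed, priorSpeed, ProbabilityTheory.Kernel.const_apply,
        intervalIntegral.integral_const, smul_eq_mul]
      ring
    rw [h1]
    exact mul_le_mul_of_nonneg_left (by linarith [ht.1]) (priorSpeed_nonneg hb ℓ)
  rw [runCost, he]
  simpa [costCeil] using hL.integral_le γ (hΦ.continuous_at T) hd

/-- Near-optimal controls have bounded speed. -/
theorem Regularity.exists_isRun (h : Regularity b ℓ L) (hL : CostBound L C m₀)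
    (hb : GrowthBound b B) (hε : 0 < ε) (ht : t₀ ∈ Icc 0 T) (γ : P2 d₁ d₂) {δ : ℝ} (hδ : 0 < δ)
    (hδ1 : δ ≤ 1) :
    ∃ κ Φ, IsRun b ℓ T t₀ κ Φ ∧ runCost ε ℓ L T t₀ γ κ Φ ≤ U ε b ℓ L T t₀ γ + δ ∧
      (∫ r in t₀..T, speed B κ r) + priorSpeed B ℓ * T
        ≤ displacementBound ε B C m₀ T ℓ γ.moment := by
  obtain ⟨c₀, hc₀, hc₀'⟩ := h.exists_le_costCeil (ε := ε) hL hb ht γ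
  have hU : U ε b ℓ L T t₀ γ ≤ costCeil B C T ℓ γ.moment :=
    (csInf_le (h.bddBelow_costs hL hb hε.le ht.2 γ) hc₀).trans hc₀'
  obtain ⟨c, hc, hcU⟩ := exists_lt_of_csInf_lt ⟨c₀, hc₀⟩
    (show sInf (costs ε b ℓ L T t₀ γ) < U ε b ℓ L T t₀ γ + δ from lt_add_of_pos_right _ hδ)
  obtain ⟨κ, Φ, hr, rfl⟩ := (h.mem_costs_iff hb ht.2).1 hc
  refine ⟨κ, Φ, hr, hcU.le, ?_⟩
  -- The cost is at most the ceiling plus δ ≤ 1 and at least m₀ plus ε times the entropy; this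
  -- bounds the entropy, and the entropy inequality with K = 1 then bounds the speed. The extra
  -- `priorSpeed B ℓ * T` in the conclusion leaves room for a waiting period.
  have h1 := hr.le_runCost (ε := ε) hL hb ht.2 γ
  have h2 : (totalEntropy ℓ T t₀ κ).toReal ≤ (costCeil B C T ℓ γ.moment + 1 + |m₀|) / ε := by
    rw [le_div_iff₀ hε]
    linarith [neg_abs_le m₀]
  have h3 := h.integral_weight_le hr.tame zero_le_one ht.2 hr.entropy
  have h4 : expMoment ℓ 1 * (T - t₀) ≤ expMoment ℓ 1 * T :=
    mul_le_mul_of_nonneg_left (by linarith [ht.1]) (expMoment_nonneg ℓ 1)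
  have h5 : ∫ r in t₀..T, speed B κ r = B * ∫ r in t₀..T, ∫ a, weight a ∂κ r :=
    intervalIntegral.integral_const_mul _ _
  rw [displacementBound, h5]
  gcongr
  · exact hb.nonneg
  · linarith

/-- A control nearly optimal from γ₁ is used from γ₂: the entropies agree, so only the terminal
costs are compared. -/
theorem Regularity.U_le_add_dist2 (h : Regularity b ℓ L) (hL : CostBound L C m₀)
    (hb : GrowthBound b B) (hε : 0 < ε) (ht : t₀ ∈ Icc 0 T) (γ₁ γ₂ : P2 d₁ d₂) {R : ℝ}
    (hR₁ : γ₁.moment ≤ R) (hR₂ : γ₂.moment ≤ R) :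
    U ε b ℓ L T t₀ γ₂ ≤ U ε b ℓ L T t₀ γ₁
      + lipConst C (displacementBound ε B C m₀ T ℓ γ₁.moment) R * dist2 γ₁ γ₂ := by
  refine le_of_forall_pos_le_add fun δ hδ => ?_
  obtain ⟨κ, Φ, hr, hc, hM⟩ :=
    h.exists_isRun hL hb hε ht γ₁ (lt_min hδ one_pos) (min_le_right _ _)
  have hT : 0 ≤ priorSpeed B ℓ * T := mul_nonneg (priorSpeed_nonneg hb ℓ) (ht.1.trans ht.2)
  have hM' : ∫ r in t₀..T, speed B κ r ≤ displacementBound ε B C m₀ T ℓ γ₁.moment := by linarith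
  have h1 := hL.integral_le_add_dist2 γ₁ γ₂ (hr.flow.continuous_at T)
    (fun x => (hr.displacement_le hb ht.2 x).trans hM') (fun x y => ?_) hR₁ hR₂
  · have h2 := h.U_le hL hb hε.le ht.2 γ₂ hr
    have h3 := min_le_left δ 1
    simp only [runCost] at h2 hc
    linarith
  · have h4 := (hr.flow.curve x).norm_sub_le_exp (hb.isCaratheodory hr.tame) ht.2
      (hr.flow.curve y) T (right_mem_Icc.2 ht.2)
    rw [hr.flow.init, hr.flow.init] at h4
    refine h4.trans ?_
    rw [mul_right_comm]
    gcongr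

/-- A control nearly optimal from the later time is preceded by the prior. The wait adds no entropy
and displaces points by at most the constant prior speed times its duration. -/
theorem Regularity.U_le_of_later (h : Regularity b ℓ L) (hL : CostBound L C m₀)
    (hb : GrowthBound b B) (hε : 0 < ε) {t₁ t₂ : ℝ} (ht₁ : 0 ≤ t₁) (ht : t₁ ≤ t₂) (ht₂ : t₂ ≤ T)
    (γ : P2 d₁ d₂) :
    U ε b ℓ L T t₁ γ ≤ U ε b ℓ L T t₂ γ
      + lipConst C (displacementBound ε B C m₀ T ℓ γ.moment) γ.moment
        * (priorSpeed B ℓ * (t₂ - t₁)) := by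
  have := h.isProbabilityMeasure_prior
  refine le_of_forall_pos_le_add fun δ hδ => ?_
  obtain ⟨κ, Φ, hr, hc, hM⟩ :=
    h.exists_isRun hL hb hε ⟨ht₁.trans ht, ht₂⟩ γ (lt_min hδ one_pos) (min_le_right _ _)
  set H := displacementBound ε B C m₀ T ℓ γ.moment
  have hp := priorSpeed_nonneg hb ℓ
  have hκ' := h.isTame_delayed hr.tame t₂
  have hV' := hb.isCaratheodory hκ'
  have hV := hb.isCaratheodory hr.tame
  obtain ⟨Ψ, hΨ⟩ := hV'.exists_isFlow (ht.trans ht₂)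
  have he₁ : totalEntropy ℓ t₂ t₁ (delayed ℓ t₂ κ) = 0 :=
    totalEntropy_eq_zero fun r hr => delayed_of_le hr.2
  have he : totalEntropy ℓ T t₁ (delayed ℓ t₂ κ) = totalEntropy ℓ T t₂ κ := by
    rw [totalEntropy_add ht ht₂, he₁, zero_add, totalEntropy_congr (ae_delayed ℓ t₂ T κ)]
  have hr' : IsRun b ℓ T t₁ (delayed ℓ t₂ κ) Ψ := ⟨hκ', hΨ, by rw [he]; exact hr.entropy⟩
  have hs : ∫ r in t₁..T, speed B (delayed ℓ t₂ κ) r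
      = priorSpeed B ℓ * (t₂ - t₁) + ∫ r in t₂..T, speed B κ r := by
    rw [← intervalIntegral.integral_add_adjacent_intervals (hV'.intervalIntegrable t₁ t₂)
      (hV'.intervalIntegrable t₂ T), integral_speed_delayed_left B ht,
      integral_speed_delayed_right ℓ B κ ht₂]
  have hp' : priorSpeed B ℓ * (t₂ - t₁) ≤ priorSpeed B ℓ * T :=
    mul_le_mul_of_nonneg_left (by linarith) hp
  have hpT : 0 ≤ priorSpeed B ℓ * T := mul_nonneg hp (by linarith)
  have h1 := hL.abs_integral_sub_le γ (f := Ψ T) (g := Φ T) (M := H)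
    (δ := priorSpeed B ℓ * (t₂ - t₁)) (hΨ.continuous_at T) (hr.flow.continuous_at T)
    (fun x => (hr'.displacement_le hb (ht.trans ht₂) x).trans (by rw [hs]; linarith))
    (fun x => (hr.displacement_le hb ht₂ x).trans (by linarith)) (fun x => ?_)
  · have h2 := h.U_le hL hb hε.le (ht.trans ht₂) γ hr'
    have h3 := min_le_left δ 1
    have h4 := le_of_abs_le h1
    simp only [runCost, he] at h2 hc
    linarith
  · have h5 := (((hΨ.curve x).mono_left hV' ⟨ht, ht₂⟩).congr
      ((ae_delayed ℓ t₂ T κ).mono fun r hr' hrI => by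
        rw [hr' hrI])).norm_sub_le_exp hV ht₂ (hr.flow.curve x) T (right_mem_Icc.2 ht₂)
    have h6 := (hΨ.curve x).norm_sub_le hV' (left_mem_Icc.2 (ht.trans ht₂)) ⟨ht, ht₂⟩ ht
    rw [hΨ.init, integral_speed_delayed_left B ht] at h6
    rw [hr.flow.init] at h5
    refine h5.trans ?_
    rw [mul_right_comm]
    gcongr
    linarith

/-- The control is restricted to [t₂, T]. The displacement it caused on [t₁, t₂] may be far larger
than t₂ - t₁, but the corresponding loss in terminal cost is compensated by the entropy no longer
paid there, up to a multiple of t₂ - t₁. -/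
theorem Regularity.U_le_of_earlier (h : Regularity b ℓ L) (hL : CostBound L C m₀)
    (hb : GrowthBound b B) (hε : 0 < ε) {t₁ t₂ : ℝ} (ht₁ : 0 ≤ t₁) (ht : t₁ ≤ t₂) (ht₂ : t₂ ≤ T)
    (γ : P2 d₁ d₂) :
    U ε b ℓ L T t₂ γ ≤ U ε b ℓ L T t₁ γ
      + ε * expMoment ℓ
          (lipConst C (displacementBound ε B C m₀ T ℓ γ.moment) γ.moment * B / ε)
        * (t₂ - t₁) := by
  refine le_of_forall_pos_le_add fun δ hδ => ?_
  obtain ⟨κ, Φ, hr, hc, hM⟩ :=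
    h.exists_isRun hL hb hε ⟨ht₁, ht.trans ht₂⟩ γ (lt_min hδ one_pos) (min_le_right _ _)
  set H := displacementBound ε B C m₀ T ℓ γ.moment
  set K := lipConst C H γ.moment
  have hK : 0 ≤ K := lipConst_nonneg hL.nonneg (NNReal.coe_nonneg _)
  have hB := hb.nonneg
  have hp := priorSpeed_nonneg hb ℓ
  have hV := hb.isCaratheodory hr.tame
  obtain ⟨Ψ, hΨ⟩ := hV.exists_isFlow ht₂
  have hadd := totalEntropy_add (ℓ := ℓ) ht ht₂ κ
  have hfin := hr.entropy
  rw [hadd, ENNReal.add_ne_top] at hfin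
  have hr' : IsRun b ℓ T t₂ κ Ψ := ⟨hr.tame, hΨ, hfin.2⟩
  have hadd' : (totalEntropy ℓ T t₁ κ).toReal
      = (totalEntropy ℓ t₂ t₁ κ).toReal + (totalEntropy ℓ T t₂ κ).toReal := by
    rw [hadd, ENNReal.toReal_add hfin.1 hfin.2]
  have hsplit := intervalIntegral.integral_add_adjacent_intervals (hV.intervalIntegrable t₁ t₂)
    (hV.intervalIntegrable t₂ T)
  have hμ : 0 ≤ ∫ r in t₁..t₂, speed B κ r :=
    intervalIntegral.integral_nonneg ht fun r _ => hV.nonneg r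
  have hpT : 0 ≤ priorSpeed B ℓ * T := mul_nonneg hp (by linarith)
  have hM₂ : ∫ r in t₂..T, speed B κ r ≤ H := by linarith
  have h1 := hL.abs_integral_sub_le γ (f := Φ T) (g := Ψ T) (M := H)
    (δ := ∫ r in t₁..t₂, speed B κ r) (hr.flow.continuous_at T) (hΨ.continuous_at T)
    (fun x => (hr.displacement_le hb (ht.trans ht₂) x).trans (by linarith))
    (fun x => (hr'.displacement_le hb ht₂ x).trans hM₂) (fun x => ?_)
  · have h2 := h.U_le hL hb hε.le ht₂ γ hr'
    have h3 := min_le_left δ 1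
    have h4 := neg_le_of_abs_le h1
    -- With this scale, multiplying by ε turns the left side into exactly K times the displacement
    -- bound, and the entropy on the right into the term that cancels in the cost.
    have h5 := h.integral_weight_le hr.tame (K := K * B / ε) (by positivity) ht hfin.1
    have h6 : ∫ r in t₁..t₂, speed B κ r = B * ∫ r in t₁..t₂, ∫ a, weight a ∂κ r :=
      intervalIntegral.integral_const_mul _ _
    have h7 : K * ∫ r in t₁..t₂, speed B κ r
        ≤ ε * ((totalEntropy ℓ t₂ t₁ κ).toReal + expMoment ℓ (K * B / ε) * (t₂ - t₁)) := by
      refine le_trans (le_of_eq ?_) (mul_le_mul_of_nonneg_left h5 hε.le)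
      rw [h6]
      field_simp
    simp only [runCost, hadd'] at h2 hc
    linarith
  · have h5 := ((hr.flow.curve x).mono_left hV ⟨ht, ht₂⟩).norm_sub_le_exp hV ht₂ (hΨ.curve x) T
      (right_mem_Icc.2 ht₂)
    have h6 := (hr.flow.curve x).norm_sub_le hV (left_mem_Icc.2 (ht.trans ht₂)) ⟨ht, ht₂⟩ ht
    rw [hr.flow.init] at h6
    rw [hΨ.init] at h5
    refine h5.trans ?_
    rw [mul_right_comm]
    gcongr

/-- The local Lipschitz constant of the value function. -/
def valueLip (ε B C m₀ T : ℝ) (ℓ : E d' → ℝ) (R : ℝ) : ℝ :=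
  lipConst C (displacementBound ε B C m₀ T ℓ R) R * (1 + priorSpeed B ℓ)
    + ε * expMoment ℓ (lipConst C (displacementBound ε B C m₀ T ℓ R) R * B / ε)

theorem displacementBound_mono (hL : CostBound L C m₀) (hb : GrowthBound b B) (hε : 0 < ε)
    {R R' : ℝ} (hRR : R ≤ R') :
    displacementBound ε B C m₀ T ℓ R ≤ displacementBound ε B C m₀ T ℓ R' := by
  have := hL.nonneg
  have := hb.nonneg
  unfold displacementBound costCeil
  gcongr

theorem displacementBound_nonneg (hL : CostBound L C m₀) (hb : GrowthBound b B) (hε : 0 < ε)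
    (hT : 0 ≤ T) {R : ℝ} (hR : 0 ≤ R) : 0 ≤ displacementBound ε B C m₀ T ℓ R := by
  have := hL.nonneg
  have := hb.nonneg
  have := priorSpeed_nonneg hb ℓ
  have := expMoment_nonneg ℓ 1
  unfold displacementBound costCeil
  positivity

theorem lipConst_displacementBound_mono (hL : CostBound L C m₀) (hb : GrowthBound b B)
    (hε : 0 < ε) (hT : 0 ≤ T) {R R' : ℝ} (hR : 0 ≤ R) (hRR : R ≤ R') :
    lipConst C (displacementBound ε B C m₀ T ℓ R) R
      ≤ lipConst C (displacementBound ε B C m₀ T ℓ R') R' :=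
  lipConst_mono hL.nonneg (displacementBound_nonneg hL hb hε hT hR) hR
    (displacementBound_mono hL hb hε hRR) hRR

theorem Regularity.valueLip_mono (h : Regularity b ℓ L) (hL : CostBound L C m₀)
    (hb : GrowthBound b B) (hε : 0 < ε) (hT : 0 ≤ T) {R R' : ℝ} (hR : 0 ≤ R) (hRR : R ≤ R') :
    valueLip ε B C m₀ T ℓ R ≤ valueLip ε B C m₀ T ℓ R' := by
  have h1 := lipConst_displacementBound_mono (ℓ := ℓ) hL hb hε hT hR hRR
  have hB := hb.nonneg
  have hp := priorSpeed_nonneg hb ℓ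
  exact add_le_add (mul_le_mul_of_nonneg_right h1 (by positivity))
    (mul_le_mul_of_nonneg_left (h.expMoment_mono (by gcongr)) hε.le)

theorem Regularity.abs_U_sub_le (h : Regularity b ℓ L) (hL : CostBound L C m₀)
    (hb : GrowthBound b B) (hε : 0 < ε) {t₁ t₂ : ℝ} (ht₁ : t₁ ∈ Icc 0 T) (ht₂ : t₂ ∈ Icc 0 T)
    (γ₁ γ₂ : P2 d₁ d₂) {R : ℝ} (hR₁ : γ₁.moment ≤ R) (hR₂ : γ₂.moment ≤ R) :
    |U ε b ℓ L T t₂ γ₂ - U ε b ℓ L T t₁ γ₁|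
      ≤ valueLip ε B C m₀ T ℓ R * (|t₂ - t₁| + dist2 γ₁ γ₂) := by
  have hT : 0 ≤ T := ht₁.1.trans ht₁.2
  have hR : 0 ≤ R := (NNReal.coe_nonneg _).trans hR₁
  have hB := hb.nonneg
  have hp := priorSpeed_nonneg hb ℓ
  have hC := hL.nonneg
  have hK : ∀ R, 0 ≤ R → 0 ≤ lipConst C (displacementBound ε B C m₀ T ℓ R) R := fun R hR =>
    lipConst_nonneg hC hR
  have hKR := hK R hR
  have hE := mul_nonneg hε.le
    (expMoment_nonneg ℓ (lipConst C (displacementBound ε B C m₀ T ℓ R) R * B / ε))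
  have hv : valueLip ε B C m₀ T ℓ R
      = lipConst C (displacementBound ε B C m₀ T ℓ R) R
        + lipConst C (displacementBound ε B C m₀ T ℓ R) R * priorSpeed B ℓ
        + ε * expMoment ℓ (lipConst C (displacementBound ε B C m₀ T ℓ R) R * B / ε) := by
    unfold valueLip; ring
  have hspace : ∀ (t : ℝ) (γ γ' : P2 d₁ d₂), t ∈ Icc 0 T → γ.moment ≤ R → γ'.moment ≤ R →
      U ε b ℓ L T t γ' ≤ U ε b ℓ L T t γ + valueLip ε B C m₀ T ℓ R * dist2 γ γ' := by
    intro t γ γ' ht hγ hγ'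
    have h1 := h.U_le_add_dist2 hL hb hε ht γ γ' hγ hγ'
    have hd := dist2_nonneg γ γ'
    have h2 : lipConst C (displacementBound ε B C m₀ T ℓ γ.moment) R
        ≤ valueLip ε B C m₀ T ℓ R := by
      refine (lipConst_mono hC (displacementBound_nonneg hL hb hε hT (NNReal.coe_nonneg _)) hR
        (displacementBound_mono hL hb hε hγ) le_rfl).trans ?_
      rw [hv]
      linarith [mul_nonneg hKR hp]
    linarith [mul_le_mul_of_nonneg_right h2 hd]
  have htime : ∀ (s t : ℝ) (γ : P2 d₁ d₂), s ∈ Icc 0 T → t ∈ Icc 0 T → γ.moment ≤ R →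
      U ε b ℓ L T t γ ≤ U ε b ℓ L T s γ + valueLip ε B C m₀ T ℓ R * |t - s| := by
    intro s t γ hs ht hγ
    have hmono := lipConst_displacementBound_mono (ℓ := ℓ) hL hb hε hT
      (NNReal.coe_nonneg γ.moment) hγ
    rcases le_total s t with hst | hts
    · have h1 := h.U_le_of_earlier hL hb hε hs.1 hst ht.2 γ
      rw [abs_of_nonneg (sub_nonneg.2 hst)]
      have h2 : ε * expMoment ℓ
          (lipConst C (displacementBound ε B C m₀ T ℓ γ.moment) γ.moment * B / ε)
          ≤ valueLip ε B C m₀ T ℓ R := by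
        refine (mul_le_mul_of_nonneg_left (h.expMoment_mono (by gcongr)) hε.le).trans
          (le_add_of_nonneg_left (mul_nonneg hKR (by positivity)))
      linarith [mul_le_mul_of_nonneg_right h2 (sub_nonneg.2 hst)]
    · have h1 := h.U_le_of_later hL hb hε ht.1 hts hs.2 γ
      rw [abs_sub_comm, abs_of_nonneg (sub_nonneg.2 hts)]
      have h2 : lipConst C (displacementBound ε B C m₀ T ℓ γ.moment) γ.moment * priorSpeed B ℓ
          ≤ valueLip ε B C m₀ T ℓ R := by
        rw [hv]
        linarith [mul_le_mul_of_nonneg_right hmono hp]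
      linarith [mul_le_mul_of_nonneg_right h2 (sub_nonneg.2 hts)]
  -- Both inequalities pass through the intermediate point (t₁, γ₂).
  rw [abs_sub_le_iff, mul_add]
  have h1 := htime t₁ t₂ γ₂ ht₁ ht₂ hR₂
  have h2 := hspace t₁ γ₁ γ₂ ht₁ hR₁ hR₂
  have h3 := htime t₂ t₁ γ₂ ht₂ ht₁ hR₂
  have h4 := hspace t₁ γ₂ γ₁ ht₁ hR₂ hR₁
  rw [abs_sub_comm] at h3
  rw [dist2_comm] at h4
  constructor <;> linarith

end Value

end MeanFieldResNet

end

/-! ### The main theorem -/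

theorem mainTheorem9 (d₁ d₂ d' : ℕ) (T ε : ℝ) (hT : 0 < T) (hε : 0 < ε)
    (b : MeanFieldResNet.E d₁ → MeanFieldResNet.E d' → MeanFieldResNet.E d₁)
    (ℓ : MeanFieldResNet.E d' → ℝ)
    (L : MeanFieldResNet.E d₁ × MeanFieldResNet.E d₂ → ℝ)
    (hreg : MeanFieldResNet.Regularity b ℓ L) :
    -- the infimum defining `U` is a genuine real infimum
    (∀ t ∈ Icc 0 T, ∀ γ : MeanFieldResNet.P2 d₁ d₂,
      (MeanFieldResNet.costs ε b ℓ L T t γ).Nonempty ∧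
        BddBelow (MeanFieldResNet.costs ε b ℓ L T t γ)) ∧
    -- `U` is locally Lipschitz on `[0, T] × 𝒫₂`
    (∀ t₀ ∈ Icc 0 T, ∀ γ₀ : MeanFieldResNet.P2 d₁ d₂, ∃ r > (0 : ℝ), ∃ K : ℝ,
      ∀ t₁ ∈ Icc 0 T, ∀ t₂ ∈ Icc 0 T, ∀ γ₁ γ₂ : MeanFieldResNet.P2 d₁ d₂,
        |t₁ - t₀| + MeanFieldResNet.dist2 γ₁ γ₀ < r →
        |t₂ - t₀| + MeanFieldResNet.dist2 γ₂ γ₀ < r →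
        |MeanFieldResNet.U ε b ℓ L T t₂ γ₂ - MeanFieldResNet.U ε b ℓ L T t₁ γ₁|
          ≤ K * (|t₂ - t₁| + MeanFieldResNet.dist2 γ₁ γ₂)) ∧
    -- the quantitative bound
    (∃ Λ : ℝ≥0 → ℝ≥0, Monotone Λ ∧
      ∀ t₁ ∈ Icc 0 T, ∀ t₂ ∈ Icc 0 T, ∀ γ₁ γ₂ : MeanFieldResNet.P2 d₁ d₂,
        |MeanFieldResNet.U ε b ℓ L T t₂ γ₂ - MeanFieldResNet.U ε b ℓ L T t₁ γ₁|
          ≤ (max (Λ γ₁.moment) (Λ γ₂.moment) : ℝ≥0) *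
            (|t₂ - t₁| + MeanFieldResNet.dist2 γ₁ γ₂)) := by
  obtain ⟨B, hb⟩ := hreg.exists_growthBound
  obtain ⟨C, m₀, hL⟩ := hreg.exists_costBound
  refine ⟨fun t ht γ => ⟨?_, hreg.bddBelow_costs hL hb hε.le ht.2 γ⟩, fun t₀ _ γ₀ => ?_, ?_⟩
  · obtain ⟨c, hc, -⟩ := hreg.exists_le_costCeil (ε := ε) hL hb ht γ
    exact ⟨c, hc⟩
  -- On the ball of radius 1 around γ₀ all second moments are at most twice that of γ₀ plus 2.
  · refine ⟨1, one_pos, MeanFieldResNet.valueLip ε B C m₀ T ℓ (2 * γ₀.moment + 2 * 1 ^ 2),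
      fun t₁ ht₁ t₂ ht₂ γ₁ γ₂ h₁ h₂ => ?_⟩
    exact hreg.abs_U_sub_le hL hb hε ht₁ ht₂ γ₁ γ₂
      (MeanFieldResNet.moment_le_of_dist2 γ₁ γ₀ (by linarith [abs_nonneg (t₁ - t₀)]))
      (MeanFieldResNet.moment_le_of_dist2 γ₂ γ₀ (by linarith [abs_nonneg (t₂ - t₀)]))
  · have hmono : Monotone fun R : ℝ≥0 =>
        (MeanFieldResNet.valueLip ε B C m₀ T ℓ (R : ℝ)).toNNReal := fun R R' hRR =>
      Real.toNNReal_mono (hreg.valueLip_mono hL hb hε hT.le R.coe_nonneg (by exact_mod_cast hRR))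
    refine ⟨_, hmono, fun t₁ ht₁ t₂ ht₂ γ₁ γ₂ => ?_⟩
    -- Monotonicity lets a single bound R, the larger of the two moments, serve for both laws.
    rw [← hmono.map_max]
    refine (hreg.abs_U_sub_le hL hb hε ht₁ ht₂ γ₁ γ₂
      (R := ((max γ₁.moment γ₂.moment : ℝ≥0) : ℝ)) (by exact_mod_cast le_max_left _ _)
      (by exact_mod_cast le_max_right _ _)).trans ?_
    exact mul_le_mul_of_nonneg_right (Real.le_coe_toNNReal _)
      (add_nonneg (abs_nonneg _) (MeanFieldResNet.dist2_nonneg _ _))
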